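/- Let $T=\mathbb{G}_m^n$ be a torus over $\mathbb{C}$ with character lattice $M$, let $X$ be a complete normal toric $T$-variety over $\mathbb{C}$ of dimension $n$ (so $\mathbb{C}(X)=\mathbb{C}(T)$, and each $u\in M$ gives a rational function $\chi^u$ on $X$), and let $L$ be an ample $\mathbb{Q}$-Cartier $\mathbb{Q}$-divisor on $X$ (an ample $\mathbb{Q}$-line bundle). Let $D_0$ be a $T$-invariant $\mathbb{Q}$-divisor with $D_0\sim_{\mathbb{Q}}L$, let $$P=\{u\in M_{\mathbb{R}} : \langle u,\mathrm{ord}_{E}\rangle+\mathrm{ord}_E(D_0)\ge 0 \text{ for all $T$-invariant prime divisors } E\},$$ where $\langle\,\cdot\,,\mathrm{ord}_E\rangle$ is the linear extension of $u\mapsto\mathrm{ord}_E(\chi^u)$, and let $\bar u$ be the barycenter of $P$ with respect to Lebesgue measure. For $m\ge 1$ put $$D_m=D_0+\frac1{N_m}\sum_{u\in mP\cap M}\frac1m\,\mathrm{div}(\chi^u),\qquad N_m=\#(mP\cap M).$$ For a nontrivial divisorial valuation $v=c\cdot\mathrm{ord}_E$ ($c>0$, $E$ a prime divisor on a normal variety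 $Y$ with a proper birational morphism $Y\to X$) and a $\mathbb{Q}$-Cartier divisor $D$, let $v(D)$ be the value of $v$ at a local equation of $D$ (that is, $v(g)/r$ for a local equation $g$ of $rD$ at the center of $v$). An $m$-basis type divisor of $L$ is a divisor $\frac1{mN}\sum_{j=1}^N(\mathrm{div}(s_j)+mL)$ for a basis $s_1,\dots,s_N$ of $H^0(X,mL)\ne0$; $S_m(v)$ is the maximum of $v(D)$ over all $m$-basis type divisors $D$ of $L$, and $S(v)=\lim_{m\to\infty}S_m(v)$, the limit being over those $m$ for which $mL$ is Cartier. Let $\mathrm{DivVal}^{T,\circ}_X$ be the set of nontrivial divisorial valuations on $X$ that are $T$-invariant. Then: 1. $\bar u$ is rational, so that $D^T_L=D_0+\frac1{m'}\mathrm{div}(\chi^{m'\bar u})$ is defined, where $m'\ge1$ is any integer with $m'\bar u\in M$. 2. For all sufficiently divisible $m\geq 1$ (that is, for all positive multiples $m$ of some $r\ge1$), $D_m$ is an $m$-basis type divisor of $L$ and, for every $v\in\mathrm{DivVal}^{T,\circ}_X$, it attains the maximum defining $S_m(v)$: $S_m(v)=v(D_m)$. 3. For every $v\in\mathrm{DivVal}^{T,\circ}_X$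 the limit defining $S(v)$ exists and $S(v)=v(D^T_L)$. 4. Suppose that $K_X$ is $\mathbb{Q}$-Cartier, let $A_X$ denote the log discrepancy, and let $\delta_T(L)=\inf_{v\in\mathrm{DivVal}^{T,\circ}_X}A_X(v)/S(v)$. Then $$\delta_T(L)=\inf_{v\in\mathrm{DivVal}^{T,\circ}_X}\frac{A_X(v)}{v(D^T_L)},$$ where a quotient with non-positive denominator is read as $+\infty$. -/

import Mathlib

open CategoryTheory AlgebraicGeometry MeasureTheory Filter Topology Order
open MonoidalCategory CartesianMonoidalCategory
open scoped KaehlerDifferential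

noncomputable section

namespace ToricStability

/-! ### Varieties over the complex numbers, function fields -/

/-- `Spec ℂ`. -/
abbrev SpecC : Scheme.{0} := Spec (CommRingCat.of ℂ)

/-- A scheme is normal if all its local rings are integrally closed domains (the schemes below are
integral, so the local rings are domains anyway). -/
class IsNormalScheme (X : Scheme.{0}) : Prop where
  stalk_isIntegrallyClosed : ∀ x : X, IsIntegrallyClosed (X.presheaf.stalk x)

/-- The function field of a scheme over `ℂ` is a `ℂ`-algebra. -/
instance functionFieldAlgebra (X : Scheme.{0}) [X.Over SpecC] [IsIntegral X] :
    Algebra ℂ X.functionField :=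
  ((Scheme.ΓSpecIso (CommRingCat.of ℂ)).inv ≫ (X ↘ SpecC).appTop ≫
    X.presheaf.germ ⊤ (genericPoint X) trivial).hom.toAlgebra

theorem map_genericPoint {X Y : Scheme.{0}} [IsIntegral X] [IsIntegral Y] (f : Y ⟶ X)
    [IsDominant f] : f (genericPoint Y) = genericPoint X := by
  apply ((genericPoint_spec X).eq _).symm
  have h := (genericPoint_spec Y).image f.continuous
  rwa [Set.image_univ, f.denseRange.closure_range] at h

/-- The pull-back of rational functions along a dominant morphism. -/
def pullback {X Y : Scheme.{0}} [IsIntegral X] [IsIntegral Y] (f : Y ⟶ X) [IsDominant f] :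
    X.functionField →+* Y.functionField :=
  (X.presheaf.stalkSpecializes (specializes_of_eq (map_genericPoint f)) ≫
    f.stalkMap (genericPoint Y)).hom

/-! ### Divisors

The prime divisors of a normal variety `X` are represented by their generic points, that is, by the
points `x` of `X` with `coheight x = 1`; Mathlib's `Scheme.ord f x` is the order of vanishing of the
rational function `f` along the prime divisor `x` (it is `0` if `coheight x ≠ 1`). -/

section Divisors

variable {X : Scheme.{0}} [IsIntegral X] [IsLocallyNoetherian X]

theorem stalk_isDiscreteValuationRing [IsNormalScheme X] {x : X} (hx : coheight x = 1) :
    IsDiscreteValuationRing (X.presheaf.stalk x) := by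
  have hdim : ringKrullDim (X.presheaf.stalk x) = 1 := by
    rw [ringKrullDim_stalk_eq_coheight, hx]; rfl
  have hf : ¬ IsField (X.presheaf.stalk x) := by
    intro h
    rw [ringKrullDim_eq_zero_of_isField h] at hdim
    exact zero_ne_one hdim
  have : Ring.KrullDimLE 1 (X.presheaf.stalk x) := krullDimLE_of_coheight_le hx.le
  have := IsNormalScheme.stalk_isIntegrallyClosed x
  have key := (IsDiscreteValuationRing.TFAE (X.presheaf.stalk x) hf).out 0 3
  refine key.mpr
    ⟨inferInstance, IsLocalRing.maximalIdeal _,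
      ⟨IsLocalRing.isField_iff_maximalIdeal_eq.not.mp hf, inferInstance⟩, fun P hP => ?_⟩
  exact IsLocalRing.eq_maximalIdeal (hP.2.isMaximal_of_ne_bot hP.1)

/-- A `ℚ`-divisor, given by its coefficients at the points of `X`. It is only ever considered under
a hypothesis which forces it to be (a multiple of) the divisor of a rational function locally on
`X`, so that it is supported at points of codimension one, with locally finite support. -/
abbrev QDivisor (X : Scheme.{0}) := X → ℚ

/-- The principal divisor `div f`. -/
def div (f : X.functionField) : QDivisor X := fun x => (Scheme.ord f x : ℚ)

/-- `g` is a local equation of the divisor `D` at the point `ξ`. -/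
def IsLocalEquation (D : QDivisor X) (ξ : X) (g : X.functionField) : Prop :=
  g ≠ 0 ∧ ∃ U : X.Opens, ξ ∈ U ∧ ∀ y ∈ U, div g y = D y

/-- `D` is an (integral) Cartier divisor. -/
def IsCartier (D : QDivisor X) : Prop := ∀ ξ : X, ∃ g, IsLocalEquation D ξ g

/-- `D` is a `ℚ`-Cartier `ℚ`-divisor. -/
def IsQCartier (D : QDivisor X) : Prop := ∃ r : ℕ, 0 < r ∧ IsCartier (r • D)

/-- `ℚ`-linear equivalence of `ℚ`-divisors. -/
def QLinEquiv (D E : QDivisor X) : Prop :=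
  ∃ r : ℕ, 0 < r ∧ ∃ f : X.functionField, f ≠ 0 ∧ r • D = r • E + div f

theorem div_smul [X.Over SpecC] {c : ℂ} (hc : c ≠ 0) {f : X.functionField} (hf : f ≠ 0) :
    div (c • f) = div f := by
  let c' : Γ(X, ⊤) := (X ↘ SpecC).appTop ((Scheme.ΓSpecIso (CommRingCat.of ℂ)).inv c)
  have hu : IsUnit c' := (((isUnit_iff_ne_zero.mpr hc).map
    (Scheme.ΓSpecIso (CommRingCat.of ℂ)).inv.hom).map (X ↘ SpecC).appTop.hom)
  have : Nonempty (⊤ : X.Opens) := ⟨⟨genericPoint X, trivial⟩⟩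
  have hc' : algebraMap ℂ X.functionField c = X.germToFunctionField ⊤ c' := rfl
  have h0 : X.germToFunctionField ⊤ c' ≠ 0 := by
    rw [← hc']; exact (map_ne_zero _).mpr hc
  funext x
  rw [div, div, Algebra.smul_def, hc', Scheme.ord_mul h0 hf,
    Scheme.ord_of_isUnit (x := x) hu trivial, zero_add]

/-- The space of global sections `H⁰(X, D)`: the rational functions `f` with `f = 0` or
`div f + D ≥ 0`. -/
def H0 [X.Over SpecC] [IsNormalScheme X] (D : QDivisor X) : Submodule ℂ X.functionField where
  carrier := {f | f = 0 ∨ ∀ x : X, coheight x = 1 → 0 ≤ div f x + D x}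
  zero_mem' := Or.inl rfl
  add_mem' := by
    rintro f g (rfl | hf) (rfl | hg)
    · exact Or.inl (add_zero 0)
    · exact Or.inr (by rwa [zero_add])
    · exact Or.inr (by rwa [add_zero])
    · by_cases h : f + g = 0
      · exact Or.inl h
      · refine Or.inr fun x hx => ?_
        have := stalk_isDiscreteValuationRing hx
        have h1 := hf x hx
        have h2 := hg x hx
        have h3 : (min (Scheme.ord f x) (Scheme.ord g x) : ℤ) ≤ Scheme.ord (f + g) x :=
          Scheme.ord_add h
        simp only [div] at *
        rcases min_le_iff.mp h3 with h4 | h4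
        · have : (Scheme.ord f x : ℚ) ≤ Scheme.ord (f + g) x := by exact_mod_cast h4
          linarith
        · have : (Scheme.ord g x : ℚ) ≤ Scheme.ord (f + g) x := by exact_mod_cast h4
          linarith
  smul_mem' := by
    rintro c f (rfl | hf)
    · exact Or.inl (smul_zero c)
    · by_cases hc : c = 0
      · exact Or.inl (by rw [hc, zero_smul])
      by_cases hf0 : f = 0
      · exact Or.inl (by rw [hf0, smul_zero])
      refine Or.inr fun x hx => ?_
      rw [div_smul hc hf0]
      exact hf x hx

/-- The `ℚ`-divisor `D` is ample: it has a positive multiple `r D` which is Cartier, and for every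
point `ξ` there is a section `s` of some positive multiple `k r D` such that the locus where `s`
does not vanish, i.e. the complement of the support of `div s + k r D`, is affine and contains `ξ`.
-/
def IsAmple [X.Over SpecC] [IsNormalScheme X] (D : QDivisor X) : Prop :=
  ∃ r : ℕ, 0 < r ∧ IsCartier (r • D) ∧
    ∀ ξ : X, ∃ k : ℕ, 0 < k ∧ ∃ s ∈ H0 ((k * r) • D), s ≠ 0 ∧
      ∃ U : X.Opens, IsAffineOpen U ∧ ξ ∈ U ∧
        ∀ y : X, y ∈ U ↔ ∀ z : X, z ⤳ y → div s z + ((k * r) • D) z = 0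

/-! ### Divisorial valuations

A real valuation of the function field is given by its values on nonzero rational functions; the
value at `0` is set to `0` and carries no meaning. -/

/-- `v` is a (nontrivial) divisorial valuation on `X`: there are a normal variety `Y`, a proper
birational morphism `π : Y ⟶ X`, a prime divisor `E` of `Y` and `c > 0` such that `v = c ord_E`. -/
def IsDivisorial (v : X.functionField → ℝ) : Prop :=
  ∃ (Y : Scheme.{0}) (_ : IsIntegral Y) (_ : IsLocallyNoetherian Y) (_ : IsNormalScheme Y)
    (π : Y ⟶ X) (_ : IsDominant π) (E : Y) (c : ℝ),
    IsProper π ∧ Function.Bijective (pullback π) ∧ coheight E = 1 ∧ 0 < c ∧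
      ∀ f, v f = c * (Scheme.ord (pullback π f) E : ℝ)

/-- `ξ` is the center of `v` on `X`: the valuation ring of `v` dominates the local ring at `ξ`. -/
def IsCenter (v : X.functionField → ℝ) (ξ : X) : Prop :=
  ∀ a : X.presheaf.stalk ξ, a ≠ 0 →
    0 ≤ v (algebraMap _ X.functionField a) ∧
      (0 < v (algebraMap _ X.functionField a) ↔
        a ∈ IsLocalRing.maximalIdeal (X.presheaf.stalk ξ))

/-- The value `v(D)` of a divisorial valuation at a `ℚ`-Cartier `ℚ`-divisor: if `g` is a local
equation of `r D` at the center of `v`, then `v(D) = v(g) / r`. (For a divisorial valuation and a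
`ℚ`-Cartier `D` the set below has exactly one element.) -/
def valDiv (v : X.functionField → ℝ) (D : QDivisor X) : ℝ :=
  sSup {t : ℝ | ∃ (ξ : X) (r : ℕ) (g : X.functionField),
    IsCenter v ξ ∧ 0 < r ∧ IsLocalEquation (r • D) ξ g ∧ t = v g / r}

/-! ### The invariants `S_m` and `S` -/

section SInvariant

variable [X.Over SpecC] [IsNormalScheme X]

/-- `D` is an `m`-basis type `ℚ`-divisor of `L`:
`D = (1 / (m N)) ∑_j (div s_j + m L)` for a basis `s_1, …, s_N` of `H⁰(X, m L)`, `N > 0`. -/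
def IsBasisType (L : QDivisor X) (m : ℕ) (D : QDivisor X) : Prop :=
  ∃ (N : ℕ) (s : Module.Basis (Fin N) ℂ (H0 (m • L))), 0 < N ∧
    D = fun x => (1 / ((m : ℚ) * N)) * ∑ j, (div (s j : X.functionField) x + (m • L) x)

/-- The set of values `v(D)` at the `m`-basis type `ℚ`-divisors `D` of `L`. -/
def basisTypeValues (L : QDivisor X) (m : ℕ) (v : X.functionField → ℝ) : Set ℝ :=
  {t : ℝ | ∃ D, IsBasisType L m D ∧ t = valDiv v D}

/-- `S_m(v)`, the maximum of `v(D)` over all `m`-basis type `ℚ`-divisors `D` of `L`. -/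
def Sm (L : QDivisor X) (m : ℕ) (v : X.functionField → ℝ) : ℝ := sSup (basisTypeValues L m v)

/-- The filter `m → ∞` on the integers `m` for which `m L` is Cartier. -/
def cartierAtTop (L : QDivisor X) : Filter ℕ := atTop ⊓ 𝓟 {m | IsCartier (m • L)}

/-- `S(v) = lim_m S_m(v)`. -/
def SInv (L : QDivisor X) (v : X.functionField → ℝ) : ℝ :=
  limUnder (cartierAtTop L) fun m => Sm L m v

end SInvariant

/-! ### Canonical divisor and log discrepancy -/

section LogDiscrepancy

variable [X.Over SpecC] {Γ : Type} [AddCommGroup Γ] [LinearOrder Γ] [SupSet Γ]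

/-- For a divisorial valuation `v` of the function field `K` with valuation ring `R`, this is the
image of `Ω^n_{R/ℂ}` in the space `Ω^n_{K/ℂ}` of rational `n`-forms, i.e. the `R`-span of the forms
`da_1 ∧ ⋯ ∧ da_n` with `a_1, …, a_n ∈ R`. For `n = dim X` it is free of rank one over `R`. -/
def regularForms (n : ℕ) (v : X.functionField → Γ) :
    AddSubgroup (⋀[X.functionField]^n (Ω[X.functionField⁄ℂ])) :=
  AddSubgroup.closure {η | ∃ (f : X.functionField) (a : Fin n → X.functionField),
    0 ≤ v f ∧ (∀ i, 0 ≤ v (a i)) ∧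
      η = f • exteriorPower.ιMulti X.functionField n
        fun i => KaehlerDifferential.D ℂ X.functionField (a i)}

/-- The order of the rational `n`-form `ω ≠ 0` with respect to `v`: it is `v(f)` if `ω = f e`, where
`e` generates the module of `v`-regular forms; equivalently, it is the largest `-v(a)` such that
`a ω` is `v`-regular. -/
def formOrder {n : ℕ} (v : X.functionField → Γ)
    (ω : ⋀[X.functionField]^n (Ω[X.functionField⁄ℂ])) : Γ :=
  sSup {t : Γ | ∃ a : X.functionField, a ≠ 0 ∧ a • ω ∈ regularForms n v ∧ t = - v a}

open Classical in
/-- The canonical divisor `K_X = div ω` of a rational form `ω ≠ 0` of top degree. -/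
def canonicalDivisor {n : ℕ} (ω : ⋀[X.functionField]^n (Ω[X.functionField⁄ℂ])) : QDivisor X :=
  fun x => if coheight x = 1 then
    ((formOrder (fun f : X.functionField => Scheme.ord f x) ω : ℤ) : ℚ) else 0

/-- The log discrepancy `A_X(v) = c (1 + ord_E (K_Y - π^* K_X))` of a divisorial valuation
`v = c ord_E`, computed by means of the canonical divisors `K_X` and `K_Y` of one rational top form
`ω ≠ 0` (it does not depend on `ω`). The first term is `c`, the least positive value of `v`. -/
def logDiscrepancy {n : ℕ} (ω : ⋀[X.functionField]^n (Ω[X.functionField⁄ℂ]))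
    (v : X.functionField → ℝ) : ℝ :=
  sInf {t : ℝ | 0 < t ∧ ∃ f, v f = t} + formOrder v ω - valDiv v (canonicalDivisor ω)

/-- The quotient `a / s` for `s > 0`; it is `+∞` if `s ≤ 0`. -/
def ratio (a s : ℝ) : EReal := if 0 < s then ((a / s : ℝ) : EReal) else ⊤

end LogDiscrepancy

end Divisors

/-! ### Toric varieties -/

/-- The coordinate ring `ℂ[M]` of the torus with character lattice `M = ℤ^n`. -/
abbrev torusRing (n : ℕ) : Type := AddMonoidAlgebra ℂ (Fin n → ℤ)

/-- The torus `T = Spec ℂ[M]`, a group scheme over `ℂ`. -/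
abbrev torus (n : ℕ) : Over SpecC :=
  (Spec (CommRingCat.of (torusRing n))).asOver (Spec (CommRingCat.of ℂ))

section

open MonObj

/-- A complete normal toric variety of dimension `n`: a proper normal variety over `ℂ` with an
action of the torus `T`, together with an equivariant open immersion `T ⟶ X`. -/
structure ToricVariety (n : ℕ) where
  X : Scheme.{0}
  [overSpecC : X.Over SpecC]
  [isIntegral : IsIntegral X]
  [isNormal : IsNormalScheme X]
  [isProper : IsProper (X ↘ SpecC)]
  [action : ModObj (torus n) (X.asOver SpecC)]
  orbit : torus n ⟶ X.asOver SpecC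
  [isOpenImmersion : IsOpenImmersion orbit.left]
  equivariant : μ[torus n] ≫ orbit = (torus n ◁ orbit) ≫ γ[torus n, X.asOver SpecC]

attribute [instance] ToricVariety.overSpecC ToricVariety.isIntegral ToricVariety.isNormal
  ToricVariety.isProper ToricVariety.action ToricVariety.isOpenImmersion

/-- The action `Z ≅ Spec ℂ × Z ⟶ T × Z ⟶ Z` of a point `t : Spec ℂ ⟶ T` on a `T`-scheme `Z`. -/
def act {n : ℕ} (Z : Over SpecC) [ModObj (torus n) Z] (t : 𝟙_ (Over SpecC) ⟶ torus n) : Z ⟶ Z :=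
  lift (toUnit Z ≫ t) (𝟙 Z) ≫ γ[torus n, Z]

theorem act_comp {n : ℕ} (Z : Over SpecC) [ModObj (torus n) Z]
    (s t : 𝟙_ (Over SpecC) ⟶ torus n) : act Z s ≫ act Z t = act Z (t * s) := by
  change act Z s ≫ ((toUnit Z ≫ t) • 𝟙 Z) = (toUnit Z ≫ (t * s)) • 𝟙 Z
  rw [ModObj.comp_smul, MonObj.comp_mul, mul_smul, Category.comp_id, ← Category.assoc,
    toUnit_unique (act Z s ≫ toUnit Z) (toUnit Z)]
  rfl

theorem act_one {n : ℕ} (Z : Over SpecC) [ModObj (torus n) Z] :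
    act Z (1 : 𝟙_ (Over SpecC) ⟶ torus n) = 𝟙 Z := by
  change (toUnit Z ≫ (1 : 𝟙_ (Over SpecC) ⟶ torus n)) • 𝟙 Z = 𝟙 Z
  rw [MonObj.comp_one, one_smul]

instance {n : ℕ} (Z : Over SpecC) [ModObj (torus n) Z] (t : 𝟙_ (Over SpecC) ⟶ torus n) :
    IsIso (act Z t) :=
  ⟨act Z t⁻¹, by simp [act_comp, act_one], by simp [act_comp, act_one]⟩

end

namespace ToricVariety

variable {n : ℕ} (V : ToricVariety n)

instance : IsLocallyNoetherian V.X :=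
  LocallyOfFiniteType.isLocallyNoetherian (V.X ↘ SpecC)

/-- The complex points of the torus. -/
abbrev Point (n : ℕ) : Type := 𝟙_ (Over SpecC) ⟶ torus n

/-- The automorphism of `X` given by the action of `t ∈ T(ℂ)`. -/
def translation (t : Point n) : V.X ⟶ V.X := (act (V.X.asOver SpecC) t).left

instance (t : Point n) : IsIso (V.translation t) :=
  inferInstanceAs (IsIso ((Over.forget SpecC).map (act (V.X.asOver SpecC) t)))

/-- The character `χ^u` of the torus, as a rational function on `X`. -/
def chi (u : Fin n → ℤ) : V.X.functionField :=
  V.X.presheaf.germ (V.orbit.left ''ᵁ ⊤) (genericPoint V.X)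
    (((genericPoint_spec V.X).mem_open_set_iff (V.orbit.left ''ᵁ ⊤).isOpen).mpr
      ⟨V.orbit.left (Classical.arbitrary (Spec (CommRingCat.of (torusRing n)))),
        trivial, ⟨_, trivial, rfl⟩⟩)
    ((V.orbit.left.appIso ⊤).inv
      ((Scheme.ΓSpecIso (CommRingCat.of (torusRing n))).inv
        (AddMonoidAlgebra.single u (1 : ℂ) : torusRing n)))

/-- `x` is (the generic point of) a `T`-invariant prime divisor. -/
def IsInvariantPrime (x : V.X) : Prop :=
  coheight x = 1 ∧ ∀ t : Point n, V.translation t x = x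

/-- The `ℚ`-divisor `D` is `T`-invariant: a combination of `T`-invariant prime divisors. -/
def IsInvariantDivisor (D : QDivisor V.X) : Prop := ∀ x, D x ≠ 0 → V.IsInvariantPrime x

/-- The set of `T`-invariant (nontrivial) divisorial valuations on `X`. -/
def invDivVal : Set (V.X.functionField → ℝ) :=
  {v | IsDivisorial v ∧ ∀ (t : Point n) f, v (pullback (V.translation t) f) = v f}

/-- The polytope of a `T`-invariant `ℚ`-divisor `D`, in `M_ℝ = ℝ^n`: the set of `x` with
`⟨x, ord_E⟩ + D(E) ≥ 0` for all `T`-invariant prime divisors `E`, where `⟨·, ord_E⟩` is the linear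
extension of `u ↦ ord_E (χ^u)`. -/
def polytope (D : QDivisor V.X) : Set (Fin n → ℝ) :=
  {x | ∀ E, V.IsInvariantPrime E →
    0 ≤ ∑ i, x i * (Scheme.ord (V.chi (Pi.single i 1)) E : ℝ) + (D E : ℝ)}

/-- The lattice points of `m P`, for the polytope `P` of `D`. -/
def latticePoints (D : QDivisor V.X) (m : ℕ) : Set (Fin n → ℤ) :=
  {u | (fun i => (u i : ℝ) / (m : ℝ)) ∈ V.polytope D}

/-- `D_m = D + (1 / N_m) ∑_{u ∈ m P ∩ M} (1 / m) div χ^u`, where `N_m = |m P ∩ M|`. -/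
def toricBasisDivisor (D : QDivisor V.X) (m : ℕ) : QDivisor V.X := fun x =>
  D x + (1 / ((V.latticePoints D m).ncard : ℚ)) *
    ∑ᶠ u ∈ V.latticePoints D m, (1 / (m : ℚ)) * div (V.chi u) x

/-- The barycenter of the polytope of `D`, with respect to Lebesgue measure. -/
def barycenter (D : QDivisor V.X) : Fin n → ℝ := ⨍ x in V.polytope D, x

/-- `B = D + (1 / m') div χ^{m' ū}`, where `ū` is the barycenter of the polytope of `D` and `m'` is
a positive integer such that `m' ū` lies in the lattice `M`. -/
def IsBarycenterDivisor (D B : QDivisor V.X) : Prop :=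
  ∃ (m' : ℕ) (w : Fin n → ℤ), 0 < m' ∧ (∀ i, (w i : ℝ) = m' * V.barycenter D i) ∧
    B = fun x => D x + (1 / (m' : ℚ)) * div (V.chi w) x

/-- The equivariant stability threshold `δ_T(L) = inf_v A_X(v) / S(v)`, where `v` runs over the
`T`-invariant divisorial valuations. The log discrepancy is computed with `K_X = div ω`. -/
def deltaT (ω : ⋀[V.X.functionField]^n (Ω[V.X.functionField⁄ℂ])) (L : QDivisor V.X) : EReal :=
  ⨅ v ∈ V.invDivVal, ratio (logDiscrepancy ω v) (SInv L v)

end ToricVariety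

end ToricStability

end

/-!
The torus acts on the function field of the toric variety `V.X` and scales the characters `χ^u` by
distinct functions of the point of the torus. Hence an invariant subspace of the coordinate ring of
the torus contains every character which occurs in one of its elements (`single_mem_of_invariant`).
Two consequences carry the proof.

* The sections of an invariant divisor `D` are spanned by the characters which are sections
  (`sectionBasis`), and these are the lattice points of a multiple of its polytope, as the invariant
  prime divisors are exactly those outside the open orbit (`isInvariantPrime_iff`).
* An invariant valuation `v` satisfies `v f ≤ v (χ^u)` for every character `χ^u` which occurs in `f`
  (`val_ratFun_le`). An arbitrary basis of `H⁰(X, m L)` can be matched with the monomial basis so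
  that each member contains its partner (`exists_equiv_repr_ne_zero`); hence the monomial basis
  computes `S_m(v)` (`isGreatest_basisTypeValues`).

On characters `v` is a linear form, so `S_m(v)` is `v(D)` plus the average of a linear form over the
lattice points `u / m` of the polytope. This is literally true if `m L` is equivalent to `m D`. If
`m L` is only Cartier, then the factoriality of the coordinate ring of the torus shows that `m L` is
equivalent to `m D` plus a fractional multiple of the divisor of a character (`exists_shift`), and
the lattice is shifted by a vector depending on `m` (`Sm_eq`). Riemann sums over shifted lattices
converge to the integral, whatever the shifts are (`tendsto_sum_latticePoint`), so the averages
converge to the value of the linear form at the barycenter (`tendsto_average`, `tendsto_Sm`). Here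
one needs that the polytope is bounded, because regular functions on a complete variety are constant
(`isBounded_polytope`), and that it has interior points, because every character is a quotient of
two sections of a multiple of the ample divisor `L` (`interior_polytope_nonempty`).

The barycenter is rational since moments of rational polytopes are: piecewise polynomial functions
with rational data are stable under integration over a bounded interval in one variable
(`integral_ratPoly_rational`). The formula for the stability threshold is the equality of the
denominators.
-/

noncomputable section

namespace ToricStability

section

/-! ### Moments of rational polytopes -/

/-- The rational affine function `x ↦ ∑ i, a i * x i + b`. -/
def ratAffine {n : ℕ} (a : Fin n → ℚ) (b : ℚ) (x : Fin n → ℝ) : ℝ := ∑ i, (a i : ℝ) * x i + b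

/-- The `ℚ`-algebra of piecewise polynomial functions on `ℝ^n`, generated by the coordinates and
the indicator functions of the rational half-spaces. -/
def ratPoly (n : ℕ) : Subalgebra ℚ ((Fin n → ℝ) → ℝ) :=
  Algebra.adjoin ℚ (Set.range (fun i x => x i) ∪
    {f | ∃ a b, f = fun x => if 0 ≤ ratAffine a b x then 1 else 0})

variable {n : ℕ}

theorem coord_mem_ratPoly (i : Fin n) : (fun x : Fin n → ℝ => x i) ∈ ratPoly n :=
  Algebra.subset_adjoin (Or.inl ⟨i, rfl⟩)

theorem indicator_mem_ratPoly (a : Fin n → ℚ) (b : ℚ) :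
    (fun x : Fin n → ℝ => if 0 ≤ ratAffine a b x then (1 : ℝ) else 0) ∈ ratPoly n :=
  Algebra.subset_adjoin (Or.inr ⟨a, b, rfl⟩)

theorem const_mem_ratPoly (q : ℚ) : (fun _ : Fin n → ℝ => (q : ℝ)) ∈ ratPoly n := by
  have := (ratPoly n).algebraMap_mem q
  exact this

theorem ratAffine_mem_ratPoly (a : Fin n → ℚ) (b : ℚ) : ratAffine a b ∈ ratPoly n := by
  have : ratAffine a b = ∑ i, (a i) • (fun x : Fin n → ℝ => x i) + fun _ => (b : ℝ) := by
    ext x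
    simp [ratAffine, Rat.smul_def]
  rw [this]
  exact add_mem (sum_mem fun i _ => (ratPoly n).smul_mem (coord_mem_ratPoly i) _)
    (const_mem_ratPoly b)

/-- The maximum of two rational affine functions is piecewise polynomial. -/
theorem max_mem_ratPoly (a : Fin n → ℚ) (b : ℚ) (a' : Fin n → ℚ) (b' : ℚ) :
    (fun x => max (ratAffine a b x) (ratAffine a' b' x)) ∈ ratPoly n := by
  have h : (fun x => max (ratAffine a b x) (ratAffine a' b' x)) =
      ratAffine a b * (fun x => if 0 ≤ ratAffine (a - a') (b - b') x then (1 : ℝ) else 0) +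
      ratAffine a' b' *
        (1 - (fun x => if 0 ≤ ratAffine (a - a') (b - b') x then (1 : ℝ) else 0)) := by
    ext x
    have : ratAffine (a - a') (b - b') x = ratAffine a b x - ratAffine a' b' x := by
      simp only [ratAffine, Pi.sub_apply, Rat.cast_sub, sub_mul, Finset.sum_sub_distrib]
      ring
    simp only [Pi.add_apply, Pi.mul_apply, Pi.sub_apply, Pi.one_apply, this, sub_nonneg]
    split_ifs with h
    · simp [h]
    · simp [(not_le.mp h).le]
  rw [h]
  exact add_mem (mul_mem (ratAffine_mem_ratPoly _ _) (indicator_mem_ratPoly _ _))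
    (mul_mem (ratAffine_mem_ratPoly _ _) (sub_mem (one_mem _) (indicator_mem_ratPoly _ _)))

/-- Truncating a rational affine function to a rational interval gives a piecewise polynomial
function. -/
theorem clamp_mem_ratPoly (a : Fin n → ℚ) (b : ℚ) (R : ℕ) :
    (fun x => max (-(R : ℝ)) (min R (ratAffine a b x))) ∈ ratPoly n := by
  have hc : ∀ (q : ℚ) (x : Fin n → ℝ), ratAffine 0 q x = q := fun q x => by simp [ratAffine]
  have hn : ∀ x, ratAffine (-a) (-b) x = - ratAffine a b x := fun x => by
    simp [ratAffine, add_comm]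
  have h : (fun x => max (-(R : ℝ)) (min R (ratAffine a b x))) =
      (fun x => max (ratAffine a b x) (ratAffine 0 (-R) x)) +
      ((fun _ => ((R : ℚ) : ℝ)) -
        fun x => max (ratAffine a b x) (ratAffine 0 R x)) := by
    ext x
    simp only [Pi.add_apply, Pi.sub_apply, hc]
    push_cast
    rcases le_total (ratAffine a b x) R with h1 | h1
    · rw [min_eq_right h1, max_eq_right h1, max_comm]; ring
    · have : -(R : ℝ) ≤ R := by have := Nat.cast_nonneg (α := ℝ) R; linarith
      rw [min_eq_left h1, max_eq_left h1, max_eq_right this, max_eq_left (this.trans h1)]; ring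
  rw [h]
  exact add_mem (max_mem_ratPoly _ _ _ _) (sub_mem (const_mem_ratPoly _) (max_mem_ratPoly _ _ _ _))

/-- Functions of `(t, x)` of the form `g(x) t^k` or `g(x) t^k 1[t ≥ α(x)]`, with `g` piecewise
polynomial and `α` rational affine. -/
def sliceGenerators (n : ℕ) : Set (ℝ → (Fin n → ℝ) → ℝ) :=
  {f | ∃ g ∈ ratPoly n, ∃ k : ℕ, f = fun t x => g x * t ^ k} ∪
  {f | ∃ g ∈ ratPoly n, ∃ (k : ℕ) (a : Fin n → ℚ) (b : ℚ),
    f = fun t x => g x * t ^ k * if ratAffine a b x ≤ t then 1 else 0}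

theorem sliceGenerators_mul {f g : ℝ → (Fin n → ℝ) → ℝ} (hf : f ∈ sliceGenerators n)
    (hg : g ∈ sliceGenerators n) : f * g ∈ Submodule.span ℚ (sliceGenerators n) := by
  rcases hf with ⟨p, hp, k, rfl⟩ | ⟨p, hp, k, a, b, rfl⟩ <;>
  rcases hg with ⟨q, hq, l, rfl⟩ | ⟨q, hq, l, a', b', rfl⟩
  · exact Submodule.subset_span (Or.inl ⟨p * q, mul_mem hp hq, k + l, by
      ext t x; simp only [Pi.mul_apply]; ring⟩)
  · exact Submodule.subset_span (Or.inr ⟨p * q, mul_mem hp hq, k + l, a', b', by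
      ext t x; simp only [Pi.mul_apply]; ring⟩)
  · exact Submodule.subset_span (Or.inr ⟨p * q, mul_mem hp hq, k + l, a, b, by
      ext t x; simp only [Pi.mul_apply]; ring⟩)
  · -- `1[t ≥ α] 1[t ≥ α'] = 1[α ≥ α'] 1[t ≥ α] + (1 - 1[α ≥ α']) 1[t ≥ α']`
    set c : (Fin n → ℝ) → ℝ := fun x => if 0 ≤ ratAffine (a - a') (b - b') x then 1 else 0 with hc
    have hcm : c ∈ ratPoly n := indicator_mem_ratPoly _ _
    have key : ((fun t x => p x * t ^ k * if ratAffine a b x ≤ t then (1 : ℝ) else 0) *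
        fun t x => q x * t ^ l * if ratAffine a' b' x ≤ t then (1 : ℝ) else 0) =
        (fun t x => (p * q * c) x * t ^ (k + l) * if ratAffine a b x ≤ t then (1 : ℝ) else 0) +
        fun t x => (p * q * (1 - c)) x * t ^ (k + l) *
          if ratAffine a' b' x ≤ t then (1 : ℝ) else 0 := by
      ext t x
      have : ratAffine (a - a') (b - b') x = ratAffine a b x - ratAffine a' b' x := by
        simp only [ratAffine, Pi.sub_apply, Rat.cast_sub, sub_mul, Finset.sum_sub_distrib]
        ring
      simp only [Pi.mul_apply, Pi.add_apply, Pi.sub_apply, Pi.one_apply, hc, this, sub_nonneg]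
      by_cases h1 : ratAffine a' b' x ≤ ratAffine a b x
      · by_cases h2 : ratAffine a b x ≤ t
        · simp [h1, h2, h1.trans h2]; ring
        · simp [h1, h2]
      · by_cases h2 : ratAffine a' b' x ≤ t
        · simp [h1, h2, (not_le.mp h1).le.trans h2]; ring
        · simp [h1, h2]
    rw [key]
    exact add_mem (Submodule.subset_span (Or.inr ⟨_, mul_mem (mul_mem hp hq) hcm, _, _, _, rfl⟩))
      (Submodule.subset_span (Or.inr ⟨_, mul_mem (mul_mem hp hq) (sub_mem (one_mem _) hcm),
        _, _, _, rfl⟩))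

theorem span_sliceGenerators_mul {f g : ℝ → (Fin n → ℝ) → ℝ}
    (hf : f ∈ Submodule.span ℚ (sliceGenerators n))
    (hg : g ∈ Submodule.span ℚ (sliceGenerators n)) :
    f * g ∈ Submodule.span ℚ (sliceGenerators n) := by
  induction hf, hg using Submodule.span_induction₂ with
  | mem_mem x y hx hy => exact sliceGenerators_mul hx hy
  | zero_left => simp
  | zero_right => simp
  | add_left x y z _ _ _ h1 h2 => rw [add_mul]; exact add_mem h1 h2
  | add_right x y z _ _ _ h1 h2 => rw [mul_add]; exact add_mem h1 h2
  | smul_left r x y _ _ h => rw [smul_mul_assoc]; exact Submodule.smul_mem _ _ h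
  | smul_right r x y _ _ h => rw [mul_smul_comm]; exact Submodule.smul_mem _ _ h

/-- Integrating over the first variable: up to null sets, a piecewise polynomial function of
`(t, x)` is a combination of the functions in `sliceGenerators`. -/
theorem exists_slice {f : (Fin (n + 1) → ℝ) → ℝ} (hf : f ∈ ratPoly (n + 1)) :
    ∃ g ∈ Submodule.span ℚ (sliceGenerators n),
      ∀ x : Fin n → ℝ, (fun t : ℝ => f (Fin.cons t x)) =ᵐ[volume] fun t => g t x := by
  have hgen : ∀ g ∈ ratPoly n, (fun (_ : ℝ) x => g x) ∈ Submodule.span ℚ (sliceGenerators n) :=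
    fun g hg => Submodule.subset_span (Or.inl ⟨g, hg, 0, by simp⟩)
  induction hf using Algebra.adjoin_induction with
  | mem f hf =>
    rcases hf with ⟨i, rfl⟩ | ⟨a, b, rfl⟩
    · refine Fin.cases ?_ (fun j => ?_) i
      · exact ⟨fun t _ => t, Submodule.subset_span (Or.inl ⟨1, one_mem _, 1, by simp⟩),
          fun x => by simp⟩
      · exact ⟨fun _ x => x j, hgen _ (coord_mem_ratPoly j), fun x => by simp⟩
    · have hcons : ∀ t (x : Fin n → ℝ), ratAffine a b (Fin.cons t x) =
          a 0 * t + ratAffine (Fin.tail a) b x := fun t x => by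
        simp [ratAffine, Fin.sum_univ_succ, Fin.tail, add_assoc]
      have hdiv : ∀ x : Fin n → ℝ, ratAffine (fun i => -(Fin.tail a i) / a 0) (-b / a 0) x =
          - ratAffine (Fin.tail a) b x / a 0 := fun x => by
        simp only [ratAffine]
        push_cast
        rw [neg_div, neg_div, add_div, neg_add, Finset.sum_div, ← Finset.sum_neg_distrib]
        congr 1
        exact Finset.sum_congr rfl fun i _ => by ring
      set a' : Fin n → ℚ := fun i => -(Fin.tail a i) / a 0
      set b' : ℚ := -b / a 0
      rcases lt_trichotomy (a 0) 0 with h | h | h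
      · have h' : ((a 0 : ℚ) : ℝ) < 0 := by exact_mod_cast h
        refine ⟨(fun _ _ => 1) - fun t x => if ratAffine a' b' x ≤ t then 1 else 0,
          sub_mem (hgen 1 (one_mem _)) (Submodule.subset_span
            (Or.inr ⟨1, one_mem _, 0, a', b', by simp⟩)), fun x => ?_⟩
        -- the two functions of `t` differ only at `t = α(x)`
        filter_upwards [(Set.finite_singleton (ratAffine a' b' x)).countable.ae_notMem volume]
          with t ht
        have ht : t ≠ ratAffine a' b' x := ht
        have e : 0 ≤ ratAffine a b (Fin.cons t x) ↔ t ≤ ratAffine a' b' x := by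
          rw [hcons, hdiv, le_div_iff_of_neg h']
          constructor <;> intro <;> linarith
        simp only [Pi.sub_apply, e]
        rcases lt_or_gt_of_ne ht with h1 | h1
        · simp [h1.le, not_le.mpr h1]
        · simp [h1.le, not_le.mpr h1]
      · refine ⟨fun _ x => if 0 ≤ ratAffine (Fin.tail a) b x then 1 else 0,
          hgen _ (indicator_mem_ratPoly _ _), fun x => ?_⟩
        simp [hcons, h]
      · have h' : (0 : ℝ) < ((a 0 : ℚ) : ℝ) := by exact_mod_cast h
        refine ⟨fun t x => if ratAffine a' b' x ≤ t then 1 else 0, Submodule.subset_span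
            (Or.inr ⟨1, one_mem _, 0, a', b', by simp⟩), fun x => Eventually.of_forall fun t => ?_⟩
        have e : 0 ≤ ratAffine a b (Fin.cons t x) ↔ ratAffine a' b' x ≤ t := by
          rw [hcons, hdiv, div_le_iff₀ h']
          constructor <;> intro <;> linarith
        simp only [e]
  | algebraMap q => exact ⟨fun _ _ => (q : ℝ), hgen _ (const_mem_ratPoly q), fun x => by rfl⟩
  | add f g _ _ hf hg =>
    obtain ⟨f', hf', hf''⟩ := hf
    obtain ⟨g', hg', hg''⟩ := hg
    exact ⟨f' + g', add_mem hf' hg', fun x => (hf'' x).add (hg'' x)⟩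
  | mul f g _ _ hf hg =>
    obtain ⟨f', hf', hf''⟩ := hf
    obtain ⟨g', hg', hg''⟩ := hg
    exact ⟨f' * g', span_sliceGenerators_mul hf' hg', fun x => (hf'' x).mul (hg'' x)⟩

theorem setIntegral_Icc_pow_indicator (R : ℕ) (k : ℕ) (c : ℝ) :
    ∫ t in Set.Icc (-(R : ℝ)) R, t ^ k * (if c ≤ t then (1 : ℝ) else 0) =
      ((R : ℝ) ^ (k + 1) - (max (-(R : ℝ)) (min R c)) ^ (k + 1)) / (k + 1) := by
  have hR : -(R : ℝ) ≤ R := by have := Nat.cast_nonneg (α := ℝ) R; linarith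
  have h1 : ∀ t ∈ Set.Icc (-(R : ℝ)) R, t ^ k * (if c ≤ t then (1 : ℝ) else 0) =
      (Set.Ici c).indicator (fun t => t ^ k) t := fun t _ => by
    simp [Set.indicator_apply]
  rw [setIntegral_congr_fun measurableSet_Icc h1, setIntegral_indicator measurableSet_Ici,
    ← integral_pow]
  have hle : max (-(R : ℝ)) (min R c) ≤ R := max_le hR (min_le_left _ _)
  rw [intervalIntegral.integral_of_le hle, ← integral_Icc_eq_integral_Ioc]
  rcases le_or_gt c R with h | h
  · congr 2
    ext t
    simp only [Set.mem_inter_iff, Set.mem_Icc, Set.mem_Ici, min_eq_right h, max_le_iff]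
    tauto
  · rw [min_eq_left h.le, max_eq_right hR]
    have : Set.Icc (-(R : ℝ)) R ∩ Set.Ici c = ∅ := by
      ext t
      simp only [Set.mem_inter_iff, Set.mem_Icc, Set.mem_Ici, Set.mem_empty_iff_false, iff_false]
      rintro ⟨⟨_, h2⟩, h3⟩
      linarith
    rw [this, Set.Icc_self]
    simp

/-- Integrating a combination of the functions in `sliceGenerators` over a bounded interval gives a
piecewise polynomial function of the remaining variables. -/
theorem slice_integral_mem {g : ℝ → (Fin n → ℝ) → ℝ}
    (hg : g ∈ Submodule.span ℚ (sliceGenerators n)) (R : ℕ) :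
    (∀ x, IntegrableOn (fun t => g t x) (Set.Icc (-(R : ℝ)) R)) ∧
      (fun x => ∫ t in Set.Icc (-(R : ℝ)) R, g t x) ∈ ratPoly n := by
  have hR : -(R : ℝ) ≤ R := by have := Nat.cast_nonneg (α := ℝ) R; linarith
  have hint : ∀ k : ℕ, IntegrableOn (fun t : ℝ => t ^ k) (Set.Icc (-(R : ℝ)) R) :=
    fun k => (continuous_pow k).continuousOn.integrableOn_Icc
  induction hg using Submodule.span_induction with
  | mem f hf =>
    rcases hf with ⟨g, hg, k, rfl⟩ | ⟨g, hg, k, a, b, rfl⟩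
    · refine ⟨fun x => (hint k).const_mul _, ?_⟩
      have : (fun x => ∫ t in Set.Icc (-(R : ℝ)) R, g x * t ^ k) =
          g * fun _ => (((R ^ (k + 1) - (-R) ^ (k + 1)) / (k + 1) : ℚ) : ℝ) := by
        ext x
        rw [integral_const_mul, integral_Icc_eq_integral_Ioc,
          ← intervalIntegral.integral_of_le hR, integral_pow]
        simp
      rw [this]
      exact mul_mem hg (const_mem_ratPoly _)
    · constructor
      · intro x
        have : (fun t : ℝ => g x * t ^ k * if ratAffine a b x ≤ t then 1 else 0) =
            (Set.Ici (ratAffine a b x)).indicator fun t => g x * t ^ k := by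
          ext t; simp [Set.indicator_apply]
        rw [this]
        exact ((hint k).const_mul _).indicator measurableSet_Ici
      · have : (fun x => ∫ t in Set.Icc (-(R : ℝ)) R,
            g x * t ^ k * if ratAffine a b x ≤ t then 1 else 0) =
            g * ((1 / (k + 1) : ℚ) • ((fun _ => ((R ^ (k + 1) : ℚ) : ℝ)) -
              (fun x => max (-(R : ℝ)) (min R (ratAffine a b x))) ^ (k + 1))) := by
          ext x
          simp only [mul_assoc]
          rw [integral_const_mul, setIntegral_Icc_pow_indicator]
          simp [Rat.smul_def]
          left; ring
        rw [this]
        exact mul_mem hg ((ratPoly n).smul_mem (sub_mem (const_mem_ratPoly _)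
          (pow_mem (clamp_mem_ratPoly _ _ _) _)) _)
  | zero =>
    refine ⟨fun x => by simp, ?_⟩
    simp only [Pi.zero_apply, integral_zero]
    exact (ratPoly n).zero_mem
  | add f g _ _ hf hg =>
    refine ⟨fun x => (hf.1 x).add (hg.1 x), ?_⟩
    have : (fun x => ∫ t in Set.Icc (-(R : ℝ)) R, (f + g) t x) =
        (fun x => ∫ t in Set.Icc (-(R : ℝ)) R, f t x) +
          fun x => ∫ t in Set.Icc (-(R : ℝ)) R, g t x := by
      ext x
      exact integral_add (hf.1 x) (hg.1 x)
    rw [this]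
    exact add_mem hf.2 hg.2
  | smul q f _ hf =>
    have hq : ∀ t x, (q • f) t x = (q : ℝ) * f t x := fun t x => by simp [Rat.smul_def]
    refine ⟨fun x => by simp only [hq]; exact (hf.1 x).const_mul _, ?_⟩
    have : (fun x => ∫ t in Set.Icc (-(R : ℝ)) R, (q • f) t x) =
        q • (fun x => ∫ t in Set.Icc (-(R : ℝ)) R, f t x) := by
      ext x
      simp only [hq, integral_const_mul, Pi.smul_apply, Rat.smul_def]
    rw [this]
    exact (ratPoly n).smul_mem hf.2 q

theorem measurable_ratAffine (a : Fin n → ℚ) (b : ℚ) : Measurable (ratAffine a b) := by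
  unfold ratAffine
  fun_prop

theorem measurable_of_mem_ratPoly {f : (Fin n → ℝ) → ℝ} (hf : f ∈ ratPoly n) : Measurable f := by
  induction hf using Algebra.adjoin_induction with
  | mem f hf =>
    rcases hf with ⟨i, rfl⟩ | ⟨a, b, rfl⟩
    · exact measurable_pi_apply i
    · exact Measurable.ite (measurableSet_le measurable_const (measurable_ratAffine a b))
        measurable_const measurable_const
  | algebraMap q => exact measurable_const
  | add f g _ _ hf hg => exact hf.add hg
  | mul f g _ _ hf hg => exact hf.mul hg

/-- The box `[-R, R]^n`. -/
def box (n R : ℕ) : Set (Fin n → ℝ) := Set.univ.pi fun _ => Set.Icc (-(R : ℝ)) R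

theorem measurableSet_box (R : ℕ) : MeasurableSet (box n R) :=
  MeasurableSet.univ_pi fun _ => measurableSet_Icc

theorem isCompact_box (R : ℕ) : IsCompact (box n R) := isCompact_univ_pi fun _ => isCompact_Icc

theorem bounded_of_mem_ratPoly {f : (Fin n → ℝ) → ℝ} (hf : f ∈ ratPoly n) (R : ℕ) :
    ∃ C, ∀ x ∈ box n R, |f x| ≤ C := by
  induction hf using Algebra.adjoin_induction with
  | mem f hf =>
    rcases hf with ⟨i, rfl⟩ | ⟨a, b, rfl⟩
    · exact ⟨R, fun x hx => abs_le.mpr (hx i trivial)⟩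
    · exact ⟨1, fun x _ => by dsimp only; split_ifs <;> simp⟩
  | algebraMap q => exact ⟨|(q : ℝ)|, fun x _ => le_of_eq rfl⟩
  | add f g _ _ hf hg =>
    obtain ⟨C, hC⟩ := hf
    obtain ⟨D, hD⟩ := hg
    exact ⟨C + D, fun x hx => (abs_add_le _ _).trans (add_le_add (hC x hx) (hD x hx))⟩
  | mul f g _ _ hf hg =>
    obtain ⟨C, hC⟩ := hf
    obtain ⟨D, hD⟩ := hg
    refine ⟨C * D, fun x hx => ?_⟩
    rw [Pi.mul_apply, abs_mul]
    exact mul_le_mul (hC x hx) (hD x hx) (abs_nonneg _) ((abs_nonneg _).trans (hC x hx))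

theorem integrableOn_of_mem_ratPoly {f : (Fin n → ℝ) → ℝ} (hf : f ∈ ratPoly n) (R : ℕ) :
    IntegrableOn f (box n R) := by
  obtain ⟨C, hC⟩ := bounded_of_mem_ratPoly hf R
  exact IntegrableOn.of_bound (isCompact_box R).measure_lt_top
    (measurable_of_mem_ratPoly hf).aestronglyMeasurable C
    ((ae_restrict_iff' (measurableSet_box R)).mpr (Eventually.of_forall hC))

/-- The integral of a piecewise polynomial function with rational data over a box is rational: the
variables are integrated out one at a time. -/
theorem integral_ratPoly_rational : ∀ (n : ℕ) {f : (Fin n → ℝ) → ℝ} (_ : f ∈ ratPoly n) (R : ℕ),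
    ∃ q : ℚ, ∫ x in box n R, f x = q
  | 0, f, hf, R => by
    have : ∃ q : ℚ, f 0 = q := by
      induction hf using Algebra.adjoin_induction with
      | mem f hf =>
        rcases hf with ⟨i, rfl⟩ | ⟨a, b, rfl⟩
        · exact i.elim0
        · dsimp only
          split_ifs
          · exact ⟨1, by simp⟩
          · exact ⟨0, by simp⟩
      | algebraMap q => exact ⟨q, rfl⟩
      | add f g _ _ hf hg =>
        obtain ⟨p, hp⟩ := hf
        obtain ⟨q, hq⟩ := hg
        exact ⟨p + q, by rw [Pi.add_apply, hp, hq, Rat.cast_add]⟩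
      | mul f g _ _ hf hg =>
        obtain ⟨p, hp⟩ := hf
        obtain ⟨q, hq⟩ := hg
        exact ⟨p * q, by rw [Pi.mul_apply, hp, hq, Rat.cast_mul]⟩
    obtain ⟨q, hq⟩ := this
    refine ⟨q, ?_⟩
    have hb : box 0 R = Set.univ := by ext x; simp [box]
    rw [hb, Measure.restrict_univ, ← hq, volume_pi, Measure.pi_of_empty _ (0 : Fin 0 → ℝ)]
    simp
  | n + 1, f, hf, R => by
    obtain ⟨g, hg, hfg⟩ := exists_slice hf
    obtain ⟨q, hq⟩ := integral_ratPoly_rational n (slice_integral_mem hg R).2 R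
    refine ⟨q, ?_⟩
    let e := (MeasurableEquiv.piFinSuccAbove (fun _ : Fin (n + 1) => ℝ) 0).symm
    have he : MeasurePreserving e :=
      (volume_preserving_piFinSuccAbove (fun _ : Fin (n + 1) => ℝ) 0).symm _
    have happ : ∀ p : ℝ × (Fin n → ℝ), e p = Fin.cons p.1 p.2 := fun p => by
      simp [e, Fin.insertNthEquiv]
    have hpre : e ⁻¹' box (n + 1) R = Set.Icc (-(R : ℝ)) R ×ˢ box n R := by
      ext ⟨t, x⟩
      rw [Set.mem_preimage, happ]
      simp only [box, Set.mem_pi, Set.mem_univ, forall_true_left, Fin.forall_fin_succ,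
        Fin.cons_zero, Fin.cons_succ, Set.mem_prod]
    have hI : IntegrableOn (fun p => f (e p)) (Set.Icc (-(R : ℝ)) R ×ˢ box n R)
        (volume.prod volume) := by
      have := (he.integrableOn_comp_preimage e.measurableEmbedding).mpr
        (integrableOn_of_mem_ratPoly hf R)
      rwa [hpre] at this
    rw [← he.setIntegral_preimage_emb e.measurableEmbedding, hpre, Measure.volume_eq_prod,
      ← Measure.prod_restrict, integral_prod_symm _ (by rwa [Measure.prod_restrict]), ← hq]
    congr 1
    ext x
    refine integral_congr_ae ?_
    filter_upwards [ae_restrict_of_ae (hfg x)] with t ht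
    rw [← ht, happ]

/-- The moments of a bounded rational polytope are rational. -/
theorem integral_polytope_rational {ι : Type*} {s : Set ι} (hs : s.Finite) (a : ι → Fin n → ℚ)
    (b : ι → ℚ) (hP : Bornology.IsBounded {x | ∀ k ∈ s, 0 ≤ ratAffine (a k) (b k) x})
    {f : (Fin n → ℝ) → ℝ} (hf : f ∈ ratPoly n) :
    ∃ q : ℚ, ∫ x in {x | ∀ k ∈ s, 0 ≤ ratAffine (a k) (b k) x}, f x = q := by
  set P := {x | ∀ k ∈ s, 0 ≤ ratAffine (a k) (b k) x}
  obtain ⟨C, hC⟩ := hP.exists_norm_le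
  obtain ⟨R, hR⟩ := exists_nat_ge C
  have hPR : P ⊆ box n R := fun x hx i _ =>
    abs_le.mp ((norm_le_pi_norm x i).trans ((hC x hx).trans hR))
  have hmeas : MeasurableSet P := by
    have : P = ⋂ k ∈ s, {x | 0 ≤ ratAffine (a k) (b k) x} := by ext; simp [P]
    rw [this]
    exact hs.measurableSet_biInter fun k _ =>
      measurableSet_le measurable_const (measurable_ratAffine _ _)
  have hprod : (f * ∏ k ∈ hs.toFinset,
      fun x => if 0 ≤ ratAffine (a k) (b k) x then (1 : ℝ) else 0) = P.indicator f := by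
    ext x
    rw [Pi.mul_apply, Finset.prod_apply]
    by_cases hx : x ∈ P
    · rw [Set.indicator_of_mem hx, Finset.prod_eq_one, mul_one]
      exact fun k hk => if_pos (hx k (hs.mem_toFinset.mp hk))
    · obtain ⟨k, hk, hk'⟩ : ∃ k ∈ s, ¬ 0 ≤ ratAffine (a k) (b k) x := by
        by_contra! h
        exact hx h
      rw [Set.indicator_of_notMem hx, Finset.prod_eq_zero (hs.mem_toFinset.mpr hk) (if_neg hk'),
        mul_zero]
  obtain ⟨q, hq⟩ := integral_ratPoly_rational n
    (mul_mem hf (prod_mem fun k (_ : k ∈ hs.toFinset) => indicator_mem_ratPoly (a k) (b k))) R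
  refine ⟨q, ?_⟩
  rw [← hq, hprod, setIntegral_indicator hmeas, Set.inter_eq_right.mpr hPR]

end

section

/-! ### Riemann sums over shifted lattices -/

variable {n : ℕ}

/-- The point `(u + θ) / m` of the shifted lattice `(ℤ^n + θ) / m`. -/
def latticePoint (m : ℕ) (θ : Fin n → ℝ) (u : Fin n → ℤ) : Fin n → ℝ := fun i => (u i + θ i) / m

/-- The index of the cell of the shifted lattice `(ℤ^n + θ) / m` which contains `x`. -/
def latticeCell (m : ℕ) (θ : Fin n → ℝ) (x : Fin n → ℝ) : Fin n → ℤ := fun i => ⌊m * x i - θ i⌋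

theorem latticePoint_mem_Icc {m : ℕ} (hm : 0 < m) (θ x : Fin n → ℝ) (i : Fin n) :
    x i - 1 / m ≤ latticePoint m θ (latticeCell m θ x) i ∧
      latticePoint m θ (latticeCell m θ x) i ≤ x i := by
  have hm' : (0 : ℝ) < m := Nat.cast_pos.mpr hm
  have h1 := Int.floor_le (m * x i - θ i)
  have h2 := Int.lt_floor_add_one (m * x i - θ i)
  simp only [latticePoint, latticeCell]
  constructor
  · rw [le_div_iff₀ hm', sub_mul, one_div_mul_cancel hm'.ne']
    linarith
  · rw [div_le_iff₀ hm']
    linarith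

theorem dist_latticePoint_le {m : ℕ} (hm : 0 < m) (θ x : Fin n → ℝ) :
    dist (latticePoint m θ (latticeCell m θ x)) x ≤ 1 / m := by
  refine (dist_pi_le_iff (by positivity)).mpr fun i => ?_
  have := latticePoint_mem_Icc hm θ x i
  rw [Real.dist_eq, abs_le]
  constructor <;> linarith [this.1, this.2, show (0 : ℝ) ≤ 1 / m by positivity]

theorem tendsto_latticePoint (θ : ℕ → Fin n → ℝ) (x : Fin n → ℝ) :
    Tendsto (fun m => latticePoint m (θ m) (latticeCell m (θ m) x)) atTop (𝓝 x) := by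
  rw [tendsto_iff_dist_tendsto_zero]
  refine squeeze_zero' (Eventually.of_forall fun _ => dist_nonneg) ?_
    tendsto_one_div_atTop_nhds_zero_nat
  filter_upwards [eventually_gt_atTop 0] with m hm using dist_latticePoint_le hm _ _

theorem finite_latticePoint_mem {P : Set (Fin n → ℝ)} (hP : Bornology.IsBounded P) {m : ℕ}
    (hm : 0 < m) (θ : Fin n → ℝ) : {u | latticePoint m θ u ∈ P}.Finite := by
  obtain ⟨C, hC⟩ := hP.exists_norm_le
  have hm' : (0 : ℝ) < m := Nat.cast_pos.mpr hm
  refine (Set.Finite.pi' fun i => Set.finite_Icc (⌊-C * m - θ i⌋) (⌈C * m - θ i⌉)).subset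
    fun u hu i => ?_
  have h := abs_le.mp ((norm_le_pi_norm _ i).trans (hC _ hu))
  simp only [latticePoint] at h
  rw [le_div_iff₀ hm', div_le_iff₀ hm'] at h
  refine ⟨Int.floor_le_iff.mpr ?_, Int.le_ceil_iff.mpr ?_⟩ <;> linarith [h.1, h.2]

theorem volume_latticeCell_preimage {m : ℕ} (hm : 0 < m) (θ : Fin n → ℝ) (u : Fin n → ℤ) :
    MeasurableSet (latticeCell m θ ⁻¹' {u}) ∧
      volume.real (latticeCell m θ ⁻¹' {u}) = 1 / (m : ℝ) ^ n ∧
      volume (latticeCell m θ ⁻¹' {u}) < ⊤ := by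
  have hm' : (0 : ℝ) < m := Nat.cast_pos.mpr hm
  have h : latticeCell m θ ⁻¹' {u} =
      Set.univ.pi fun i => Set.Ico ((u i + θ i) / m) ((u i + θ i + 1) / m) := by
    ext x
    simp only [latticeCell, Set.mem_preimage, Set.mem_singleton_iff, funext_iff, Int.floor_eq_iff,
      Set.mem_pi, Set.mem_univ, forall_true_left, Set.mem_Ico, div_le_iff₀ hm', lt_div_iff₀ hm']
    refine forall_congr' fun i => and_congr ?_ ?_ <;> constructor <;> intro <;> linarith
  have hv : volume (latticeCell m θ ⁻¹' {u}) = ENNReal.ofReal (1 / (m : ℝ) ^ n) := by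
    rw [h, Real.volume_pi_Ico, one_div, ← inv_pow,
      ENNReal.ofReal_pow (inv_nonneg.mpr hm'.le)]
    have : ∀ i, (u i + θ i + 1) / (m : ℝ) - (u i + θ i) / m = (m : ℝ)⁻¹ := fun i => by
      field_simp; ring
    simp [this]
  refine ⟨?_, ?_, ?_⟩
  · rw [h]
    exact MeasurableSet.univ_pi fun _ => measurableSet_Ico
  · rw [measureReal_def, hv, ENNReal.toReal_ofReal (by positivity)]
  · rw [hv]
    exact ENNReal.ofReal_lt_top

/-- Riemann sums over shifted lattices converge to the integral, whatever the shifts are. -/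
theorem tendsto_sum_latticePoint {P : Set (Fin n → ℝ)} (hP : Bornology.IsBounded P)
    (hPm : MeasurableSet P) (hfr : volume (frontier P) = 0) {F : (Fin n → ℝ) → ℝ}
    (hF : Continuous F) (θ : ℕ → Fin n → ℝ) :
    Tendsto (fun m : ℕ => 1 / (m : ℝ) ^ n *
      ∑ᶠ u ∈ {u | latticePoint m (θ m) u ∈ P}, F (latticePoint m (θ m) u)) atTop
      (𝓝 (∫ x in P, F x)) := by
  classical
  set G := P.indicator F with hG
  -- the step function with value `G ((u + θ) / m)` on the cell of `u`
  set g : ℕ → (Fin n → ℝ) → ℝ := fun m x => G (latticePoint m (θ m) (latticeCell m (θ m) x))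
  have hstep : ∀ m, (hm : 0 < m) → g m = fun x =>
      ∑ u ∈ (finite_latticePoint_mem hP hm (θ m)).toFinset,
        (latticeCell m (θ m) ⁻¹' {u}).indicator (fun _ => F (latticePoint m (θ m) u)) x := by
    intro m hm
    ext x
    simp only [Set.indicator_apply, Set.mem_preimage, Set.mem_singleton_iff]
    rw [Finset.sum_ite_eq]
    simp only [g, hG, Set.indicator_apply, Set.Finite.mem_toFinset, Set.mem_ofPred_eq]
  have hint : ∀ m, (hm : 0 < m) → ∫ x, g m x = 1 / (m : ℝ) ^ n *
      ∑ᶠ u ∈ {u | latticePoint m (θ m) u ∈ P}, F (latticePoint m (θ m) u) := by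
    intro m hm
    rw [hstep m hm, integral_finsetSum]
    · rw [finsum_mem_eq_finite_toFinset_sum _ (finite_latticePoint_mem hP hm (θ m)),
        Finset.mul_sum]
      refine Finset.sum_congr rfl fun u _ => ?_
      obtain ⟨h1, h2, -⟩ := volume_latticeCell_preimage hm (θ m) u
      rw [integral_indicator_const _ h1, h2, smul_eq_mul]
    · intro u _
      obtain ⟨h1, -, h3⟩ := volume_latticeCell_preimage hm (θ m) u
      exact (integrable_indicator_iff h1).mpr (integrableOn_const h3.ne)
  obtain ⟨C, hC⟩ := hP.exists_norm_le
  obtain ⟨R, hR⟩ := exists_nat_ge C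
  obtain ⟨B, hB⟩ := (hP.isCompact_closure.image hF).isBounded.exists_norm_le
  rw [← integral_indicator hPm]
  refine Tendsto.congr' (f₁ := fun m => ∫ x, g m x) ?_ ?_
  · filter_upwards [eventually_gt_atTop 0] with m hm using hint m hm
  refine tendsto_integral_filter_of_dominated_convergence
    ((box n (R + 1)).indicator fun _ => |B|) ?_ ?_ ?_ ?_
  · filter_upwards [eventually_gt_atTop 0] with m hm
    rw [hstep m hm]
    exact (Finset.measurable_fun_sum _ fun u _ => measurable_const.indicator
      (volume_latticeCell_preimage hm (θ m) u).1).aestronglyMeasurable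
  · filter_upwards [eventually_gt_atTop 0] with m hm
    refine Eventually.of_forall fun x => ?_
    simp only [g, hG]
    by_cases h : latticePoint m (θ m) (latticeCell m (θ m) x) ∈ P
    · have hx : x ∈ box n (R + 1) := by
        intro i _
        have h1 := latticePoint_mem_Icc hm (θ m) x i
        have h2 := abs_le.mp ((norm_le_pi_norm _ i).trans ((hC _ h).trans hR))
        have h3 : 1 / (m : ℝ) ≤ 1 := by
          rw [div_le_one (by exact_mod_cast hm)]
          exact_mod_cast hm
        push_cast
        constructor <;> linarith [h1.1, h1.2, h2.1, h2.2]
      rw [Set.indicator_of_mem h, Set.indicator_of_mem hx]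
      exact (hB _ ⟨_, subset_closure h, rfl⟩).trans (le_abs_self B)
    · rw [Set.indicator_of_notMem h, norm_zero]
      by_cases hx : x ∈ box n (R + 1)
      · rw [Set.indicator_of_mem hx]
        exact abs_nonneg B
      · rw [Set.indicator_of_notMem hx]
  · exact (integrable_indicator_iff (measurableSet_box _)).mpr
      (integrableOn_const (isCompact_box _).measure_lt_top.ne)
  · have : ∀ᵐ x, x ∉ frontier P := measure_eq_zero_iff_ae_notMem.mp hfr
    filter_upwards [this] with x hx
    have hlim := tendsto_latticePoint θ x
    by_cases hxP : x ∈ interior P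
    · have h1 : ∀ᶠ m in atTop, g m x = F (latticePoint m (θ m) (latticeCell m (θ m) x)) := by
        filter_upwards [hlim.eventually (mem_interior_iff_mem_nhds.mp hxP)] with m hm
        exact Set.indicator_of_mem hm _
      rw [Set.indicator_of_mem (interior_subset hxP)]
      exact ((hF.tendsto x).comp hlim).congr' (h1.mono fun _ h => h.symm)
    · have hxc : x ∈ (closure P)ᶜ := fun h => hx ⟨h, hxP⟩
      have h1 : ∀ᶠ m in atTop, g m x = 0 := by
        filter_upwards [hlim.eventually (isClosed_closure.isOpen_compl.mem_nhds hxc)] with m hm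
        exact Set.indicator_of_notMem (fun h => hm (subset_closure h)) _
      rw [Set.indicator_of_notMem fun h => hxc (subset_closure h)]
      exact tendsto_const_nhds.congr' (h1.mono fun _ h => h.symm)

/-! ### Boundedness and interior of rational polyhedra -/

/-- A real vector of norm at least one has a positive integral multiple close to a nonzero lattice
vector. -/
theorem exists_int_approx (y : Fin n → ℝ) (hy : 1 ≤ ‖y‖) {ε : ℝ} (hε : 0 < ε) (hε1 : ε ≤ 1) :
    ∃ (q : ℕ) (u : Fin n → ℤ), 0 < q ∧ u ≠ 0 ∧ ∀ i, |q * y i - u i| < ε := by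
  -- two of the points `k y` have close fractional parts
  set z : ℕ → Fin n → ℝ := fun k i => Int.fract (k * y i)
  have hz : ∀ k, z k ∈ Set.univ.pi fun _ : Fin n => Set.Icc (0 : ℝ) 1 := fun k i _ =>
    ⟨Int.fract_nonneg _, (Int.fract_lt_one _).le⟩
  obtain ⟨a, -, φ, hφ, hlim⟩ :=
    (isCompact_univ_pi fun _ : Fin n => isCompact_Icc (a := (0 : ℝ)) (b := 1)).tendsto_subseq hz
  obtain ⟨N, hN⟩ := Metric.cauchySeq_iff.mp hlim.cauchySeq ε hε
  have hd := hN (N + 1) (Nat.le_succ _) N le_rfl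
  have hlt : φ N < φ (N + 1) := hφ (Nat.lt_succ_self N)
  have hclose : ∀ i, |((φ (N + 1) - φ N : ℕ) : ℝ) * y i -
      ((⌊φ (N + 1) * y i⌋ - ⌊φ N * y i⌋ : ℤ) : ℝ)| < ε := fun i => by
    have h := (dist_le_pi_dist _ _ i).trans_lt hd
    rw [Real.dist_eq] at h
    simp only [z, Function.comp, Int.fract] at h
    rw [Nat.cast_sub hlt.le, Int.cast_sub]
    calc _ = _ := by congr 1; ring
      _ < ε := h
  refine ⟨φ (N + 1) - φ N, fun i => ⌊φ (N + 1) * y i⌋ - ⌊φ N * y i⌋, Nat.sub_pos_of_lt hlt, ?_,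
    hclose⟩
  intro h0
  have h1 : ‖y‖ < 1 := by
    refine (pi_norm_lt_iff one_pos).mpr fun i => ?_
    have h2 := hclose i
    have h3 : (⌊φ (N + 1) * y i⌋ - ⌊φ N * y i⌋ : ℤ) = 0 := congrFun h0 i
    rw [h3, Int.cast_zero, sub_zero, abs_mul] at h2
    have h4 : (1 : ℝ) ≤ |((φ (N + 1) - φ N : ℕ) : ℝ)| := by
      rw [Nat.abs_cast]
      exact_mod_cast Nat.sub_pos_of_lt hlt
    rw [Real.norm_eq_abs]
    nlinarith [abs_nonneg (y i)]
  exact absurd hy (not_le.mpr h1)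

/-- A polyhedron with integral normal vectors is bounded if its recession cone contains no nonzero
lattice vector. A real vector of the recession cone is approximated by lattice vectors, which still
lie in the cone because the values of the normal vectors at them are integers. -/
theorem isBounded_polyhedron {ι : Type*} {s : Set ι} (hs : s.Finite) (a : ι → Fin n → ℤ)
    (b : ι → ℝ) (h : ∀ u : Fin n → ℤ, (∀ k ∈ s, 0 ≤ ∑ i, a k i * u i) → u = 0) :
    Bornology.IsBounded {x : Fin n → ℝ | ∀ k ∈ s, 0 ≤ ∑ i, x i * (a k i : ℝ) + b k} := by
  set P := {x : Fin n → ℝ | ∀ k ∈ s, 0 ≤ ∑ i, x i * (a k i : ℝ) + b k}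
  by_contra hP
  have hx : ∀ N : ℕ, ∃ x ∈ P, (N : ℝ) + 1 < ‖x‖ := by
    intro N
    by_contra! hN
    exact hP (isBounded_iff_forall_norm_le.mpr ⟨N + 1, hN⟩)
  choose x hxP hxN using hx
  have hpos : ∀ N, 0 < ‖x N‖ := fun N => lt_trans (by positivity) (hxN N)
  -- a limit point `y` of the directions of the `x N` lies in the recession cone
  have hsph : ∀ N, (‖x N‖⁻¹ • x N) ∈ Metric.sphere (0 : Fin n → ℝ) 1 := fun N => by
    rw [mem_sphere_zero_iff_norm, norm_smul, norm_inv, norm_norm, inv_mul_cancel₀ (hpos N).ne']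
  obtain ⟨y, hy, φ, hφ, hlim⟩ := (isCompact_sphere (0 : Fin n → ℝ) 1).tendsto_subseq hsph
  have hnorm : Tendsto (fun N => ‖x (φ N)‖⁻¹) atTop (𝓝 0) := by
    refine tendsto_inv_atTop_zero.comp (tendsto_atTop_mono (fun N => ?_)
      tendsto_natCast_atTop_atTop)
    have h1 : (N : ℝ) ≤ φ N := by exact_mod_cast hφ.id_le N
    linarith [hxN (φ N)]
  have hcone : ∀ k ∈ s, 0 ≤ ∑ i, y i * (a k i : ℝ) := by
    intro k hk
    have h1 : Tendsto (fun N => ∑ i, (‖x (φ N)‖⁻¹ • x (φ N)) i * (a k i : ℝ) +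
        ‖x (φ N)‖⁻¹ * b k) atTop (𝓝 (∑ i, y i * (a k i : ℝ) + 0 * b k)) :=
      (tendsto_finsetSum _ fun i _ =>
        ((tendsto_pi_nhds.mp hlim i).mul_const _)).add (hnorm.mul_const _)
    rw [zero_mul, add_zero] at h1
    refine ge_of_tendsto' h1 fun N => ?_
    have h2 := mul_nonneg (inv_nonneg.mpr (hpos (φ N)).le) (hxP (φ N) k hk)
    rw [mul_add, Finset.mul_sum] at h2
    simpa only [Pi.smul_apply, smul_eq_mul, mul_assoc] using h2
  obtain ⟨C, hC0, hC⟩ : ∃ C : ℝ, 0 < C ∧ ∀ k ∈ s, ∑ i, |(a k i : ℝ)| ≤ C := by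
    obtain ⟨C, hC⟩ := (hs.image fun k => ∑ i, |(a k i : ℝ)|).bddAbove
    exact ⟨max C 1, by positivity, fun k hk => (hC ⟨k, hk, rfl⟩).trans (le_max_left _ _)⟩
  obtain ⟨q, u, hq, hu, hqu⟩ := exists_int_approx y (mem_sphere_zero_iff_norm.mp hy).ge
    (ε := min 1 (1 / (2 * C))) (by positivity) (min_le_left _ _)
  refine hu (h u fun k hk => ?_)
  -- the integer `⟨a k, u⟩` is larger than `-1`
  have h1 : |∑ i, (q * y i - u i) * (a k i : ℝ)| ≤ 1 / 2 := by
    refine (Finset.abs_sum_le_sum_abs _ _).trans ?_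
    calc ∑ i, |(q * y i - u i) * (a k i : ℝ)| ≤ ∑ i, 1 / (2 * C) * |(a k i : ℝ)| := by
          refine Finset.sum_le_sum fun i _ => ?_
          rw [abs_mul]
          exact mul_le_mul_of_nonneg_right ((hqu i).le.trans (min_le_right _ _)) (abs_nonneg _)
      _ = 1 / (2 * C) * ∑ i, |(a k i : ℝ)| := (Finset.mul_sum _ _ _).symm
      _ ≤ 1 / (2 * C) * C := mul_le_mul_of_nonneg_left (hC k hk) (by positivity)
      _ = 1 / 2 := by field_simp
  have h2 : ∑ i, (q * y i - u i) * (a k i : ℝ) =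
      q * ∑ i, y i * (a k i : ℝ) - ((∑ i, a k i * u i : ℤ) : ℝ) := by
    push_cast
    rw [Finset.mul_sum, ← Finset.sum_sub_distrib]
    exact Finset.sum_congr rfl fun i _ => by ring
  rw [h2, abs_le] at h1
  have h3 : (0 : ℝ) ≤ q * ∑ i, y i * (a k i : ℝ) := mul_nonneg q.cast_nonneg (hcone k hk)
  have h4 : (-1 : ℝ) < ((∑ i, a k i * u i : ℤ) : ℝ) := by linarith [h1.2]
  have h5 : (-1 : ℤ) < ∑ i, a k i * u i := by exact_mod_cast h4
  omega

/-- A convex set which contains segments in all coordinate directions has interior points. -/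
theorem interior_nonempty_of_segments {P : Set (Fin n → ℝ)} (hP : Convex ℝ P)
    (hne : P.Nonempty) (h : ∀ i, ∃ x ∈ P, ∃ c : ℝ, c ≠ 0 ∧ x + Pi.single i c ∈ P) :
    (interior P).Nonempty := by
  rw [hP.interior_nonempty_iff_affineSpan_eq_top, ← AffineSubspace.direction_eq_top_iff_of_nonempty
    ((affineSpan_nonempty ℝ).mpr hne), eq_top_iff, ← (Pi.basisFun ℝ (Fin n)).span_eq,
    Submodule.span_le]
  rintro _ ⟨i, rfl⟩
  obtain ⟨x, hx, c, hc, hxc⟩ := h i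
  have h1 := AffineSubspace.vsub_mem_direction (subset_affineSpan ℝ P hxc)
    (subset_affineSpan ℝ P hx)
  rw [vsub_eq_sub, add_sub_cancel_left] at h1
  have h2 := (affineSpan ℝ P).direction.smul_mem c⁻¹ h1
  rw [Pi.basisFun_apply]
  rwa [← Pi.single_smul, smul_eq_mul, inv_mul_cancel₀ hc] at h2

end

section

/-! ### Normal noetherian domains -/

/-- A normal noetherian domain is the intersection of its localizations at the primes of height
one. -/
theorem mem_range_algebraMap_of_height_one {A K : Type*} [CommRing A] [IsDomain A]
    [IsNoetherianRing A] [IsIntegrallyClosed A] [Field K] [Algebra A K] [IsFractionRing A K]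
    (f : K) (h : ∀ p : Ideal A, p.IsPrime → p.height = 1 →
      ∃ a s : A, s ∉ p ∧ algebraMap A K s * f = algebraMap A K a) :
    f ∈ Set.range (algebraMap A K) := by
  by_contra hf
  -- an associated prime `P` of the class of `f` in `K / A`; it is the annihilator of a class `y`
  let N : Submodule A K := LinearMap.range (Algebra.linearMap A K)
  have hcolon : ∀ (a : A) (z : K), a ∈ (⊥ : Submodule A (K ⧸ N)).colon {N.mkQ z} ↔ a • z ∈ N := by
    intro a z
    rw [Submodule.mem_colon_singleton, Submodule.mem_bot, ← map_smul, Submodule.mkQ_apply,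
      Submodule.Quotient.mk_eq_zero]
  have hx : N.mkQ f ≠ 0 := by
    rw [Ne, Submodule.mkQ_apply, Submodule.Quotient.mk_eq_zero]
    exact hf
  obtain ⟨P, hP, hle⟩ := exists_le_isAssociatedPrime_of_isNoetherianRing A (N.mkQ f) hx
  obtain ⟨hPprime, y', hy'⟩ := isAssociatedPrime_iff.mp hP
  obtain ⟨y, rfl⟩ := N.mkQ_surjective y'
  have hPy : ∀ a : A, a ∈ P ↔ a • y ∈ N := fun a => by rw [hy', hcolon]
  have hyN : y ∉ N := fun hy => hPprime.ne_top
    ((Ideal.eq_top_iff_one P).mpr ((hPy 1).mpr (by rwa [one_smul])))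
  have hP0 : P ≠ ⊥ := by
    obtain ⟨a, b, hb, rfl⟩ := IsFractionRing.div_surjective (A := A) y
    have hb0 := nonZeroDivisors.ne_zero hb
    refine (Submodule.ne_bot_iff P).mpr ⟨b, (hPy b).mpr ⟨a, ?_⟩, hb0⟩
    rw [Algebra.linearMap_apply, Algebra.smul_def, mul_div_cancel₀]
    exact (map_ne_zero_iff _ (IsFractionRing.injective A K)).mpr hb0
  -- as `A` is integrally closed and `y ∉ A`, multiplication by `y` does not map `P` to `P`
  obtain ⟨b, hb, c, hc, hcy⟩ : ∃ b ∈ P, ∃ c ∉ P, b • y = algebraMap A K c := by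
    by_contra! hcon
    refine hyN (IsIntegrallyClosed.isIntegral_iff.mp (isIntegral_of_smul_mem_submodule
      (Submodule.map (Algebra.linearMap A K) P) ?_ ?_ y ?_))
    · intro h
      refine hP0 (Submodule.map_injective_of_injective (f := Algebra.linearMap A K)
        (IsFractionRing.injective A K) ?_)
      rw [h, Submodule.map_bot]
    · exact (IsNoetherian.noetherian P).map _
    · rintro _ ⟨a, ha, rfl⟩
      obtain ⟨d, hd⟩ := (hPy a).mp ha
      refine ⟨d, ?_, ?_⟩
      · by_contra hdP
        exact hcon a ha d hdP hd.symm
      · rw [hd, Algebra.linearMap_apply, Algebra.smul_def, smul_eq_mul, mul_comm]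
  -- hence `P` is minimal over the principal ideal `(b)`
  have hmin : P ∈ (Ideal.span {b}).minimalPrimes := by
    refine ⟨⟨hPprime, (Ideal.span_singleton_le_iff_mem P).mpr hb⟩, ?_⟩
    rintro Q ⟨hQ, hbQ⟩ hQP a ha
    obtain ⟨d, hd⟩ := (hPy a).mp ha
    have h1 : a * c = b * d := by
      apply IsFractionRing.injective A K
      rw [Algebra.linearMap_apply, Algebra.smul_def] at hd
      rw [Algebra.smul_def] at hcy
      rw [map_mul, map_mul, hd, ← hcy]
      ring
    have h2 : a * c ∈ Q := by
      rw [h1]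
      exact Q.mul_mem_right _ ((Ideal.span_singleton_le_iff_mem Q).mp hbQ)
    exact (hQ.mem_or_mem h2).resolve_right fun h3 => hc (hQP h3)
  have hht : P.height = 1 := by
    refine le_antisymm (Ideal.height_le_one_of_isPrincipal_of_mem_minimalPrimes _ P hmin) ?_
    rw [Order.one_le_iff_ne_zero, Ne, Ideal.height_eq_zero_iff_eq_bot]
    exact hP0
  obtain ⟨a, s, hs, hsa⟩ := h P hPprime hht
  refine hs (hle ((hcolon s f).mpr ⟨a, ?_⟩))
  rw [Algebra.linearMap_apply, Algebra.smul_def, hsa]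

/-! ### The coordinate ring of the torus -/

variable {n : ℕ}

theorem isUnit_single (u : Fin n → ℤ) {c : ℂ} (hc : c ≠ 0) :
    IsUnit (AddMonoidAlgebra.single u c : torusRing n) :=
  IsUnit.of_mul_eq_one (AddMonoidAlgebra.single (-u) c⁻¹) (by
    rw [AddMonoidAlgebra.single_mul_single, add_neg_cancel, mul_inv_cancel₀ hc]; rfl)

/-- The units of the coordinate ring of the torus are the monomials. -/
theorem eq_single_of_isUnit {f : torusRing n} (hf : IsUnit f) :
    ∃ (u : Fin n → ℤ) (c : ℂ), c ≠ 0 ∧ f = AddMonoidAlgebra.single u c := by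
  obtain ⟨g, hg⟩ := hf.exists_right_inv
  have hf0 : f.coeff.support.Nonempty := by
    rw [Finsupp.support_nonempty_iff, Ne, AddMonoidAlgebra.coeff_eq_zero]
    exact hf.ne_zero
  have hg0 : g.coeff.support.Nonempty := by
    rw [Finsupp.support_nonempty_iff, Ne, AddMonoidAlgebra.coeff_eq_zero]
    rintro rfl
    simp at hg
  -- otherwise two different monomials occur in the product `f * g = 1`
  have hcard : f.coeff.support.card * g.coeff.support.card ≤ 1 := by
    by_contra! hlt
    obtain ⟨p, hp, q, hq, hne, hup, huq⟩ := TwoUniqueSums.uniqueAdd_of_one_lt_card hlt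
    rw [Finset.mem_product, Finsupp.mem_support_iff, Finsupp.mem_support_iff] at hp hq
    have key : ∀ r : (Fin n → ℤ) × (Fin n → ℤ), f.coeff r.1 ≠ 0 → g.coeff r.2 ≠ 0 →
        UniqueAdd f.coeff.support g.coeff.support r.1 r.2 → r.1 + r.2 = 0 := by
      intro r h1 h2 hu
      have h3 := AddMonoidAlgebra.coeff_mul_add_of_uniqueAdd hu
      rw [hg] at h3
      by_contra h0
      have h4 : (1 : torusRing n).coeff (r.1 + r.2) = 0 := by
        rw [AddMonoidAlgebra.one_def, AddMonoidAlgebra.coeff_single,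
          Finsupp.single_eq_of_ne h0]
      rw [h4] at h3
      exact mul_ne_zero h1 h2 h3.symm
    have h1 := key p hp.1 hp.2 hup
    have h2 := key q hq.1 hq.2 huq
    have h3 := hup (Finsupp.mem_support_iff.mpr hq.1) (Finsupp.mem_support_iff.mpr hq.2)
      (h2.trans h1.symm)
    exact hne (Prod.ext h3.1.symm h3.2.symm)
  have hf1 : f.coeff.support.card = 1 := by
    have h1 := Finset.card_pos.mpr hf0
    have h2 := Finset.card_pos.mpr hg0
    nlinarith
  obtain ⟨u, c, hc, huc⟩ := Finsupp.card_support_eq_one'.mp hf1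
  exact ⟨u, c, hc, AddMonoidAlgebra.coeff_injective huc⟩

/-- The inclusion of the exponents of polynomials in the exponents of Laurent polynomials. -/
def natExponent (n : ℕ) : (Fin n →₀ ℕ) →+ (Fin n → ℤ) where
  toFun e i := (e i : ℤ)
  map_zero' := rfl
  map_add' e f := by ext i; simp

theorem natExponent_injective : Function.Injective (natExponent n) := fun e f h => by
  ext i
  exact Int.natCast_inj.mp (congrFun h i)

/-- Laurent polynomials are a localization of polynomials, hence form a factorial ring. -/
instance : UniqueFactorizationMonoid (torusRing n) := by
  let φ : MvPolynomial (Fin n) ℂ →+* torusRing n :=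
    AddMonoidAlgebra.mapDomainRingHom ℂ (natExponent n)
  have hφ : ∀ (e : Fin n →₀ ℕ) (c : ℂ), φ (MvPolynomial.monomial e c) =
      AddMonoidAlgebra.single (natExponent n e) c := fun e c =>
    AddMonoidAlgebra.mapDomain_single
  algebraize [φ]
  let S : Submonoid (MvPolynomial (Fin n) ℂ) :=
    MonoidHom.mrange ((MvPolynomial.monomialOneHom ℂ (Fin n)))
  have : IsLocalization S (torusRing n) :=
    { map_units := by
        rintro ⟨_, e, rfl⟩
        exact (hφ (Multiplicative.toAdd e) 1) ▸ isUnit_single _ one_ne_zero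
      surj := by
        intro f
        induction f using AddMonoidAlgebra.induction_linear with
        | zero => exact ⟨(0, 1), by simp⟩
        | add f g hf hg =>
          obtain ⟨⟨a, s⟩, h⟩ := hf
          obtain ⟨⟨b, t⟩, h'⟩ := hg
          refine ⟨(a * t + b * s, s * t), ?_⟩
          simp only [Submonoid.coe_mul, map_mul, map_add] at h h' ⊢
          rw [← h, ← h']
          ring
        | single u c =>
          refine ⟨(MvPolynomial.monomial (Finsupp.equivFunOnFinite.symm fun i => (u i).toNat) c,
            ⟨_, Multiplicative.ofAdd (Finsupp.equivFunOnFinite.symm fun i => (-u i).toNat), rfl⟩),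
            ?_⟩
          change _ * φ (MvPolynomial.monomial _ 1) = φ (MvPolynomial.monomial _ c)
          rw [hφ, hφ, AddMonoidAlgebra.single_mul_single, mul_one]
          congr 1
          ext i
          change u i + ((-u i).toNat : ℤ) = ((u i).toNat : ℤ)
          omega
      exists_of_eq := by
        intro x y hxy
        exact ⟨1, by rw [AddMonoidAlgebra.mapDomain_injective natExponent_injective hxy]⟩ }
  exact UniqueFactorizationMonoid.of_isLocalization S (torusRing n)

/-- The automorphism of the coordinate ring of the torus which multiplies the character `u` by
`t u`. -/
def scale (t : torusRing n →ₐ[ℂ] ℂ) : torusRing n →ₐ[ℂ] torusRing n :=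
  AddMonoidAlgebra.lift ℂ (torusRing n) (Fin n → ℤ)
    { toFun := fun u => AddMonoidAlgebra.single u.toAdd (t (AddMonoidAlgebra.single u.toAdd 1))
      map_one' := by
        change AddMonoidAlgebra.single 0 (t 1) = _
        rw [map_one]; rfl
      map_mul' := fun u w => by
        rw [AddMonoidAlgebra.single_mul_single, ← map_mul, AddMonoidAlgebra.single_mul_single,
          mul_one]; rfl }

theorem coeff_scale (t : torusRing n →ₐ[ℂ] ℂ) (f : torusRing n) (u : Fin n → ℤ) :
    (scale t f).coeff u = t (AddMonoidAlgebra.single u 1) * f.coeff u := by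
  induction f using AddMonoidAlgebra.induction_linear with
  | zero => simp
  | add f g hf hg => simp [hf, hg, mul_add]
  | single w c =>
    rw [scale, AddMonoidAlgebra.lift_single]
    simp only [MonoidHom.coe_mk, OneHom.coe_mk, toAdd_ofAdd, AddMonoidAlgebra.coeff_smul_apply,
      AddMonoidAlgebra.coeff_single]
    by_cases h : w = u
    · subst h; simp [mul_comm]
    · simp [Finsupp.single_eq_of_ne (Ne.symm h)]

/-- The point of the torus with given nonzero coordinates. -/
def evalPoint (z : Fin n → ℂˣ) : torusRing n →ₐ[ℂ] ℂ :=
  AddMonoidAlgebra.lift ℂ ℂ (Fin n → ℤ)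
    { toFun := fun u => ((∏ i, z i ^ u.toAdd i : ℂˣ) : ℂ)
      map_one' := by simp
      map_mul' := fun u w => by simp [zpow_add, Finset.prod_mul_distrib] }

theorem evalPoint_single (z : Fin n → ℂˣ) (u : Fin n → ℤ) :
    evalPoint z (AddMonoidAlgebra.single u 1) = ((∏ i, z i ^ u i : ℂˣ) : ℂ) := by
  rw [evalPoint, AddMonoidAlgebra.lift_single, one_smul]; rfl

theorem exists_separating_point {u w : Fin n → ℤ} (h : u ≠ w) :
    ∃ t : torusRing n →ₐ[ℂ] ℂ,
      t (AddMonoidAlgebra.single u 1) ≠ t (AddMonoidAlgebra.single w 1) := by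
  obtain ⟨i, hi⟩ := Function.ne_iff.mp h
  refine ⟨evalPoint (Function.update 1 i (Units.mk0 2 two_ne_zero)), fun h2 => hi ?_⟩
  rw [evalPoint_single, evalPoint_single, Units.val_inj, Finset.prod_eq_single i,
    Finset.prod_eq_single i] at h2
  · simp only [Function.update_self, Units.ext_iff, Units.val_zpow_eq_zpow_val, Units.val_mk0] at h2
    have h3 : ((2 : ℝ) ^ (u i)) = 2 ^ (w i) := by
      simpa [norm_zpow] using congrArg norm h2
    exact zpow_right_injective₀ two_pos (by norm_num) h3
  all_goals simp +contextual [Function.update_of_ne]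

/-- A torus-invariant subspace of the coordinate ring contains the characters which occur in its
elements. This is where invariance under the torus enters the estimates of valuations. -/
theorem single_mem_of_invariant (W : Submodule ℂ (torusRing n))
    (hW : ∀ t : torusRing n →ₐ[ℂ] ℂ, ∀ f ∈ W, scale t f ∈ W) {f : torusRing n} (hf : f ∈ W)
    {u : Fin n → ℤ} (hu : f.coeff u ≠ 0) : AddMonoidAlgebra.single u 1 ∈ W := by
  induction hN : f.coeff.support.card using Nat.strong_induction_on generalizing f with
  | _ N ih =>
    by_cases hone : ∃ w, w ≠ u ∧ f.coeff w ≠ 0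
    · -- eliminate the character `w` from `f`
      obtain ⟨w, hwu, hw⟩ := hone
      obtain ⟨t, ht⟩ := exists_separating_point hwu
      set g := t (AddMonoidAlgebra.single w 1) • f - scale t f with hg
      have hgc : ∀ x, g.coeff x =
          (t (AddMonoidAlgebra.single w 1) - t (AddMonoidAlgebra.single x 1)) * f.coeff x := by
        intro x
        rw [hg, AddMonoidAlgebra.coeff_sub, Finsupp.sub_apply,
          AddMonoidAlgebra.coeff_smul_apply, coeff_scale, smul_eq_mul, sub_mul]
      refine ih _ ?_ (sub_mem (W.smul_mem _ hf) (hW t f hf)) (f := g) ?_ rfl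
      · rw [← hN]
        refine Finset.card_lt_card (Finset.ssubset_iff_subset_ne.mpr ⟨fun x hx => ?_, fun h => ?_⟩)
        · rw [Finsupp.mem_support_iff] at hx ⊢
          rw [hgc] at hx
          exact right_ne_zero_of_mul hx
        · have := h ▸ Finsupp.mem_support_iff.mpr hw
          rw [Finsupp.mem_support_iff, hgc, sub_self, zero_mul] at this
          exact this rfl
      · rw [hgc]
        exact mul_ne_zero (sub_ne_zero.mpr ht) hu
    · have hfu : f = f.coeff u • AddMonoidAlgebra.single u 1 := by
        push Not at hone
        refine AddMonoidAlgebra.coeff_injective (Finsupp.ext fun x => ?_)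
        rw [AddMonoidAlgebra.coeff_smul_apply, AddMonoidAlgebra.coeff_single]
        by_cases hx : x = u
        · subst hx; simp
        · simp [Finsupp.single_eq_of_ne hx, hone x hx]
      have := W.smul_mem (f.coeff u)⁻¹ hf
      rw [hfu, smul_smul] at this
      simpa [hu] using this

/-- The only proper torus-invariant ideal of the coordinate ring is `0`. -/
theorem eq_bot_of_invariant (I : Ideal (torusRing n)) (hI : I ≠ ⊤)
    (hinv : ∀ t : torusRing n →ₐ[ℂ] ℂ, ∀ f ∈ I, scale t f ∈ I) : I = ⊥ := by
  by_contra h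
  obtain ⟨f, hf, hf0⟩ := Submodule.exists_mem_ne_zero_of_ne_bot h
  obtain ⟨u, hu⟩ : ∃ u, f.coeff u ≠ 0 := by
    by_contra! h0
    exact hf0 (AddMonoidAlgebra.coeff_injective (Finsupp.ext h0))
  exact hI (Ideal.eq_top_of_isUnit_mem _
    (single_mem_of_invariant (I.restrictScalars ℂ) hinv hf hu) (isUnit_single u one_ne_zero))

/-! ### Linear algebra -/

/-- Two bases of a vector space can be matched in such a way that every vector of the second one
has a nonzero coordinate at the corresponding vector of the first one: some term of the Leibniz
expansion of the determinant of the base change is nonzero. -/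
theorem exists_equiv_repr_ne_zero {k W ι κ : Type*} [Field k] [AddCommGroup W] [Module k W]
    [Fintype ι] [Fintype κ] (e : Module.Basis κ k W) (s : Module.Basis ι k W) :
    ∃ σ : ι ≃ κ, ∀ j, e.repr (s j) (σ j) ≠ 0 := by
  classical
  let s' : Module.Basis κ k W := s.reindex (s.indexEquiv e)
  have hdet : (e.toMatrix s').det ≠ 0 := by
    rw [← Module.Basis.det_apply]
    exact (e.isUnit_det s').ne_zero
  rw [Matrix.det_apply] at hdet
  obtain ⟨σ, -, hσ⟩ := Finset.exists_ne_zero_of_sum_ne_zero hdet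
  refine ⟨(s.indexEquiv e).trans σ, fun j => ?_⟩
  have h1 : ∏ i, e.toMatrix s' (σ i) i ≠ 0 := fun h => hσ (by rw [h, smul_zero])
  have h2 := Finset.prod_ne_zero_iff.mp h1 (s.indexEquiv e j) (Finset.mem_univ _)
  simpa [Module.Basis.toMatrix_apply, s'] using h2

end

/-! ### Regular functions and local rings -/

section Stalks

variable {X : Scheme.{0}} [IsIntegral X]

/-- The rational function `f` is regular at the point `x`. -/
def IsRegularAt (f : X.functionField) (x : X) : Prop :=
  f ∈ Set.range (algebraMap (X.presheaf.stalk x) X.functionField)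

theorem stalk_injective (x : X) :
    Function.Injective (algebraMap (X.presheaf.stalk x) X.functionField) :=
  IsFractionRing.injective _ _

theorem isRegularAt_germ {U : X.Opens} [Nonempty U] (a : Γ(X, U)) {x : X} (hx : x ∈ U) :
    IsRegularAt (X.germToFunctionField U a) x :=
  ⟨X.presheaf.germ U x hx a, Scheme.algebraMap_germ_eq_germToFunctionField X hx a⟩

/-- A rational function which is regular at all points of an open set is a section over it. -/
theorem exists_section_of_isRegularAt {U : X.Opens} [Nonempty U] {f : X.functionField}
    (hf : ∀ x ∈ U, IsRegularAt f x) : ∃ a : Γ(X, U), X.germToFunctionField U a = f := by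
  have hloc : ∀ x : U, ∃ (V : X.Opens) (_ : x.1 ∈ V) (_ : V ≤ U) (_ : Nonempty V) (a : Γ(X, V)),
      X.germToFunctionField V a = f := by
    rintro ⟨x, hx⟩
    obtain ⟨s, hs⟩ := hf x hx
    obtain ⟨V, hxV, a, rfl⟩ := X.presheaf.exists_germ_eq s
    have hUV : Nonempty (U ⊓ V : X.Opens) := ⟨⟨x, hx, hxV⟩⟩
    have : Nonempty V := ⟨⟨x, hxV⟩⟩
    refine ⟨U ⊓ V, ⟨hx, hxV⟩, inf_le_left, hUV, X.presheaf.map (homOfLE inf_le_right).op a, ?_⟩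
    rw [← hs, Scheme.algebraMap_germ_eq_germToFunctionField X hxV]
    exact X.presheaf.germ_res_apply _ _ _ a
  choose V hxV hVU hV a ha using hloc
  have hcov : U ≤ iSup V := fun x hx => TopologicalSpace.Opens.mem_iSup.mpr ⟨⟨x, hx⟩, hxV ⟨x, hx⟩⟩
  have hcompat : TopCat.Presheaf.IsCompatible X.presheaf V a := by
    intro x y
    by_cases hne : Nonempty (V x ⊓ V y : X.Opens)
    · apply X.germToFunctionField_injective (V x ⊓ V y)
      have e1 : X.germToFunctionField (V x ⊓ V y)
          (X.presheaf.map (TopologicalSpace.Opens.infLELeft (V x) (V y)).op (a x)) =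
          X.germToFunctionField (V x) (a x) := X.presheaf.germ_res_apply _ _ _ (a x)
      have e2 : X.germToFunctionField (V x ⊓ V y)
          (X.presheaf.map (TopologicalSpace.Opens.infLERight (V x) (V y)).op (a y)) =
          X.germToFunctionField (V y) (a y) := X.presheaf.germ_res_apply _ _ _ (a y)
      exact e1.trans ((ha x).trans ((ha y).symm.trans e2.symm))
    · have hbot : V x ⊓ V y = ⊥ := by
        rw [← TopologicalSpace.Opens.coe_eq_empty]
        exact Set.not_nonempty_iff_eq_empty.mp fun ⟨z, hz⟩ => hne ⟨⟨z, hz⟩⟩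
      have : Subsingleton Γ(X, V x ⊓ V y) := by
        rw [hbot]; infer_instance
      exact Subsingleton.elim _ _
  obtain ⟨s, hs, -⟩ := X.sheaf.existsUnique_gluing' V U (fun x => homOfLE (hVU x)) hcov a hcompat
  refine ⟨s, ?_⟩
  obtain ⟨x⟩ := ‹Nonempty U›
  rw [← ha x, ← hs x]
  exact (X.presheaf.germ_res_apply (homOfLE (hVU x)) _ _ s).symm

/-! ### Points of affine open subsets -/

/-- The prime ideal of an affine open set at one of its points consists of the functions which
vanish at this point. -/
theorem mem_primeIdealOf_iff {X : Scheme.{0}} {U : X.Opens} (hU : IsAffineOpen U) (y : U)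
    (a : Γ(X, U)) : a ∈ (hU.primeIdealOf y).asIdeal ↔ ¬ IsUnit (X.presheaf.germ U y y.2 a) := by
  let := X.presheaf.algebra_section_stalk y
  have := hU.isLocalization_stalk y
  have h := IsLocalization.AtPrime.to_map_mem_maximal_iff (X.presheaf.stalk y.1)
    (hU.primeIdealOf y).asIdeal a
  rw [← h, IsLocalRing.mem_maximalIdeal, mem_nonunits_iff]
  rfl

theorem isRegularAt_iff_exists_div {U : X.Opens} (hU : IsAffineOpen U) [Nonempty U] (y : U)
    (f : X.functionField) : IsRegularAt f y.1 ↔ ∃ a s : Γ(X, U), s ∉ (hU.primeIdealOf y).asIdeal ∧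
      X.germToFunctionField U s * f = X.germToFunctionField U a := by
  let := X.presheaf.algebra_section_stalk y
  have := hU.isLocalization_stalk y
  have hg : ∀ a : Γ(X, U), algebraMap (X.presheaf.stalk y.1) X.functionField
      (X.presheaf.germ U y y.2 a) = X.germToFunctionField U a :=
    fun a => Scheme.algebraMap_germ_eq_germToFunctionField X y.2 a
  constructor
  · rintro ⟨b, rfl⟩
    obtain ⟨⟨a, s⟩, h⟩ := IsLocalization.surj (hU.primeIdealOf y).asIdeal.primeCompl b
    refine ⟨a, s, s.2, ?_⟩
    rw [← hg, ← hg, ← map_mul, mul_comm]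
    exact congrArg _ h
  · rintro ⟨a, s, hs, h⟩
    have hu : IsUnit (X.presheaf.germ U y y.2 s) := by
      by_contra hc
      exact hs ((mem_primeIdealOf_iff hU y s).mpr hc)
    obtain ⟨b, hb⟩ := hu.exists_right_inv
    refine ⟨b * X.presheaf.germ U y y.2 a, ?_⟩
    rw [map_mul, hg, ← h, ← hg, ← mul_assoc, ← map_mul, mul_comm b, hb, map_one, one_mul]

theorem exists_point_of_prime {X : Scheme.{0}} {U : X.Opens} (hU : IsAffineOpen U)
    (p : Ideal Γ(X, U)) (hp : p.IsPrime) :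
    ∃ y : U, (hU.primeIdealOf y).asIdeal = p := by
  have hy : hU.fromSpec ⟨p, hp⟩ ∈ U := (hU.isoSpec.inv _).2
  refine ⟨⟨_, hy⟩, ?_⟩
  have h := hU.fromSpec_primeIdealOf ⟨_, hy⟩
  have := hU.isOpenImmersion_fromSpec
  exact congrArg PrimeSpectrum.asIdeal (hU.fromSpec.isOpenEmbedding.injective h)

theorem coheight_eq_height {X : Scheme.{0}} {U : X.Opens} (hU : IsAffineOpen U)
    (y : U) : (coheight y.1 : WithBot ℕ∞) =
    (hU.primeIdealOf y).asIdeal.height := by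
  let := X.presheaf.algebra_section_stalk y
  have := hU.isLocalization_stalk y
  rw [← ringKrullDim_stalk_eq_coheight,
    IsLocalization.AtPrime.ringKrullDim_eq_height (hU.primeIdealOf y).asIdeal]

theorem specializes_of_primeIdealOf_le {X : Scheme.{0}} {U : X.Opens} (hU : IsAffineOpen U)
    {y z : U}
    (h : (hU.primeIdealOf y).asIdeal ≤ (hU.primeIdealOf z).asIdeal) : y.1 ⤳ z.1 := by
  have h1 : hU.primeIdealOf y ⤳ hU.primeIdealOf z :=
    (PrimeSpectrum.le_iff_specializes _ _).mp h
  have h2 := h1.map hU.fromSpec.continuous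
  rwa [hU.fromSpec_primeIdealOf, hU.fromSpec_primeIdealOf] at h2

/-! ### Orders of vanishing -/

variable [IsLocallyNoetherian X]

theorem ord_one (x : X) : Scheme.ord (1 : X.functionField) x = 0 := by
  have := Scheme.ord_mul (x := x) (one_ne_zero (α := X.functionField)) one_ne_zero
  rw [mul_one] at this
  omega

theorem ord_inv (x : X) {f : X.functionField} (hf : f ≠ 0) :
    Scheme.ord f⁻¹ x = - Scheme.ord f x := by
  have := Scheme.ord_mul (x := x) hf (inv_ne_zero hf)
  rw [mul_inv_cancel₀ hf, ord_one] at this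
  omega

theorem ord_pow (x : X) {f : X.functionField} (hf : f ≠ 0) (k : ℕ) :
    Scheme.ord (f ^ k) x = k * Scheme.ord f x := by
  induction k with
  | zero => simp [ord_one]
  | succ k ih =>
    rw [pow_succ, Scheme.ord_mul (pow_ne_zero k hf) hf, ih]
    push_cast
    ring

theorem ord_zpow (x : X) {f : X.functionField} (hf : f ≠ 0) (k : ℤ) :
    Scheme.ord (f ^ k) x = k * Scheme.ord f x := by
  obtain ⟨m, rfl | rfl⟩ := k.eq_nat_or_neg
  · rw [zpow_natCast, ord_pow x hf]
  · rw [zpow_neg, zpow_natCast, ord_inv x (pow_ne_zero m hf), ord_pow x hf]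
    ring

theorem ord_of_isUnit_stalk {x : X} {a : X.presheaf.stalk x} (ha : IsUnit a) :
    Scheme.ord (algebraMap _ X.functionField a) x = 0 := by
  by_cases hx : coheight x = 1
  · have hk : Ring.KrullDimLE 1 (X.presheaf.stalk x) := krullDimLE_of_coheight_le hx.le
    rw [Scheme.ord_eq_iff hx ((map_ne_zero_iff _ (stalk_injective x)).mpr ha.ne_zero)]
    exact Ring.ordFrac_of_isUnit ha
  · simp [hx]

section DVR

variable [IsNormalScheme X] {x : X}

theorem isRegularAt_iff_ord_nonneg (hx : coheight x = 1) {f : X.functionField} (hf : f ≠ 0) :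
    IsRegularAt f x ↔ 0 ≤ Scheme.ord f x := by
  have := stalk_isDiscreteValuationRing hx
  have hk : Ring.KrullDimLE 1 (X.presheaf.stalk x) := krullDimLE_of_coheight_le hx.le
  have hreg : ∀ a : X.presheaf.stalk x, a ≠ 0 →
      0 ≤ Scheme.ord (algebraMap _ X.functionField a) x := by
    intro a ha
    rw [Scheme.le_ord_iff hx ((map_ne_zero_iff _ (stalk_injective x)).mpr ha)]
    exact Ring.ordFrac_ge_one_of_ne_zero ha
  constructor
  · rintro ⟨a, rfl⟩
    exact hreg a fun h => hf (by rw [h, map_zero])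
  · intro h
    rcases ValuationRing.isInteger_or_isInteger (X.presheaf.stalk x) f with ⟨a, ha⟩ | ⟨a, ha⟩
    · exact ⟨a, ha⟩
    · have ha0 : a ≠ 0 := by
        rintro rfl
        rw [map_zero] at ha
        exact hf (inv_eq_zero.mp ha.symm)
      have hK : algebraMap _ X.functionField a ≠ 0 := by rw [ha]; exact inv_ne_zero hf
      have h1 : Scheme.ord (algebraMap _ X.functionField a) x = 0 := by
        refine le_antisymm ?_ (hreg a ha0)
        have h2 := Scheme.ord_mul (x := x) hf hK
        rw [ha, mul_inv_cancel₀ hf, ord_one] at h2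
        rw [ha]
        omega
      rw [Scheme.ord_eq_iff hx hK] at h1
      have hu : IsUnit a := Ring.isUnit_iff_ordFrac_one_of_isDiscreteValuationRing.mpr h1
      obtain ⟨b, hb⟩ := hu.exists_right_inv
      refine ⟨b, ?_⟩
      have h4 : algebraMap _ X.functionField a * algebraMap _ X.functionField b = 1 := by
        rw [← map_mul, hb, map_one]
      rw [ha] at h4
      exact (eq_of_inv_mul_eq_one h4).symm

theorem ord_pos_iff (hx : coheight x = 1) {a : X.presheaf.stalk x} (ha : a ≠ 0) :
    0 < Scheme.ord (algebraMap _ X.functionField a) x ↔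
      a ∈ IsLocalRing.maximalIdeal (X.presheaf.stalk x) := by
  have := stalk_isDiscreteValuationRing hx
  have hk : Ring.KrullDimLE 1 (X.presheaf.stalk x) := krullDimLE_of_coheight_le hx.le
  have hK := (map_ne_zero_iff _ (stalk_injective x)).mpr ha
  have h0 := (isRegularAt_iff_ord_nonneg hx hK).mp ⟨a, rfl⟩
  rw [IsLocalRing.mem_maximalIdeal, mem_nonunits_iff]
  constructor
  · intro h hu
    rw [ord_of_isUnit_stalk hu] at h
    exact lt_irrefl _ h
  · intro h
    refine lt_of_le_of_ne h0 fun h1 => h ?_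
    exact Ring.isUnit_iff_ordFrac_one_of_isDiscreteValuationRing.mpr
      ((Scheme.ord_eq_iff hx hK).mp h1.symm)

theorem ord_irreducible (hx : coheight x = 1) {ϖ : X.presheaf.stalk x} (h : Irreducible ϖ) :
    Scheme.ord (algebraMap _ X.functionField ϖ) x = 1 := by
  have := stalk_isDiscreteValuationRing hx
  have hk : Ring.KrullDimLE 1 (X.presheaf.stalk x) := krullDimLE_of_coheight_le hx.le
  rw [Scheme.ord_eq_iff hx ((map_ne_zero_iff _ (stalk_injective x)).mpr h.ne_zero)]
  exact Ring.ordFrac_irreducible h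

end DVR

/-- On a normal scheme, a rational function which has no poles along the prime divisors through `ξ`
is regular at `ξ`. -/
theorem isRegularAt_of_ord_nonneg [IsNormalScheme X] {f : X.functionField} (ξ : X)
    (hf : ∀ y : X, y ⤳ ξ → coheight y = 1 → 0 ≤ Scheme.ord f y) : IsRegularAt f ξ := by
  by_cases hf0 : f = 0
  · exact ⟨0, by rw [hf0, map_zero]⟩
  have := IsNormalScheme.stalk_isIntegrallyClosed ξ
  obtain ⟨_, ⟨U, hU, rfl⟩, hξU, -⟩ :=
    X.isBasis_affineOpens.exists_subset_of_mem_open (Set.mem_univ ξ) isOpen_univ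
  replace hU : IsAffineOpen U := hU
  have : Nonempty U := ⟨⟨ξ, hξU⟩⟩
  refine mem_range_algebraMap_of_height_one f fun P hP hPht => ?_
  let := X.presheaf.algebra_section_stalk ⟨ξ, hξU⟩
  have := hU.isLocalization_stalk ⟨ξ, hξU⟩
  have hg : ∀ a : Γ(X, U), algebraMap (X.presheaf.stalk ξ) X.functionField
      (X.presheaf.germ U ξ hξU a) = X.germToFunctionField U a :=
    fun a => Scheme.algebraMap_germ_eq_germToFunctionField X hξU a
  have hp : (P.comap (algebraMap Γ(X, U) (X.presheaf.stalk ξ))).IsPrime := hP.comap _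
  obtain ⟨y, hy⟩ := exists_point_of_prime hU _ hp
  have hyξ : y.1 ⤳ ξ := by
    refine specializes_of_primeIdealOf_le hU (z := ⟨ξ, hξU⟩) ?_
    rw [hy]
    intro a ha
    rw [mem_primeIdealOf_iff]
    intro hu
    exact hP.ne_top (Ideal.eq_top_of_isUnit_mem _ ha hu)
  have hyht : coheight y.1 = 1 := by
    have h1 := coheight_eq_height hU y
    rw [hy] at h1
    have h2 := IsLocalization.height_under (hU.primeIdealOf ⟨ξ, hξU⟩).asIdeal.primeCompl P
    rw [Ideal.under_def] at h2
    rw [h2, hPht] at h1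
    exact_mod_cast h1
  obtain ⟨a, s, hs, h⟩ := (isRegularAt_iff_exists_div hU y f).mp
    ((isRegularAt_iff_ord_nonneg hyht hf0).mpr (hf y hyξ hyht))
  refine ⟨X.presheaf.germ U ξ hξU a, X.presheaf.germ U ξ hξU s, fun hsP => hs ?_, ?_⟩
  · rw [hy]
    exact hsP
  · rw [hg, hg, h]

end Stalks

/-! ### Points of codimension one outside an open subset -/

theorem genericPoint_specializes {X : Scheme.{0}} [IsIntegral X] (x : X) : genericPoint X ⤳ x :=
  (genericPoint_spec X).specializes (Set.mem_univ x)

theorem coheight_genericPoint {X : Scheme.{0}} [IsIntegral X] : coheight (genericPoint X) = 0 := by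
  rw [coheight_eq_zero]
  intro y _
  exact Scheme.le_iff_specializes.mpr (genericPoint_specializes y)

/-- A prime divisor is contained in no irreducible closed subset other than itself and the whole
scheme. -/
theorem eq_of_coheight_eq_one {X : Scheme.{0}} [IsIntegral X] {x y : X} (hx : coheight x = 1)
    (h : y ⤳ x) (hy : y ≠ genericPoint X) : y = x := by
  by_contra hne
  have hle : x ≤ y := Scheme.le_iff_specializes.mpr h
  have hlt : x < y := lt_of_le_not_ge hle fun h' =>
    hne (h.antisymm (Scheme.le_iff_specializes.mp h')).eq
  have h1 := coheight_add_one_le hlt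
  rw [hx] at h1
  have h2 : coheight y = 0 := by
    by_contra h0
    have h3 : (1 : ℕ∞) ≤ coheight y := Order.one_le_iff_pos.mpr (pos_iff_ne_zero.mpr h0)
    have h4 : (1 : ℕ∞) + 1 ≤ 1 := (add_le_add_left h3 1).trans h1
    exact absurd h4 (by decide)
  rw [coheight_eq_zero] at h2
  have h3 : genericPoint X ⤳ y := genericPoint_specializes y
  exact hy ((Scheme.le_iff_specializes.mp (h2 (Scheme.le_iff_specializes.mpr h3))).antisymm h3).eq

theorem genericPoint_mem {X : Scheme.{0}} [IsIntegral X] (U : X.Opens) [h : Nonempty U] :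
    genericPoint X ∈ U :=
  ((genericPoint_spec X).mem_open_set_iff U.isOpen).mpr (by simpa using h)

/-- Only finitely many prime divisors lie in the complement of a nonempty open subset: their generic
points are generic points of irreducible components of the complement. -/
theorem finite_coheight_one_compl {X : Scheme.{0}} [IsIntegral X]
    [TopologicalSpace.NoetherianSpace X] (U : X.Opens) [Nonempty U] :
    {x : X | coheight x = 1 ∧ x ∉ U}.Finite := by
  obtain ⟨S, hS, hcl, hirr, hU⟩ :=
    TopologicalSpace.NoetherianSpace.exists_finite_set_isClosed_irreducible U.isOpen.isClosed_compl
  have key : ∀ x : X, coheight x = 1 → x ∉ U → ∃ C ∈ S, IsGenericPoint x C := by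
    intro x hx hxU
    obtain ⟨C, hC, hxC⟩ : x ∈ ⋃₀ S := hU ▸ hxU
    obtain ⟨y, hy⟩ := QuasiSober.sober (hirr C hC) (hcl C hC)
    refine ⟨C, hC, ?_⟩
    have hyU : y ∉ U := by
      have : y ∈ (U : Set X)ᶜ := hU ▸ ⟨C, hC, hy.mem⟩
      exact this
    rwa [← eq_of_coheight_eq_one hx (hy.specializes hxC)
      fun h => hyU (h ▸ genericPoint_mem U)]
  refine (hS.image fun C => Classical.epsilon fun x : X => IsGenericPoint x C).subset ?_
  rintro x ⟨hx, hxU⟩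
  obtain ⟨C, hC, h⟩ := key x hx hxU
  exact ⟨C, hC, (Classical.epsilon_spec (p := fun x : X => IsGenericPoint x C) ⟨x, h⟩).eq h⟩

/-! ### Pull-back of rational functions -/

section Pullback

variable {X Y : Scheme.{0}} [IsIntegral X] [IsIntegral Y]

theorem pullback_algebraMap (π : Y ⟶ X) [IsDominant π] (y : Y) (a : X.presheaf.stalk (π y)) :
    pullback π (algebraMap _ X.functionField a) =
      algebraMap _ Y.functionField (π.stalkMap y a) := by
  have h : genericPoint Y ⤳ y := genericPoint_specializes _
  have h1 := Scheme.Hom.stalkSpecializes_stalkMap π _ _ h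
  have h2 : X.presheaf.stalkSpecializes (genericPoint_specializes _ :
      genericPoint X ⤳ π y) ≫ X.presheaf.stalkSpecializes
        (specializes_of_eq (map_genericPoint π)) =
      X.presheaf.stalkSpecializes (h.map π.continuous) := by
    rw [TopCat.Presheaf.stalkSpecializes_comp]
  change (X.presheaf.stalkSpecializes _ ≫ X.presheaf.stalkSpecializes _ ≫ π.stalkMap _) a =
    (π.stalkMap y ≫ Y.presheaf.stalkSpecializes h) a
  rw [← h1, ← h2, Category.assoc]

theorem ord_pullback [IsLocallyNoetherian X] [IsLocallyNoetherian Y] [IsNormalScheme X]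
    [IsNormalScheme Y] (π : Y ⟶ X) [IsDominant π] [IsIso π] (f : X.functionField) (y : Y) :
    Scheme.ord (pullback π f) y = Scheme.ord f (π y) := by
  have hco : coheight (π y) = coheight y := coheight_eq_of_isOpenImmersion π
  by_cases hy : coheight y = 1
  swap
  · have hy' : coheight (π y) ≠ 1 := hco ▸ hy
    simp [hy, hy']
  have hy' : coheight (π y) = 1 := hco.trans hy
  have := stalk_isDiscreteValuationRing hy
  have := stalk_isDiscreteValuationRing hy'
  have key : ∀ a : X.presheaf.stalk (π y), a ≠ 0 →
      Scheme.ord (pullback π (algebraMap _ X.functionField a)) y =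
        Scheme.ord (algebraMap _ X.functionField a) (π y) := by
    intro a ha
    obtain ⟨ϖ, hϖ⟩ := IsDiscreteValuationRing.exists_irreducible (X.presheaf.stalk (π y))
    obtain ⟨k, u, rfl⟩ := IsDiscreteValuationRing.eq_unit_mul_pow_irreducible ha hϖ
    have hϖ' : Irreducible (π.stalkMap y ϖ) :=
      (MulEquiv.irreducible_iff ((asIso (π.stalkMap y)).commRingCatIsoToRingEquiv)).mpr hϖ
    have hu : IsUnit (π.stalkMap y (u : X.presheaf.stalk (π y))) := u.isUnit.map _
    have e1 := (map_ne_zero_iff _ (stalk_injective (π y))).mpr u.isUnit.ne_zero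
    have e2 := (map_ne_zero_iff _ (stalk_injective (π y))).mpr hϖ.ne_zero
    have e3 := (map_ne_zero_iff _ (stalk_injective y)).mpr hu.ne_zero
    have e4 := (map_ne_zero_iff _ (stalk_injective y)).mpr hϖ'.ne_zero
    rw [pullback_algebraMap, map_mul, map_pow, map_mul, map_pow, map_mul, map_pow,
      Scheme.ord_mul e1 (pow_ne_zero k e2), Scheme.ord_mul e3 (pow_ne_zero k e4),
      ord_of_isUnit_stalk hu, ord_of_isUnit_stalk u.isUnit, ord_pow _ e2, ord_pow _ e4,
      ord_irreducible hy hϖ', ord_irreducible hy' hϖ]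
  by_cases hf : f = 0
  · simp [hf]
  obtain ⟨a, b, hb, rfl⟩ := IsFractionRing.div_surjective (A := X.presheaf.stalk (π y)) f
  have hb0 := nonZeroDivisors.ne_zero hb
  have ha0 : a ≠ 0 := by
    rintro rfl
    simp at hf
  have e1 := (map_ne_zero_iff _ (stalk_injective (π y))).mpr ha0
  have e2 := (map_ne_zero_iff _ (stalk_injective (π y))).mpr hb0
  have e1' := (map_ne_zero_iff _ (pullback π).injective).mpr e1
  have e2' := (map_ne_zero_iff _ (pullback π).injective).mpr e2
  rw [map_div₀, div_eq_mul_inv, div_eq_mul_inv, Scheme.ord_mul e1 (inv_ne_zero e2),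
    Scheme.ord_mul e1' (inv_ne_zero e2'), ord_inv _ e2, ord_inv _ e2', key a ha0, key b hb0]

end Pullback

/-! ### Divisorial valuations and their centers -/

section Valuations

variable {X : Scheme.{0}} [IsIntegral X] {v : X.functionField → ℝ}

namespace IsDivisorial

theorem map_mul (hv : IsDivisorial v) {f g : X.functionField} (hf : f ≠ 0) (hg : g ≠ 0) :
    v (f * g) = v f + v g := by
  obtain ⟨Y, _, _, _, π, _, E, c, -, -, -, -, h⟩ := hv
  rw [h, h, h, _root_.map_mul, Scheme.ord_mul ((map_ne_zero _).mpr hf) ((map_ne_zero _).mpr hg)]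
  push_cast
  ring

theorem map_add (hv : IsDivisorial v) {f g : X.functionField} (h : f + g ≠ 0) :
    min (v f) (v g) ≤ v (f + g) := by
  obtain ⟨Y, _, _, _, π, _, E, c, -, -, hE, hc, hv⟩ := hv
  have := stalk_isDiscreteValuationRing hE
  have h1 := Scheme.ord_add (x := E) (f := pullback π f) (g := pullback π g)
    (by rw [← _root_.map_add]; exact (map_ne_zero _).mpr h)
  rw [hv, hv, hv, _root_.map_add, ← mul_min_of_nonneg _ _ hc.le]
  refine mul_le_mul_of_nonneg_left ?_ hc.le
  exact_mod_cast h1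

theorem map_one (hv : IsDivisorial v) : v 1 = 0 := by
  have := hv.map_mul (one_ne_zero (α := X.functionField)) one_ne_zero
  rw [mul_one] at this
  linarith

theorem map_inv (hv : IsDivisorial v) {f : X.functionField} (hf : f ≠ 0) : v f⁻¹ = - v f := by
  have := hv.map_mul hf (inv_ne_zero hf)
  rw [mul_inv_cancel₀ hf, hv.map_one] at this
  linarith

theorem map_pow (hv : IsDivisorial v) {f : X.functionField} (hf : f ≠ 0) (k : ℕ) :
    v (f ^ k) = k * v f := by
  induction k with
  | zero => simp [hv.map_one]
  | succ k ih =>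
    rw [pow_succ, hv.map_mul (pow_ne_zero k hf) hf, ih]
    push_cast
    ring

theorem map_zpow (hv : IsDivisorial v) {f : X.functionField} (hf : f ≠ 0) (k : ℤ) :
    v (f ^ k) = k * v f := by
  obtain ⟨m, rfl | rfl⟩ := k.eq_nat_or_neg
  · rw [zpow_natCast, hv.map_pow hf]
    simp
  · rw [zpow_neg, zpow_natCast, hv.map_inv (pow_ne_zero m hf), hv.map_pow hf]
    push_cast
    ring

/-- A divisorial valuation has a center: the image of the prime divisor which defines it. It is
unique since the scheme is separated: a second center gives another morphism from the spectrum of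
the local ring at the prime divisor to `X`, which agrees with the first one at the generic point. -/
theorem exists_center [X.IsSeparated] (hv : IsDivisorial v) :
    ∃ ξ, IsCenter v ξ ∧ ∀ ξ', IsCenter v ξ' → ξ' = ξ := by
  obtain ⟨Y, _, _, _, π, _, E, c, -, -, hE, hc, hv⟩ := hv
  have := stalk_isDiscreteValuationRing hE
  refine ⟨π E, ?_, ?_⟩
  · intro a ha
    have ha' : π.stalkMap E a ≠ 0 := by
      intro h0
      have h1 := pullback_algebraMap π E a
      rw [h0, map_zero] at h1
      exact ha (stalk_injective _ (((map_eq_zero _).mp h1).trans (map_zero _).symm))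
    rw [hv, pullback_algebraMap]
    constructor
    · have := (isRegularAt_iff_ord_nonneg hE
        ((map_ne_zero_iff _ (stalk_injective E)).mpr ha')).mp ⟨_, rfl⟩
      have : (0 : ℝ) ≤ Scheme.ord (algebraMap _ Y.functionField (π.stalkMap E a)) E := by
        exact_mod_cast this
      positivity
    · rw [mul_pos_iff_of_pos_left hc, Int.cast_pos, ord_pos_iff hE ha',
        IsLocalRing.mem_maximalIdeal, IsLocalRing.mem_maximalIdeal, mem_nonunits_iff,
        mem_nonunits_iff, isUnit_map_iff (π.stalkMap E).hom]
  · intro ξ hξ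
    have hord : ∀ a : X.presheaf.stalk ξ, a ≠ 0 →
        0 ≤ Scheme.ord (pullback π (algebraMap _ X.functionField a)) E ∧
        (0 < Scheme.ord (pullback π (algebraMap _ X.functionField a)) E ↔
          a ∈ IsLocalRing.maximalIdeal (X.presheaf.stalk ξ)) := by
      intro a ha
      have h1 := hξ a ha
      rw [hv, mul_nonneg_iff_of_pos_left hc, mul_pos_iff_of_pos_left hc] at h1
      exact_mod_cast h1
    have hreg : ∀ a : X.presheaf.stalk ξ,
        IsRegularAt (pullback π (algebraMap _ X.functionField a)) E := by
      intro a
      by_cases ha : a = 0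
      · exact ⟨0, by simp [ha]⟩
      · rw [isRegularAt_iff_ord_nonneg hE ((map_ne_zero _).mpr
          ((map_ne_zero_iff _ (stalk_injective ξ)).mpr ha))]
        exact (hord a ha).1
    choose φ hφ using hreg
    let Φ : X.presheaf.stalk ξ →+* Y.presheaf.stalk E :=
      { toFun := φ
        map_one' := stalk_injective E (by rw [hφ]; simp)
        map_zero' := stalk_injective E (by rw [hφ]; simp)
        map_mul' := fun a b => stalk_injective E (by rw [_root_.map_mul, hφ, hφ, hφ]; simp)
        map_add' := fun a b => stalk_injective E (by rw [_root_.map_add, hφ, hφ, hφ]; simp) }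
    have hΦ : ∀ a, algebraMap _ Y.functionField (Φ a) =
        pullback π (algebraMap _ X.functionField a) := hφ
    have hloc : IsLocalHom Φ := by
      refine ⟨fun a ha => ?_⟩
      by_contra hna
      have ha0 : a ≠ 0 := by
        rintro rfl
        rw [map_zero] at ha
        exact not_isUnit_zero ha
      have h1 := (hord a ha0).2.mpr hna
      rw [← hΦ, ord_of_isUnit_stalk ha] at h1
      exact lt_irrefl _ h1
    let Ψ : X.presheaf.stalk ξ ⟶ Y.presheaf.stalk E := CommRingCat.ofHom Φ
    let P : X.functionField ⟶ Y.functionField := CommRingCat.ofHom (pullback π)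
    -- `Φ` is a local homomorphism of local rings, compatible with the pull-back along `π`
    let ι : Spec Y.functionField ⟶ Spec (Y.presheaf.stalk E) :=
      Spec.map (Y.presheaf.stalkSpecializes (genericPoint_specializes _))
    have hι : IsDominant ι := by
      refine ⟨(PrimeSpectrum.denseRange_comap_iff_ker_le_nilRadical _).mpr ?_⟩
      have : RingHom.ker (algebraMap (Y.presheaf.stalk E) Y.functionField) = ⊥ :=
        (RingHom.injective_iff_ker_eq_bot _).mp (stalk_injective E)
      exact this.le.trans bot_le
    have heq : Spec.map Ψ ≫ X.fromSpecStalk ξ =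
        Y.fromSpecStalk E ≫ π := by
      have h2 : X.presheaf.stalkSpecializes (genericPoint_specializes (π (genericPoint Y))) ≫ P =
          π.stalkMap (genericPoint Y) := by
        change X.presheaf.stalkSpecializes _ ≫ X.presheaf.stalkSpecializes _ ≫ _ = _
        rw [← Category.assoc, TopCat.Presheaf.stalkSpecializes_comp]
        simp
      have h3 : Ψ ≫ Y.presheaf.stalkSpecializes (genericPoint_specializes E) =
          X.presheaf.stalkSpecializes (genericPoint_specializes ξ) ≫ P := by
        ext a
        exact hΦ a
      clear_value P Ψ
      have h4 : ι ≫ Spec.map Ψ ≫ X.fromSpecStalk ξ =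
          Spec.map P ≫ X.fromSpecStalk (genericPoint X) := by
        rw [← Category.assoc, ← Spec.map_comp, h3, Spec.map_comp, Category.assoc,
          Scheme.SpecMap_stalkSpecializes_fromSpecStalk]
      have h5 : ι ≫ Y.fromSpecStalk E ≫ π =
          Spec.map P ≫ X.fromSpecStalk (genericPoint X) := by
        rw [← Category.assoc, Scheme.SpecMap_stalkSpecializes_fromSpecStalk,
          ← Scheme.SpecMap_stalkMap_fromSpecStalk, ← h2, Spec.map_comp, Category.assoc,
          Scheme.SpecMap_stalkSpecializes_fromSpecStalk]
      exact ext_of_isDominant ι (h4.trans h5.symm)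
    have h5 : (Spec.map Ψ) (IsLocalRing.closedPoint (Y.presheaf.stalk E)) =
        IsLocalRing.closedPoint (X.presheaf.stalk ξ) := IsLocalRing.comap_closedPoint Φ
    calc ξ = X.fromSpecStalk ξ (IsLocalRing.closedPoint (X.presheaf.stalk ξ)) :=
          Scheme.fromSpecStalk_closedPoint.symm
      _ = (Spec.map Ψ ≫ X.fromSpecStalk ξ)
          (IsLocalRing.closedPoint (Y.presheaf.stalk E)) := by
        rw [← h5]
        rfl
      _ = (Y.fromSpecStalk E ≫ π) (IsLocalRing.closedPoint (Y.presheaf.stalk E)) := by rw [heq]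
      _ = π E := congrArg π Scheme.fromSpecStalk_closedPoint

end IsDivisorial

/-! ### Values of divisors -/

variable [IsLocallyNoetherian X]

/-- The value of `v` at the `ℚ`-divisor `D` is defined, and equal to `t`; `valDiv v D` is the
supremum of all such `t`. Unlike an equation for `valDiv`, this relation carries the existence of a
local equation along. -/
def HasVal (v : X.functionField → ℝ) (D : QDivisor X) (t : ℝ) : Prop :=
  ∃ (ξ : X) (r : ℕ) (g : X.functionField),
    IsCenter v ξ ∧ 0 < r ∧ IsLocalEquation (r • D) ξ g ∧ t = v g / r

/-- The values of `v` at two rational functions with the same divisor near the center of `v` agree,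
because their quotient is a unit of the local ring at the center. -/
theorem IsCenter.eq_of_ord_eq [IsNormalScheme X] (hv : IsDivisorial v) {ξ : X} (hξ : IsCenter v ξ)
    {f g : X.functionField} (hf : f ≠ 0) (hg : g ≠ 0)
    (h : ∀ y : X, y ⤳ ξ → Scheme.ord f y = Scheme.ord g y) : v f = v g := by
  have key : ∀ f g : X.functionField, f ≠ 0 → g ≠ 0 →
      (∀ y : X, y ⤳ ξ → Scheme.ord f y = Scheme.ord g y) → v g ≤ v f := by
    intro f g hf hg h
    obtain ⟨a, ha⟩ := isRegularAt_of_ord_nonneg (f := f * g⁻¹) ξ fun y hy _ => by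
      rw [Scheme.ord_mul hf (inv_ne_zero hg), ord_inv y hg, h y hy, add_neg_cancel]
    have ha0 : a ≠ 0 := by
      rintro rfl
      rw [map_zero] at ha
      exact mul_ne_zero hf (inv_ne_zero hg) ha.symm
    have := (hξ a ha0).1
    rw [ha, hv.map_mul hf (inv_ne_zero hg), hv.map_inv hg] at this
    linarith
  exact le_antisymm (key g f hg hf fun y hy => (h y hy).symm) (key f g hf hg h)

namespace HasVal

variable {D E : QDivisor X} {s t : ℝ}

theorem smul (hv : IsDivisorial v) (h : HasVal v D t) (q : ℚ) : HasVal v (q • D) (q * t) := by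
  obtain ⟨ξ, r, g, hξ, hr, ⟨hg, U, hξU, hU⟩, rfl⟩ := h
  refine ⟨ξ, q.den * r, g ^ q.num, hξ, Nat.mul_pos q.den_pos hr,
    ⟨zpow_ne_zero _ hg, U, hξU, fun y hy => ?_⟩, ?_⟩
  · have e1 := hU y hy
    simp only [div, Pi.smul_apply, nsmul_eq_mul, smul_eq_mul] at e1 ⊢
    rw [ord_zpow y hg]
    push_cast
    rw [e1, ← q.mul_den_eq_num]
    ring
  · rw [hv.map_zpow hg]
    have h1 : (q : ℝ) = q.num / q.den := by exact_mod_cast (q.num_div_den).symm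
    have : (0 : ℝ) < q.den := by exact_mod_cast q.den_pos
    rw [h1]
    push_cast
    field_simp

theorem nsmul (hv : IsDivisorial v) (h : HasVal v D t) (k : ℕ) : HasVal v (k • D) (k * t) := by
  have h1 := h.smul hv (k : ℚ)
  rw [Rat.cast_natCast] at h1
  convert h1 using 1
  funext y
  simp

variable [X.IsSeparated]

theorem unique [IsNormalScheme X] (hv : IsDivisorial v) (h : HasVal v D t) (h' : HasVal v D s) :
    t = s := by
  obtain ⟨ξ, r, g, hξ, hr, ⟨hg, U, hξU, hU⟩, rfl⟩ := h
  obtain ⟨ξ', r', g', hξ', hr', ⟨hg', U', hξU', hU'⟩, rfl⟩ := h'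
  obtain ⟨ζ, -, hζ⟩ := hv.exists_center
  obtain rfl : ξ = ξ' := (hζ ξ hξ).trans (hζ ξ' hξ').symm
  have h1 := hξ.eq_of_ord_eq hv (pow_ne_zero r' hg) (pow_ne_zero r hg') fun y hy => by
    have e1 := hU y (hy.mem_open U.isOpen hξU)
    have e2 := hU' y (hy.mem_open U'.isOpen hξU')
    simp only [div, Pi.smul_apply, nsmul_eq_mul] at e1 e2
    rw [ord_pow y hg, ord_pow y hg']
    have : ((r' * Scheme.ord g y : ℤ) : ℚ) = (r * Scheme.ord g' y : ℤ) := by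
      push_cast
      rw [e1, e2]
      ring
    exact_mod_cast this
  rw [hv.map_pow hg, hv.map_pow hg'] at h1
  have : (0 : ℝ) < r := by exact_mod_cast hr
  have : (0 : ℝ) < r' := by exact_mod_cast hr'
  field_simp
  linarith

theorem valDiv_eq [IsNormalScheme X] (hv : IsDivisorial v) (h : HasVal v D t) :
    valDiv v D = t := by
  have : {t : ℝ | HasVal v D t} = {t} :=
    Set.eq_singleton_iff_unique_mem.mpr ⟨h, fun s hs => unique hv hs h⟩
  change sSup {t : ℝ | HasVal v D t} = t
  rw [this, csSup_singleton]

theorem of_div (hv : IsDivisorial v) {f : X.functionField} (hf : f ≠ 0) :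
    HasVal v (div f) (v f) := by
  obtain ⟨ξ, hξ, -⟩ := hv.exists_center
  exact ⟨ξ, 1, f, hξ, one_pos, ⟨hf, ⊤, trivial, fun y _ => by simp⟩, by simp⟩

theorem add (hv : IsDivisorial v) (h : HasVal v D t) (h' : HasVal v E s) :
    HasVal v (D + E) (t + s) := by
  obtain ⟨ξ, r, g, hξ, hr, ⟨hg, U, hξU, hU⟩, rfl⟩ := h
  obtain ⟨ξ', r', g', hξ', hr', ⟨hg', U', hξU', hU'⟩, rfl⟩ := h'
  obtain ⟨ζ, -, hζ⟩ := hv.exists_center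
  obtain rfl : ξ = ξ' := (hζ ξ hξ).trans (hζ ξ' hξ').symm
  refine ⟨ξ, r * r', g ^ r' * g' ^ r, hξ, Nat.mul_pos hr hr',
    ⟨mul_ne_zero (pow_ne_zero _ hg) (pow_ne_zero _ hg'), U ⊓ U', ⟨hξU, hξU'⟩, fun y hy => ?_⟩, ?_⟩
  · have e1 := hU y hy.1
    have e2 := hU' y hy.2
    simp only [div, Pi.smul_apply, Pi.add_apply, nsmul_eq_mul] at e1 e2 ⊢
    rw [Scheme.ord_mul (pow_ne_zero _ hg) (pow_ne_zero _ hg'), ord_pow y hg, ord_pow y hg']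
    push_cast
    rw [e1, e2]
    ring
  · rw [hv.map_mul (pow_ne_zero _ hg) (pow_ne_zero _ hg'), hv.map_pow hg, hv.map_pow hg']
    have : (0 : ℝ) < r := by exact_mod_cast hr
    have : (0 : ℝ) < r' := by exact_mod_cast hr'
    push_cast
    field_simp

theorem zero (hv : IsDivisorial v) : HasVal v (0 : QDivisor X) 0 := by
  have := of_div hv (one_ne_zero (α := X.functionField))
  rw [hv.map_one] at this
  convert this using 1
  funext y
  simp [div, ord_one]

theorem sum (hv : IsDivisorial v) {ι : Type*} (S : Finset ι) {D : ι → QDivisor X} {t : ι → ℝ}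
    (h : ∀ i ∈ S, HasVal v (D i) (t i)) : HasVal v (∑ i ∈ S, D i) (∑ i ∈ S, t i) := by
  classical
  induction S using Finset.induction_on with
  | empty => simpa using zero hv
  | insert i S hi ih =>
    rw [Finset.sum_insert hi, Finset.sum_insert hi]
    exact (h i (Finset.mem_insert_self i S)).add hv
      (ih fun j hj => h j (Finset.mem_insert_of_mem hj))

end HasVal

theorem exists_hasVal (hv : IsDivisorial v) [X.IsSeparated] {D : QDivisor X} (hD : IsQCartier D) :
    ∃ t, HasVal v D t := by
  obtain ⟨r, hr, h⟩ := hD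
  obtain ⟨ξ, hξ, -⟩ := hv.exists_center
  obtain ⟨g, hg⟩ := h ξ
  exact ⟨_, ξ, r, g, hξ, hr, hg, rfl⟩

end Valuations

/-! ### Rational functions with divisible orders -/

/-- An element of a unique factorization domain, all of whose prime exponents are divisible by `r`,
is an `r`-th power up to a unit. -/
theorem exists_unit_mul_pow_of_dvd {R : Type*} [CommRing R] [IsDomain R]
    [UniqueFactorizationMonoid R] {r : ℕ} (a : R) (ha : a ≠ 0)
    (h : ∀ p : R, Prime p → ∀ (k : ℕ) (c : R), a = p ^ k * c → ¬ p ∣ c → r ∣ k) :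
    ∃ ε g : R, IsUnit ε ∧ g ≠ 0 ∧ a = ε * g ^ r := by
  induction a using UniqueFactorizationMonoid.induction_on_coprime with
  | h0 => exact absurd rfl ha
  | h1 hu => exact ⟨_, 1, hu, one_ne_zero, by simp⟩
  | hpr i hp =>
    rename_i p
    obtain ⟨k, rfl⟩ := h p hp i 1 (by simp) hp.not_dvd_one
    exact ⟨1, p ^ k, isUnit_one, pow_ne_zero k hp.ne_zero, by rw [one_mul, ← pow_mul, mul_comm k]⟩
  | hcp hxy hx hy =>
    rename_i x y
    have key : ∀ x y : R, IsRelPrime x y →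
        (∀ p : R, Prime p → ∀ (k : ℕ) (c : R), x * y = p ^ k * c → ¬ p ∣ c → r ∣ k) →
        ∀ p : R, Prime p → ∀ (k : ℕ) (c : R), x = p ^ k * c → ¬ p ∣ c → r ∣ k := by
      intro x y hxy h p hp k c hx hc
      rcases Nat.eq_zero_or_pos k with rfl | hk
      · exact dvd_zero r
      · refine h p hp k (c * y) (by rw [hx, mul_assoc]) fun hd => ?_
        rcases hp.dvd_or_dvd hd with h1 | h1
        · exact hc h1
        · exact hp.not_isUnit (hxy (hx ▸ (dvd_pow_self p hk.ne').mul_right c) h1)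
    obtain ⟨ε, g, hε, hg, h1⟩ := hx (left_ne_zero_of_mul ha) (key x y hxy h)
    obtain ⟨ε', g', hε', hg', h2⟩ := hy (right_ne_zero_of_mul ha)
      (key y x hxy.symm (by rwa [mul_comm y x]))
    exact ⟨ε * ε', g * g', hε.mul hε', mul_ne_zero hg hg', by rw [h1, h2]; ring⟩

section Factorial

variable {X : Scheme.{0}} [IsIntegral X] [IsLocallyNoetherian X] [IsNormalScheme X]

/-- A prime element of the coordinate ring of an affine open subset defines a prime divisor, along
which it vanishes to order one. -/
theorem exists_ord_of_prime {U : X.Opens} (hU : IsAffineOpen U) [Nonempty U] {p : Γ(X, U)}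
    (hp : Prime p) : ∃ y ∈ U, coheight y = 1 ∧ Scheme.ord (X.germToFunctionField U p) y = 1 ∧
      ∀ c : Γ(X, U), ¬ p ∣ c → Scheme.ord (X.germToFunctionField U c) y = 0 := by
  have : IsNoetherianRing Γ(X, U) := IsLocallyNoetherian.component_noetherian ⟨U, hU⟩
  have hpp : (Ideal.span {p}).IsPrime := (Ideal.span_singleton_prime hp.ne_zero).mpr hp
  obtain ⟨y, hy⟩ := exists_point_of_prime hU _ hpp
  have hyht : coheight y.1 = 1 := by
    have h1 := coheight_eq_height hU y
    rw [hy, Ideal.height_span_singleton_eq_one_of_mem_nonZeroDivisors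
      (mem_nonZeroDivisors_of_ne_zero hp.ne_zero) hp.not_isUnit] at h1
    exact_mod_cast h1
  have := stalk_isDiscreteValuationRing hyht
  let := X.presheaf.algebra_section_stalk y
  have := hU.isLocalization_stalk y
  have hg : ∀ a : Γ(X, U), algebraMap (X.presheaf.stalk y.1) X.functionField
      (X.presheaf.germ U y y.2 a) = X.germToFunctionField U a :=
    fun a => Scheme.algebraMap_germ_eq_germToFunctionField X y.2 a
  refine ⟨y, y.2, hyht, ?_, fun c hc => ?_⟩
  · rw [← hg]
    refine ord_irreducible hyht ((IsDiscreteValuationRing.irreducible_iff_uniformizer _).mpr ?_)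
    rw [← IsLocalization.AtPrime.map_eq_maximalIdeal (hU.primeIdealOf y).asIdeal, hy,
      Ideal.map_span, Set.image_singleton]
    rfl
  · rw [← hg]
    apply ord_of_isUnit_stalk
    by_contra h
    have h1 := (mem_primeIdealOf_iff hU y c).mpr h
    rw [hy, Ideal.mem_span_singleton] at h1
    exact hc h1

/-- On an affine open subset with factorial coordinate ring, a rational function all of whose orders
are divisible by `r` is an `r`-th power up to a unit. -/
theorem exists_unit_mul_pow_of_dvd_ord {U : X.Opens} (hU : IsAffineOpen U) [Nonempty U]
    [UniqueFactorizationMonoid Γ(X, U)] {r : ℕ} (hr : 0 < r) {F : X.functionField} (hF : F ≠ 0)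
    (h : ∀ y ∈ U, coheight y = 1 → (r : ℤ) ∣ Scheme.ord F y) :
    ∃ (ε : Γ(X, U)) (g : X.functionField), IsUnit ε ∧ g ≠ 0 ∧
      F = X.germToFunctionField U ε * g ^ r := by
  have := functionField_isFractionRing_of_isAffineOpen X U hU
  have hinj := IsFractionRing.injective Γ(X, U) X.functionField
  obtain ⟨a, b, hb, hab⟩ := IsFractionRing.div_surjective (A := Γ(X, U)) F
  have hb0 := nonZeroDivisors.ne_zero hb
  have ha0 : a ≠ 0 := by
    rintro rfl
    rw [map_zero, zero_div] at hab
    exact hF hab.symm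
  -- `F = a / b` and `a b^(r - 1) = F b^r` have the same orders modulo `r`
  have e : X.germToFunctionField U (a * b ^ (r - 1)) = F * (X.germToFunctionField U b) ^ r := by
    have hb1 : X.germToFunctionField U b ≠ 0 := (map_ne_zero_iff _ hinj).mpr hb0
    have : F * X.germToFunctionField U b = X.germToFunctionField U a := by
      rw [← hab]
      exact div_mul_cancel₀ _ hb1
    rw [map_mul, map_pow, ← this, mul_assoc, mul_pow_sub_one hr.ne']
  have hb1 : X.germToFunctionField U b ≠ 0 := (map_ne_zero_iff _ hinj).mpr hb0
  have hA : a * b ^ (r - 1) ≠ 0 := mul_ne_zero ha0 (pow_ne_zero _ hb0)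
  obtain ⟨ε, g, hε, hg, hεg⟩ := exists_unit_mul_pow_of_dvd _ hA (by
    intro p hp k c hc hpc
    obtain ⟨y, hyU, hy, h1, h2⟩ := exists_ord_of_prime hU hp
    have hc0 : c ≠ 0 := by
      rintro rfl
      exact hpc (dvd_zero p)
    have e1 : X.germToFunctionField U p ≠ 0 := (map_ne_zero_iff _ hinj).mpr hp.ne_zero
    have e2 : X.germToFunctionField U c ≠ 0 := (map_ne_zero_iff _ hinj).mpr hc0
    have h3 : Scheme.ord (X.germToFunctionField U (a * b ^ (r - 1))) y = k := by
      rw [hc, map_mul, map_pow, Scheme.ord_mul (pow_ne_zero k e1) e2, ord_pow y e1, h1, h2 c hpc]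
      simp
    rw [e, Scheme.ord_mul hF (pow_ne_zero r hb1), ord_pow y hb1] at h3
    have h4 : (r : ℤ) ∣ k := by
      rw [← h3]
      exact dvd_add (h y hyU hy) (dvd_mul_right _ _)
    exact_mod_cast h4)
  refine ⟨ε, X.germToFunctionField U g / X.germToFunctionField U b, hε,
    div_ne_zero ((map_ne_zero_iff _ hinj).mpr hg) hb1, ?_⟩
  rw [hεg, map_mul, map_pow] at e
  rw [div_pow, ← mul_div_assoc, e, mul_div_cancel_right₀ _ (pow_ne_zero r hb1)]

end Factorial

/-! ### Complex points of the torus -/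

section TorusPoints

open MonObj

variable {n : ℕ}

/-- The complex point of the torus with comorphism `t`. -/
def pointOfAlgHom (t : torusRing n →ₐ[ℂ] ℂ) : ToricVariety.Point n :=
  Over.homMk (Spec.map (CommRingCat.ofHom t.toRingHom)) (by
    change Spec.map _ ≫ Spec.map _ = 𝟙 _
    rw [← Spec.map_comp, ← Spec.map_id]
    congr 1
    ext c
    exact t.commutes c)

theorem exists_algHom_eq (t : ToricVariety.Point n) : ∃ t', t = pointOfAlgHom t' := by
  have hw : t.left ≫ Spec.map (CommRingCat.ofHom (algebraMap ℂ (torusRing n))) = 𝟙 SpecC :=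
    Over.w t
  obtain ⟨φ, hφ⟩ : ∃ φ : CommRingCat.of (torusRing n) ⟶ CommRingCat.of ℂ,
    t.left = Spec.map φ := ⟨Spec.preimage t.left, (Spec.map_preimage _).symm⟩
  have hw' : CommRingCat.ofHom (algebraMap ℂ (torusRing n)) ≫ φ = 𝟙 _ := by
    apply Spec.map_injective
    rw [Spec.map_comp, Spec.map_id]
    rw [hφ] at hw
    exact hw
  refine ⟨⟨φ.hom, fun c => congr($hw' c)⟩, ?_⟩
  ext1
  exact hφ

theorem scale_single (t : torusRing n →ₐ[ℂ] ℂ) (u : Fin n → ℤ) :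
    scale t (AddMonoidAlgebra.single u 1) =
      AddMonoidAlgebra.single u (t (AddMonoidAlgebra.single u 1)) := by
  rw [scale, AddMonoidAlgebra.lift_single, one_smul]
  rfl

theorem convMul_apply_single (f g : torusRing n →ₐ[ℂ] torusRing n) (u : Fin n → ℤ) :
    (WithConv.toConv f * WithConv.toConv g).ofConv (AddMonoidAlgebra.single u 1) =
      f (AddMonoidAlgebra.single u 1) * g (AddMonoidAlgebra.single u 1) := by
  simp [AlgHom.convMul_def]

/-- Translation of the torus by the point `t` has the comorphism `scale t`. -/
theorem toUnit_comp_mul_id (t : torusRing n →ₐ[ℂ] ℂ) :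
    ((toUnit (torus n) ≫ pointOfAlgHom t) * 𝟙 (torus n) : torus n ⟶ torus n).left =
      Spec.map (CommRingCat.ofHom (scale t).toRingHom) := by
  have h1 : toUnit (torus n) ≫ pointOfAlgHom t =
      Spec.mapMulEquiv (WithConv.toConv ((Algebra.ofId ℂ (torusRing n)).comp t)) := by
    ext1
    change Spec.map _ ≫ Spec.map _ = Spec.map _
    rw [← Spec.map_comp]
    rfl
  have h2 : 𝟙 (torus n) = Spec.mapMulEquiv (WithConv.toConv (AlgHom.id ℂ (torusRing n))) := by
    ext1
    exact (Spec.map_id _).symm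
  rw [h1, h2, ← map_mul]
  change Spec.map _ = Spec.map _
  congr 2
  refine congrArg AlgHom.toRingHom (AddMonoidAlgebra.algHom_ext (fun u => ?_)
    (Subsingleton.elim _ _))
  rw [convMul_apply_single, scale_single, AlgHom.comp_apply, Algebra.ofId_apply,
    AlgHom.id_apply, ← Algebra.smul_def, AddMonoidAlgebra.smul_single, smul_eq_mul, _root_.mul_one]

end TorusPoints

namespace ToricVariety

variable {n : ℕ} (V : ToricVariety n)

open MonObj in
/-- The embedding of the torus into a toric variety is compatible with translations. -/
theorem orbit_comp_translation (t : torusRing n →ₐ[ℂ] ℂ) :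
    V.orbit.left ≫ V.translation (pointOfAlgHom t) =
      Spec.map (CommRingCat.ofHom (scale t).toRingHom) ≫ V.orbit.left := by
  have h : V.orbit ≫ act (V.X.asOver SpecC) (pointOfAlgHom t) =
      (toUnit (torus n) ≫ pointOfAlgHom t * 𝟙 (torus n)) ≫ V.orbit := by
    rw [Hom.mul_def, Category.assoc, V.equivariant, act, comp_lift_assoc]
    simp
  rw [← toUnit_comp_mul_id]
  exact congrArg CommaMorphism.left h

/-! ### The coordinate ring of the open orbit -/

/-- The embedding of the torus into a toric variety. -/
def orbitMap : Spec (CommRingCat.of (torusRing n)) ⟶ V.X := V.orbit.left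

instance : IsOpenImmersion V.orbitMap := V.isOpenImmersion

/-- The open orbit of a toric variety. -/
def openOrbit : V.X.Opens := V.orbitMap ''ᵁ ⊤

instance : Nonempty V.openOrbit :=
  ⟨⟨V.orbitMap (Classical.arbitrary (Spec (CommRingCat.of (torusRing n)))),
    ⟨_, trivial, rfl⟩⟩⟩

theorem mem_openOrbit {x : V.X} : x ∈ V.openOrbit ↔ ∃ p, V.orbitMap p = x := by
  constructor
  · rintro ⟨p, -, hp⟩
    exact ⟨p, hp⟩
  · rintro ⟨p, hp⟩
    exact ⟨p, trivial, hp⟩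

theorem isAffineOpen_openOrbit : IsAffineOpen V.openOrbit :=
  (isAffineOpen_top (Spec (CommRingCat.of (torusRing n)))).image_of_isOpenImmersion V.orbitMap

instance : IsDominant V.orbitMap := by
  refine ⟨?_⟩
  have h := V.openOrbit.isOpen.dense ⟨_, (Classical.arbitrary V.openOrbit).2⟩
  refine h.mono ?_
  rintro _ ⟨p, -, rfl⟩
  exact ⟨p, rfl⟩

/-- The coordinate ring of the open orbit is that of the torus. -/
def orbitRingEquiv : torusRing n ≃+* Γ(V.X, V.openOrbit) :=
  ((Scheme.ΓSpecIso (CommRingCat.of (torusRing n))).symm ≪≫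
    (V.orbitMap.appIso ⊤).symm).commRingCatIsoToRingEquiv

/-- The regular functions on the torus, as rational functions on the toric variety. -/
def ratFun : torusRing n →+* V.X.functionField :=
  (V.X.germToFunctionField V.openOrbit).hom.comp V.orbitRingEquiv.toRingHom

theorem chi_eq (u : Fin n → ℤ) : V.chi u = V.ratFun (AddMonoidAlgebra.single u 1) := rfl

theorem ratFun_injective : Function.Injective V.ratFun :=
  (V.X.germToFunctionField_injective V.openOrbit).comp V.orbitRingEquiv.injective

end ToricVariety

/-! ### Pull-back and sections -/

section Sections

variable {X Y Z : Scheme.{0}} [IsIntegral X] [IsIntegral Y] [IsIntegral Z]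

instance : Nonempty (⊤ : X.Opens) := ⟨⟨genericPoint X, trivial⟩⟩

theorem pullback_germToFunctionField (π : Y ⟶ X) [IsDominant π] {U : X.Opens} [Nonempty U]
    {W : Y.Opens} [Nonempty W] (e : W ≤ π ⁻¹ᵁ U) (a : Γ(X, U)) :
    pullback π (X.germToFunctionField U a) = Y.germToFunctionField W (π.appLE U W e a) := by
  have h1 : π (genericPoint Y) ∈ U := e (genericPoint_mem W)
  have key : X.germToFunctionField U ≫ X.presheaf.stalkSpecializes
      (specializes_of_eq (map_genericPoint π)) ≫ π.stalkMap (genericPoint Y) =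
      π.appLE U W e ≫ Y.germToFunctionField W := by
    rw [Scheme.germToFunctionField, TopCat.Presheaf.germ_stalkSpecializes_assoc,
      Scheme.Hom.germ_stalkMap _ _ _ h1, Scheme.Hom.appLE, Category.assoc,
      Scheme.germToFunctionField, TopCat.Presheaf.germ_res]
  exact congr($key a)

theorem pullback_comp (f : Z ⟶ Y) (g : Y ⟶ X) [IsDominant f] [IsDominant g] (a : X.functionField) :
    pullback (f ≫ g) a = pullback f (pullback g a) := by
  obtain ⟨U, hU, s, rfl⟩ := X.presheaf.exists_germ_eq a
  have : Nonempty U := ⟨⟨_, hU⟩⟩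
  have h1 : g (genericPoint Y) ∈ U := by rwa [map_genericPoint]
  have : Nonempty (g ⁻¹ᵁ U) := ⟨⟨_, h1⟩⟩
  have h2 : f (genericPoint Z) ∈ g ⁻¹ᵁ U := by rwa [map_genericPoint]
  have : Nonempty (f ⁻¹ᵁ g ⁻¹ᵁ U) := ⟨⟨_, h2⟩⟩
  change pullback (f ≫ g) (X.germToFunctionField U s) =
    pullback f (pullback g (X.germToFunctionField U s))
  rw [pullback_germToFunctionField g (W := g ⁻¹ᵁ U) le_rfl,
    pullback_germToFunctionField f (W := f ⁻¹ᵁ g ⁻¹ᵁ U) le_rfl,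
    pullback_germToFunctionField (f ≫ g) (W := f ⁻¹ᵁ g ⁻¹ᵁ U) le_rfl]
  have h := Scheme.Hom.appLE_comp_appLE f g U (g ⁻¹ᵁ U) (f ⁻¹ᵁ g ⁻¹ᵁ U) le_rfl le_rfl
  exact congrArg _ congr($h.symm s)

theorem appLE_specMap_inv {R S : CommRingCat.{0}} (φ : R ⟶ S) (a : R) :
    (Spec.map φ).appLE ⊤ ⊤ le_rfl ((Scheme.ΓSpecIso R).inv a) = (Scheme.ΓSpecIso S).inv (φ a) := by
  have h := Scheme.ΓSpecIso_inv_naturality φ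
  have h1 : (Spec.map φ).appTop = (Spec.map φ).appLE ⊤ ⊤ le_rfl := Scheme.Hom.app_eq_appLE _
  rw [h1] at h
  exact congr($h a).symm

end Sections

namespace ToricVariety

variable {n : ℕ} (V : ToricVariety n)

theorem appLE_orbitRingEquiv (f : torusRing n) (e : ⊤ ≤ V.orbitMap ⁻¹ᵁ V.openOrbit) :
    V.orbitMap.appLE V.openOrbit ⊤ e (V.orbitRingEquiv f) =
      (Scheme.ΓSpecIso (CommRingCat.of (torusRing n))).inv f := by
  have h := V.orbitMap.appIso_inv_appLE (U := ⊤) (V := ⊤) e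
  have h1 := congr($h ((Scheme.ΓSpecIso (CommRingCat.of (torusRing n))).inv f))
  exact h1.trans (by simp)

theorem top_le_preimage_openOrbit : ⊤ ≤ V.orbitMap ⁻¹ᵁ V.openOrbit :=
  fun p _ => V.mem_openOrbit.mpr ⟨p, rfl⟩

theorem pullback_orbit_ratFun (f : torusRing n) :
    pullback V.orbitMap (V.ratFun f) =
      (Spec (CommRingCat.of (torusRing n))).germToFunctionField ⊤
        ((Scheme.ΓSpecIso (CommRingCat.of (torusRing n))).inv f) := by
  have := pullback_germToFunctionField V.orbitMap V.top_le_preimage_openOrbit (V.orbitRingEquiv f)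
  rw [appLE_orbitRingEquiv] at this
  exact this

/-- The embedding of the coordinate ring of the torus into the function field is `ℂ`-linear. -/
theorem algebraMap_eq_ratFun (c : ℂ) :
    algebraMap ℂ V.X.functionField c = V.ratFun (algebraMap ℂ (torusRing n) c) := by
  apply (pullback V.orbitMap).injective
  rw [pullback_orbit_ratFun]
  have h1 := pullback_germToFunctionField V.orbitMap (U := ⊤) (W := ⊤) le_rfl
    ((V.X ↘ SpecC).appTop ((Scheme.ΓSpecIso (CommRingCat.of ℂ)).inv c))
  refine h1.trans (congrArg _ ?_)
  have hw : V.orbitMap ≫ (V.X ↘ SpecC) =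
    Spec.map (CommRingCat.ofHom (algebraMap ℂ (torusRing n))) := Over.w V.orbit
  have h2 := Scheme.ΓSpecIso_inv_naturality (CommRingCat.ofHom (algebraMap ℂ (torusRing n)))
  rw [← hw] at h2
  exact congr($h2 c).symm

/-- The action of the torus on rational functions multiplies the character `χ^u` by `t u`. -/
theorem pullback_translation_ratFun (t : torusRing n →ₐ[ℂ] ℂ) (f : torusRing n) :
    pullback (V.translation (pointOfAlgHom t)) (V.ratFun f) = V.ratFun (scale t f) := by
  apply (pullback V.orbitMap).injective
  rw [pullback_orbit_ratFun, ← pullback_comp]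
  have key : ∀ (h : Spec (CommRingCat.of (torusRing n)) ⟶ V.X) [IsDominant h],
      h = Spec.map (CommRingCat.ofHom (scale t).toRingHom) ≫ V.orbitMap →
      pullback h (V.ratFun f) = (Spec (CommRingCat.of (torusRing n))).germToFunctionField ⊤
        ((Scheme.ΓSpecIso (CommRingCat.of (torusRing n))).inv (scale t f)) := by
    rintro h _ rfl
    refine (pullback_germToFunctionField
      (Spec.map (CommRingCat.ofHom (scale t).toRingHom) ≫ V.orbitMap) (U := V.openOrbit) (W := ⊤)
      (fun p _ => V.top_le_preimage_openOrbit trivial) (V.orbitRingEquiv f)).trans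
        (congrArg _ ?_)
    rw [← Scheme.Hom.appLE_comp_appLE _ _ V.openOrbit ⊤ ⊤ V.top_le_preimage_openOrbit le_rfl]
    refine (congrArg ((Spec.map (CommRingCat.ofHom (scale t).toRingHom)).appLE ⊤ ⊤ le_rfl)
      (V.appLE_orbitRingEquiv f V.top_le_preimage_openOrbit)).trans ?_
    exact appLE_specMap_inv (CommRingCat.ofHom (scale t).toRingHom) f
  exact key _ (V.orbit_comp_translation t)

end ToricVariety

/-! ### Invariant prime divisors -/

namespace ToricVariety

variable {n : ℕ} (V : ToricVariety n)

instance : V.X.IsSeparated := by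
  rw [Scheme.isSeparated_iff, ← Limits.terminal.comp_from (V.X ↘ SpecC)]
  infer_instance

instance : CompactSpace V.X := (quasiCompact_iff_compactSpace (V.X ↘ SpecC)).mp inferInstance

instance : IsNoetherian V.X where

instance : TopologicalSpace.NoetherianSpace V.X := inferInstance

theorem scale_evalPoint_mul (z w : Fin n → ℂˣ) :
    (scale (evalPoint z)).comp (scale (evalPoint w)) = scale (evalPoint (z * w)) := by
  refine AddMonoidAlgebra.algHom_ext (fun u => ?_) (Subsingleton.elim _ _)
  apply AddMonoidAlgebra.coeff_injective
  ext x
  simp only [AlgHom.comp_apply, coeff_scale, evalPoint_single, Pi.mul_apply, mul_zpow,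
    Finset.prod_mul_distrib, Units.val_mul, mul_assoc]

theorem scale_evalPoint_one : scale (evalPoint (1 : Fin n → ℂˣ)) = AlgHom.id ℂ (torusRing n) := by
  refine AddMonoidAlgebra.algHom_ext (fun u => ?_) (Subsingleton.elim _ _)
  apply AddMonoidAlgebra.coeff_injective
  ext x
  simp [coeff_scale, evalPoint_single]

/-- Every complex point of the torus is given by its coordinates. -/
theorem exists_evalPoint_eq (t : torusRing n →ₐ[ℂ] ℂ) : ∃ z, t = evalPoint z := by
  have hu : ∀ u : Fin n → ℤ, IsUnit (t (AddMonoidAlgebra.single u 1)) := fun u =>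
    (isUnit_single u one_ne_zero).map t
  let φ : (Fin n → ℤ) →+ Additive ℂˣ :=
    { toFun := fun u => Additive.ofMul (hu u).unit
      map_zero' := by
        apply Additive.toMul.injective
        ext
        exact t.map_one
      map_add' := fun u w => by
        apply Additive.toMul.injective
        ext
        change t _ = t _ * t _
        rw [← map_mul, AddMonoidAlgebra.single_mul_single, mul_one] }
  refine ⟨fun i => (φ (Pi.single i 1)).toMul,
    AddMonoidAlgebra.algHom_ext (fun u => ?_) (Subsingleton.elim _ _)⟩
  rw [evalPoint_single]
  have h1 : φ u = ∑ i, u i • φ (Pi.single i 1) := by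
    conv_lhs => rw [← Finset.univ_sum_single u]
    rw [map_sum]
    refine Finset.sum_congr rfl fun i _ => ?_
    rw [← map_zsmul, ← Pi.single_smul, smul_eq_mul, mul_one]
  have h2 : t (AddMonoidAlgebra.single u 1) = ((φ u).toMul : ℂˣ) := rfl
  rw [h2, h1]
  rfl

theorem translation_evalPoint_mul (z w : Fin n → ℂˣ) :
    V.translation (pointOfAlgHom (evalPoint (z * w))) =
      V.translation (pointOfAlgHom (evalPoint z)) ≫
        V.translation (pointOfAlgHom (evalPoint w)) := by
  refine ext_of_isDominant V.orbitMap ?_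
  have h : ∀ t, V.orbitMap ≫ V.translation (pointOfAlgHom t) =
      Spec.map (CommRingCat.ofHom (scale t).toRingHom) ≫ V.orbitMap := V.orbit_comp_translation
  have hs : CommRingCat.ofHom (scale (evalPoint (z * w))).toRingHom =
      CommRingCat.ofHom (scale (evalPoint w)).toRingHom ≫
        CommRingCat.ofHom (scale (evalPoint z)).toRingHom := by
    rw [← scale_evalPoint_mul]
    rfl
  rw [h, ← Category.assoc, h, Category.assoc, h, ← Category.assoc, ← Spec.map_comp, hs]

theorem translation_evalPoint_one :
    V.translation (pointOfAlgHom (evalPoint 1)) = 𝟙 V.X := by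
  refine ext_of_isDominant V.orbitMap ?_
  refine (V.orbit_comp_translation _).trans ?_
  rw [scale_evalPoint_one]
  exact (congrArg (· ≫ V.orbitMap) (Spec.map_id _)).trans
    ((Category.id_comp _).trans (Category.comp_id _).symm)

theorem translation_mem_openOrbit (t : torusRing n →ₐ[ℂ] ℂ) {x : V.X} (hx : x ∈ V.openOrbit) :
    V.translation (pointOfAlgHom t) x ∈ V.openOrbit := by
  obtain ⟨p, rfl⟩ := V.mem_openOrbit.mp hx
  refine V.mem_openOrbit.mpr ⟨Spec.map (CommRingCat.ofHom (scale t).toRingHom) p, ?_⟩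
  exact congr($(V.orbit_comp_translation t) p).symm

/-- The torus acts on the set of points of codimension one in the complement of the open orbit. -/
def boundaryAction : (Fin n → ℂˣ) →* Equiv.Perm {x : V.X | coheight x = 1 ∧ x ∉ V.openOrbit} :=
  MonoidHom.toHomPerm
    { toFun := fun z x => ⟨V.translation (pointOfAlgHom (evalPoint z)) x.1,
        (coheight_eq_of_isOpenImmersion (V.translation (pointOfAlgHom (evalPoint z)))).trans x.2.1,
        fun h => x.2.2 (by
          have h1 := V.translation_mem_openOrbit (evalPoint z⁻¹) h
          rw [← Scheme.Hom.comp_apply, ← translation_evalPoint_mul, mul_inv_cancel,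
            translation_evalPoint_one] at h1
          exact h1)⟩
      map_one' := by
        funext x
        ext1
        change V.translation (pointOfAlgHom (evalPoint 1)) x.1 = x.1
        rw [translation_evalPoint_one]
        rfl
      map_mul' := fun z w => by
        funext x
        ext1
        change V.translation (pointOfAlgHom (evalPoint (z * w))) x.1 =
          V.translation (pointOfAlgHom (evalPoint z))
            (V.translation (pointOfAlgHom (evalPoint w)) x.1)
        rw [mul_comm, translation_evalPoint_mul]
        rfl }

theorem finite_boundary : {x : V.X | coheight x = 1 ∧ x ∉ V.openOrbit}.Finite :=
  finite_coheight_one_compl V.openOrbit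

/-- The torus fixes the prime divisors in the complement of the open orbit: it permutes them, and it
has no nontrivial finite quotients since it is divisible. -/
theorem isInvariantPrime_of_notMem {x : V.X} (hx : coheight x = 1) (hxU : x ∉ V.openOrbit) :
    V.IsInvariantPrime x := by
  refine ⟨hx, fun t => ?_⟩
  obtain ⟨t, rfl⟩ := exists_algHom_eq t
  obtain ⟨z, rfl⟩ := exists_evalPoint_eq t
  have := V.finite_boundary.to_subtype
  let N := Nat.card (Equiv.Perm {x : V.X | coheight x = 1 ∧ x ∉ V.openOrbit})
  have hN : N ≠ 0 := Nat.card_pos.ne'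
  have hroot : ∀ i, ∃ w : ℂˣ, w ^ N = z i := by
    intro i
    obtain ⟨w, hw⟩ := IsAlgClosed.exists_pow_nat_eq (z i : ℂ) (Nat.pos_of_ne_zero hN)
    have hw0 : w ≠ 0 := by
      rintro rfl
      rw [zero_pow hN] at hw
      exact (z i).ne_zero hw.symm
    exact ⟨Units.mk0 w hw0, by ext; simpa using hw⟩
  choose w hw using hroot
  have hz : V.boundaryAction z = 1 := by
    have : z = w ^ N := funext fun i => (hw i).symm
    rw [this, map_pow, pow_card_eq_one']
  exact congr(($hz ⟨x, hx, hxU⟩).1)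

/-- The only point of the open orbit which is fixed by the torus is the generic point. -/
theorem eq_genericPoint_of_invariant {x : V.X} (hxU : x ∈ V.openOrbit)
    (h : ∀ t : Point n, V.translation t x = x) : x = genericPoint V.X := by
  obtain ⟨p, rfl⟩ := V.mem_openOrbit.mp hxU
  have hinv : ∀ t : torusRing n →ₐ[ℂ] ℂ,
      Spec.map (CommRingCat.ofHom (scale t).toRingHom) p = p := by
    intro t
    apply V.orbitMap.isOpenEmbedding.injective
    have h1 := congr($(V.orbit_comp_translation t) p)
    exact h1.symm.trans (h (pointOfAlgHom t))
  have hp : p.asIdeal = ⊥ := by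
    refine eq_bot_of_invariant p.asIdeal p.isPrime.ne_top fun t f hf => ?_
    have h1 := congrArg PrimeSpectrum.asIdeal (hinv t)
    have h2 : f ∈ (Spec.map (CommRingCat.ofHom (scale t).toRingHom) p).asIdeal := h1 ▸ hf
    exact h2
  have h1 : p = genericPoint (Spec (CommRingCat.of (torusRing n))) := by
    rw [genericPoint_eq_bot_of_affine]
    exact PrimeSpectrum.ext hp
  rw [h1, genericPoint_eq_of_isOpenImmersion]

theorem isInvariantPrime_iff {x : V.X} :
    V.IsInvariantPrime x ↔ coheight x = 1 ∧ x ∉ V.openOrbit := by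
  refine ⟨fun h => ⟨h.1, fun hx => ?_⟩, fun h => V.isInvariantPrime_of_notMem h.1 h.2⟩
  have h1 := h.1
  rw [V.eq_genericPoint_of_invariant hx h.2, coheight_genericPoint] at h1
  exact zero_ne_one h1

theorem ord_chi_of_mem (u : Fin n → ℤ) {x : V.X} (hx : x ∈ V.openOrbit) :
    Scheme.ord (V.chi u) x = 0 :=
  Scheme.ord_of_isUnit ((isUnit_single u one_ne_zero).map V.orbitRingEquiv) hx

end ToricVariety

/-! ### Sections of invariant divisors -/

theorem eq_sum_single {n : ℕ} (f : torusRing n) :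
    f = ∑ u ∈ f.coeff.support, f.coeff u • AddMonoidAlgebra.single u (1 : ℂ) := by
  refine AddMonoidAlgebra.coeff_injective (Finsupp.ext fun x => ?_)
  rw [AddMonoidAlgebra.coeff_sum, Finsupp.finsetSum_apply]
  simp only [AddMonoidAlgebra.coeff_smul_apply, AddMonoidAlgebra.coeff_single, Finsupp.single_apply,
    smul_eq_mul, mul_ite, mul_one, mul_zero, Finset.sum_ite_eq', Finsupp.mem_support_iff]
  split_ifs with h
  · rfl
  · exact not_not.mp h

namespace ToricVariety

variable {n : ℕ} (V : ToricVariety n)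

theorem ratFun_smul (c : ℂ) (f : torusRing n) : V.ratFun (c • f) = c • V.ratFun f := by
  rw [Algebra.smul_def, Algebra.smul_def, map_mul, algebraMap_eq_ratFun]

theorem chi_ne_zero (u : Fin n → ℤ) : V.chi u ≠ 0 := by
  rw [chi_eq, Ne, map_eq_zero_iff _ V.ratFun_injective]
  exact (isUnit_single u one_ne_zero).ne_zero

theorem chi_add (u w : Fin n → ℤ) : V.chi (u + w) = V.chi u * V.chi w := by
  rw [chi_eq, chi_eq, chi_eq, ← map_mul, AddMonoidAlgebra.single_mul_single, mul_one]

/-- The characters which are sections of an invariant divisor. -/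
def sectionExponents (D : QDivisor V.X) : Set (Fin n → ℤ) :=
  {u | ∀ E, V.IsInvariantPrime E → 0 ≤ div (V.chi u) E + D E}

variable {V} {D : QDivisor V.X}

theorem chi_mem_H0 (hD : V.IsInvariantDivisor D) (u : Fin n → ℤ) :
    V.chi u ∈ H0 D ↔ u ∈ V.sectionExponents D := by
  constructor
  · rintro (h | h)
    · exact absurd h (V.chi_ne_zero u)
    · exact fun E hE => h E hE.1
  · intro h
    refine Or.inr fun x hx => ?_
    by_cases hxU : x ∈ V.openOrbit
    · have h1 : D x = 0 := by
        by_contra h0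
        exact (V.isInvariantPrime_iff.mp (hD x h0)).2 hxU
      rw [div, V.ord_chi_of_mem u hxU, h1]
      simp
    · exact h x (V.isInvariantPrime_of_notMem hx hxU)

/-- The sections of an invariant divisor are regular functions on the torus. -/
theorem exists_ratFun_of_mem_H0 (hD : V.IsInvariantDivisor D) {f : V.X.functionField}
    (hf : f ∈ H0 D) : ∃ a, V.ratFun a = f := by
  rcases hf with rfl | hf
  · exact ⟨0, map_zero _⟩
  obtain ⟨b, hb⟩ := exists_section_of_isRegularAt (U := V.openOrbit) (f := f) fun x hx =>
    isRegularAt_of_ord_nonneg x fun y hy hy1 => by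
      have hyU : y ∈ V.openOrbit := hy.mem_open V.openOrbit.isOpen hx
      have h1 : D y = 0 := by
        by_contra h0
        exact (V.isInvariantPrime_iff.mp (hD y h0)).2 hyU
      have h2 := hf y hy1
      rw [h1, add_zero, div] at h2
      exact_mod_cast h2
  refine ⟨V.orbitRingEquiv.symm b, ?_⟩
  rw [← hb]
  exact congrArg (V.X.germToFunctionField V.openOrbit) (V.orbitRingEquiv.apply_symm_apply b)

theorem pullback_translation_mem_H0 (hD : V.IsInvariantDivisor D) (t : Point n)
    {f : V.X.functionField} (hf : f ∈ H0 D) : pullback (V.translation t) f ∈ H0 D := by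
  rcases hf with rfl | hf
  · exact Or.inl (map_zero _)
  refine Or.inr fun x hx => ?_
  have h1 := hf (V.translation t x)
    ((coheight_eq_of_isOpenImmersion (V.translation t)).trans hx)
  rw [div] at h1 ⊢
  rw [ord_pullback]
  by_cases hxU : x ∈ V.openOrbit
  · have h2 : ∀ y, ¬ V.IsInvariantPrime y → D y = 0 := fun y hy => by
      by_contra h0
      exact hy (hD y h0)
    have hx' : ¬ V.IsInvariantPrime x := fun h => (V.isInvariantPrime_iff.mp h).2 hxU
    rw [h2 x hx']
    rwa [h2 _ fun h => ?_] at h1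
    obtain ⟨s, rfl⟩ := exists_algHom_eq t
    exact (V.isInvariantPrime_iff.mp h).2 (V.translation_mem_openOrbit s hxU)
  · rwa [(V.isInvariantPrime_of_notMem hx hxU).2 t] at h1 ⊢

/-- The characters which occur in a section of an invariant divisor are sections as well. -/
theorem mem_sectionExponents (hD : V.IsInvariantDivisor D) {a : torusRing n}
    (ha : V.ratFun a ∈ H0 D) {u : Fin n → ℤ} (hu : a.coeff u ≠ 0) : u ∈ V.sectionExponents D := by
  let W : Submodule ℂ (torusRing n) :=
    { carrier := {a | V.ratFun a ∈ H0 D}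
      zero_mem' := by
        change V.ratFun 0 ∈ H0 D
        rw [map_zero]
        exact zero_mem _
      add_mem' := fun {a b} ha hb => by
        change V.ratFun (a + b) ∈ H0 D
        rw [map_add]
        exact add_mem ha hb
      smul_mem' := fun c a ha => by
        change V.ratFun (c • a) ∈ H0 D
        rw [ratFun_smul]
        exact Submodule.smul_mem _ c ha }
  have h := single_mem_of_invariant W (fun t f hf => ?_) (f := a) ha hu
  · exact (chi_mem_H0 hD u).mp h
  · change V.ratFun (scale t f) ∈ H0 D
    rw [← pullback_translation_ratFun]
    exact pullback_translation_mem_H0 hD _ hf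

/-- If `E = D + div g`, multiplication by `g` identifies the sections of `E` with those of `D`. -/
theorem mem_H0_iff_mul {E : QDivisor V.X} {g : V.X.functionField} (hg : g ≠ 0)
    (hE : E = D + div g) (f : V.X.functionField) : f ∈ H0 E ↔ f * g ∈ H0 D := by
  by_cases hf : f = 0
  · simp only [hf, zero_mul, zero_mem]
  have h1 : ∀ F : QDivisor V.X, ∀ f : V.X.functionField, f ≠ 0 →
      (f ∈ H0 F ↔ ∀ x : V.X, coheight x = 1 → 0 ≤ div f x + F x) := fun F f hf =>
    ⟨fun h => h.resolve_left hf, Or.inr⟩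
  rw [h1 _ _ hf, h1 _ _ (mul_ne_zero hf hg)]
  refine forall₂_congr fun x _ => ?_
  rw [hE, div, div, Scheme.ord_mul hf hg, Pi.add_apply, div]
  push_cast
  rw [add_assoc, add_comm (D x)]

/-- If `E = D + div g` for an invariant divisor `D`, then the rational functions `χ^u g⁻¹` such that
`χ^u` is a section of `D` form a basis of `H⁰(X, E)`. -/
def sectionBasis (hD : V.IsInvariantDivisor D) {E : QDivisor V.X} {g : V.X.functionField}
    (hg : g ≠ 0) (hE : E = D + div g) : Module.Basis (V.sectionExponents D) ℂ (H0 E) :=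
  Module.Basis.mk (v := fun u => ⟨V.chi u.1 * g⁻¹, (mem_H0_iff_mul hg hE _).mpr (by
      rw [mul_assoc, inv_mul_cancel₀ hg, mul_one]
      exact (chi_mem_H0 hD u.1).mpr u.2)⟩)
    (by
      rw [linearIndependent_iff']
      intro s c hc i hi
      have h1 : V.ratFun (∑ u ∈ s, c u • AddMonoidAlgebra.single u.1 1) = 0 := by
        have h2 := congrArg (fun x : H0 E => x.1 * g) hc
        simp only [Submodule.coe_sum, Submodule.coe_smul, Finset.sum_mul, smul_mul_assoc,
          mul_assoc, inv_mul_cancel₀ hg, mul_one, Submodule.coe_zero, zero_mul] at h2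
        rw [map_sum, ← h2]
        exact Finset.sum_congr rfl fun u _ => V.ratFun_smul _ _
      rw [map_eq_zero_iff _ V.ratFun_injective] at h1
      have h3 := congrArg (fun f : torusRing n => f.coeff i.1) h1
      classical
      simpa [AddMonoidAlgebra.coeff_sum, Finsupp.finsetSum_apply, Finsupp.single_apply,
        Subtype.val_inj, hi] using h3)
    (by
      rintro ⟨f, hf⟩ -
      have hf' := (mem_H0_iff_mul hg hE f).mp hf
      obtain ⟨a, ha⟩ := exists_ratFun_of_mem_H0 hD hf'
      have hu : ∀ u ∈ a.coeff.support, u ∈ V.sectionExponents D := fun u hu =>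
        mem_sectionExponents hD (ha ▸ hf') (Finsupp.mem_support_iff.mp hu)
      have h1 : (⟨f, hf⟩ : H0 E) = ∑ u ∈ a.coeff.support.attach, a.coeff u.1 •
          (⟨V.chi u.1 * g⁻¹, (mem_H0_iff_mul hg hE _).mpr (by
            rw [mul_assoc, inv_mul_cancel₀ hg, mul_one]
            exact (chi_mem_H0 hD u.1).mpr (hu u.1 u.2))⟩ : H0 E) := by
        ext1
        rw [Submodule.coe_sum]
        simp only [Submodule.coe_smul, ← smul_mul_assoc]
        rw [← Finset.sum_mul, eq_mul_inv_iff_mul_eq₀ hg, ← ha]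
        conv_lhs => rw [eq_sum_single a]
        rw [map_sum, ← Finset.sum_attach]
        exact Finset.sum_congr rfl fun u _ => V.ratFun_smul _ _
      rw [h1]
      exact Submodule.sum_mem _ fun u _ => Submodule.smul_mem _ _
        (Submodule.subset_span ⟨⟨u.1, hu u.1 u.2⟩, rfl⟩))

theorem sectionBasis_apply (hD : V.IsInvariantDivisor D) {E : QDivisor V.X}
    {g : V.X.functionField} (hg : g ≠ 0) (hE : E = D + div g) (u : V.sectionExponents D) :
    (sectionBasis hD hg hE u : V.X.functionField) = V.chi u.1 * g⁻¹ := by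
  rw [sectionBasis, Module.Basis.mk_apply]

/-! ### Invariant valuations -/

theorem val_smul {v : V.X.functionField → ℝ} (hv : IsDivisorial v) {c : ℂ} (hc : c ≠ 0)
    {f : V.X.functionField} (hf : f ≠ 0) : v (c • f) = v f := by
  obtain ⟨ξ, hξ, -⟩ := hv.exists_center
  refine hξ.eq_of_ord_eq hv (smul_ne_zero hc hf) hf fun y _ => ?_
  have := congrFun (div_smul (X := V.X) hc hf) y
  rw [div, div] at this
  exact_mod_cast this

/-- The value of an invariant valuation at a regular function on the torus is at most its value at
every character which occurs in the function, since the functions of at least this value form an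
invariant subspace. -/
theorem val_ratFun_le {v : V.X.functionField → ℝ} (hv : v ∈ V.invDivVal) {a : torusRing n}
    {u : Fin n → ℤ} (hu : a.coeff u ≠ 0) : v (V.ratFun a) ≤ v (V.chi u) := by
  let W : Submodule ℂ (torusRing n) :=
    { carrier := {f | f = 0 ∨ v (V.ratFun a) ≤ v (V.ratFun f)}
      zero_mem' := Or.inl rfl
      add_mem' := by
        rintro f g (rfl | hf) (rfl | hg)
        · exact Or.inl (add_zero 0)
        · exact Or.inr (by rwa [zero_add])
        · exact Or.inr (by rwa [add_zero])
        · by_cases h : f + g = 0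
          · exact Or.inl h
          · refine Or.inr ?_
            rw [map_add]
            refine (le_min hf hg).trans (hv.1.map_add ?_)
            rwa [← map_add, Ne, map_eq_zero_iff _ V.ratFun_injective]
      smul_mem' := by
        rintro c f (rfl | hf)
        · exact Or.inl (smul_zero c)
        · by_cases hc : c = 0
          · exact Or.inl (by rw [hc, zero_smul])
          by_cases hf0 : f = 0
          · exact Or.inl (by rw [hf0, smul_zero])
          refine Or.inr ?_
          rwa [ratFun_smul, val_smul hv.1 hc]
          rwa [Ne, map_eq_zero_iff _ V.ratFun_injective] }
  have h := single_mem_of_invariant W (fun t f hf => ?_) (f := a) (Or.inr le_rfl) hu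
  · exact h.resolve_left (isUnit_single u one_ne_zero).ne_zero
  · rcases hf with rfl | hf
    · exact Or.inl (map_zero _)
    · refine Or.inr ?_
      rwa [← pullback_translation_ratFun, hv.2]

end ToricVariety

/-! ### The maximum over basis type divisors -/

namespace ToricVariety

variable {n : ℕ} {V : ToricVariety n} {D L : QDivisor V.X} {m : ℕ} {g : V.X.functionField}
  {v : V.X.functionField → ℝ} {d : ℝ}

/-- The value of a basis type divisor, if `m L = D + div g` and `v` has the value `d` at `D`. -/
theorem hasVal_basisType (hv : IsDivisorial v) (hm : 0 < m) {N : ℕ} (hN : 0 < N)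
    {s : Fin N → V.X.functionField} (hs : ∀ j, s j ≠ 0) (hg : g ≠ 0) (hmL : m • L = D + div g)
    (hd : HasVal v D d) :
    HasVal v (fun x => (1 / ((m : ℚ) * N)) * ∑ j, (div (s j) x + (m • L) x))
      (1 / ((m : ℝ) * N) * ∑ j, v (s j * g) + d / m) := by
  have h1 := (HasVal.sum hv Finset.univ fun j _ =>
    (HasVal.of_div hv (mul_ne_zero (hs j) hg)).add hv hd).smul hv (1 / ((m : ℚ) * N))
  have hm' : (m : ℝ) ≠ 0 := by exact_mod_cast hm.ne'
  have hN' : (N : ℝ) ≠ 0 := by exact_mod_cast hN.ne'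
  convert h1 using 1
  · funext x
    rw [hmL, Pi.smul_apply, Finset.sum_apply, smul_eq_mul]
    congr 1
    refine Finset.sum_congr rfl fun j _ => ?_
    rw [Pi.add_apply, Pi.add_apply, div, div, div, Scheme.ord_mul (hs j) hg]
    push_cast
    ring
  · push_cast
    rw [Finset.sum_add_distrib, Finset.sum_const, Finset.card_univ, Fintype.card_fin, nsmul_eq_mul,
      mul_add]
    congr 1
    field_simp

/-- The `ℚ`-divisor `(1 / (m |S|)) ∑_{u ∈ S} (div χ^u + D)`. If `m L` is linearly equivalent to `D`
and `S` is the set of characters which are sections of `D`, it is the basis type divisor of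
the basis of `H⁰(X, m L)` which corresponds to these characters. -/
def monomialDivisor (D : QDivisor V.X) (m : ℕ) (S : Finset (Fin n → ℤ)) : QDivisor V.X :=
  fun x => (1 / ((m : ℚ) * S.card)) * ∑ u ∈ S, (div (V.chi u) x + D x)

theorem exists_monomial_basis (hD : V.IsInvariantDivisor D) (hg : g ≠ 0) (hmL : m • L = D + div g)
    (S : Finset (Fin n → ℤ)) (hS : ∀ u, u ∈ S ↔ u ∈ V.sectionExponents D) :
    ∃ e : Module.Basis S ℂ (H0 (m • L)),
      ∀ u, (e u : V.X.functionField) = V.chi u.1 * g⁻¹ := by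
  refine ⟨(sectionBasis hD hg hmL).reindex (Equiv.subtypeEquivRight fun u => (hS u).symm),
    fun u => ?_⟩
  rw [Module.Basis.reindex_apply, sectionBasis_apply]
  rfl

theorem monomialDivisor_eq (hg : g ≠ 0) (hmL : m • L = D + div g) (S : Finset (Fin n → ℤ)) :
    monomialDivisor D m S = fun x => (1 / ((m : ℚ) * S.card)) *
      ∑ j, (div (V.chi (S.equivFin.symm j).1 * g⁻¹) x + (m • L) x) := by
  funext x
  rw [monomialDivisor, ← Finset.sum_coe_sort S]
  congr 1
  refine Fintype.sum_equiv S.equivFin _ _ fun u => ?_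
  rw [Equiv.symm_apply_apply, hmL, Pi.add_apply, div, div, div,
    Scheme.ord_mul (V.chi_ne_zero _) (inv_ne_zero hg), ord_inv x hg]
  push_cast
  ring

theorem isBasisType_monomialDivisor (hD : V.IsInvariantDivisor D) (hg : g ≠ 0)
    (hmL : m • L = D + div g) (S : Finset (Fin n → ℤ))
    (hS : ∀ u, u ∈ S ↔ u ∈ V.sectionExponents D) (hne : S.Nonempty) :
    IsBasisType L m (monomialDivisor D m S) := by
  obtain ⟨e, he⟩ := exists_monomial_basis hD hg hmL S hS
  refine ⟨S.card, e.reindex S.equivFin, hne.card_pos, ?_⟩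
  rw [monomialDivisor_eq hg hmL]
  funext x
  simp only [Module.Basis.reindex_apply, he]

theorem hasVal_monomialDivisor (hv : IsDivisorial v) (hm : 0 < m) (hg : g ≠ 0)
    (hmL : m • L = D + div g) (S : Finset (Fin n → ℤ)) (hne : S.Nonempty) (hd : HasVal v D d) :
    HasVal v (monomialDivisor D m S)
      (1 / ((m : ℝ) * S.card) * ∑ u ∈ S, v (V.chi u) + d / m) := by
  rw [monomialDivisor_eq hg hmL]
  convert hasVal_basisType hv hm hne.card_pos (fun j => mul_ne_zero
    (V.chi_ne_zero (S.equivFin.symm j).1) (inv_ne_zero hg)) hg hmL hd using 3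
  rw [← Finset.sum_coe_sort S]
  refine Fintype.sum_equiv S.equivFin _ _ fun u => ?_
  rw [Equiv.symm_apply_apply, mul_assoc, inv_mul_cancel₀ hg, mul_one]

/-- The basis of monomial sections maximizes the value of every invariant valuation: an arbitrary
basis can be matched with it in such a way that each section contains the corresponding
monomial. -/
theorem isGreatest_basisTypeValues (hD : V.IsInvariantDivisor D) (hm : 0 < m) (hg : g ≠ 0)
    (hmL : m • L = D + div g) (S : Finset (Fin n → ℤ))
    (hS : ∀ u, u ∈ S ↔ u ∈ V.sectionExponents D) (hne : S.Nonempty) (hv : v ∈ V.invDivVal)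
    (hd : HasVal v D d) :
    IsGreatest (basisTypeValues L m v)
      (1 / ((m : ℝ) * S.card) * ∑ u ∈ S, v (V.chi u) + d / m) := by
  refine ⟨⟨_, isBasisType_monomialDivisor hD hg hmL S hS hne,
    ((hasVal_monomialDivisor hv.1 hm hg hmL S hne hd).valDiv_eq hv.1).symm⟩, ?_⟩
  rintro _ ⟨_, ⟨N, s, hN, rfl⟩, rfl⟩
  obtain ⟨e, he⟩ := exists_monomial_basis hD hg hmL S hS
  have hs : ∀ j, (s j : V.X.functionField) ≠ 0 := fun j h =>
    s.ne_zero j (Subtype.ext h)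
  rw [(hasVal_basisType hv.1 hm hN hs hg hmL hd).valDiv_eq hv.1]
  obtain ⟨σ, hσ⟩ := exists_equiv_repr_ne_zero e s
  have hcard : N = S.card := by
    simpa using Fintype.card_congr σ
  subst hcard
  have hle : ∀ j, v (s j * g) ≤ v (V.chi (σ j).1) := by
    intro j
    let a : torusRing n := ∑ u, e.repr (s j) u • AddMonoidAlgebra.single u.1 1
    have ha : V.ratFun a = s j * g := by
      have h1 := congrArg (fun x : H0 (m • L) => x.1 * g) (e.sum_repr (s j))
      rw [← h1]
      simp only [Submodule.coe_sum, Submodule.coe_smul, he, Finset.sum_mul, smul_mul_assoc,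
        mul_assoc, inv_mul_cancel₀ hg, mul_one]
      rw [map_sum]
      exact Finset.sum_congr rfl fun u _ => V.ratFun_smul _ _
    rw [← ha]
    refine val_ratFun_le hv ?_
    have h2 : a.coeff (σ j).1 = e.repr (s j) (σ j) := by
      classical
      simp [a, AddMonoidAlgebra.coeff_sum, Finsupp.finsetSum_apply, Finsupp.single_apply]
    rw [h2]
    exact hσ j
  have hsum : ∑ j, v (s j * g) ≤ ∑ u ∈ S, v (V.chi u) := by
    rw [← Finset.sum_coe_sort S]
    refine (Finset.sum_le_sum fun j _ => hle j).trans_eq ?_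
    exact Fintype.sum_equiv σ _ _ fun j => rfl
  gcongr

end ToricVariety

/-! ### The polytope of an invariant divisor -/

namespace ToricVariety

variable {n : ℕ} (V : ToricVariety n)

/-- A function which is additive on characters is linear in the exponent. -/
theorem map_chi_eq_sum {G : Type*} [AddCommGroup G] (φ : V.X.functionField → G)
    (hφ : ∀ u w, φ (V.chi u * V.chi w) = φ (V.chi u) + φ (V.chi w)) (u : Fin n → ℤ) :
    φ (V.chi u) = ∑ i, u i • φ (V.chi (Pi.single i 1)) := by
  let Φ : (Fin n → ℤ) →+ G :=
    AddMonoidHom.mk' (fun u => φ (V.chi u)) fun u w => by rw [chi_add, hφ]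
  change Φ u = ∑ i, u i • Φ (Pi.single i 1)
  conv_lhs => rw [← Finset.univ_sum_single u]
  rw [map_sum]
  refine Finset.sum_congr rfl fun i _ => ?_
  rw [← map_zsmul, ← Pi.single_smul, smul_eq_mul, mul_one]

theorem ord_chi_eq_sum (u : Fin n → ℤ) (x : V.X) :
    Scheme.ord (V.chi u) x = ∑ i, u i * Scheme.ord (V.chi (Pi.single i 1)) x :=
  V.map_chi_eq_sum (fun f => Scheme.ord f x)
    (fun u w => Scheme.ord_mul (V.chi_ne_zero u) (V.chi_ne_zero w)) u

theorem val_chi_eq_sum {v : V.X.functionField → ℝ} (hv : IsDivisorial v) (u : Fin n → ℤ) :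
    v (V.chi u) = ∑ i, u i * v (V.chi (Pi.single i 1)) := by
  rw [V.map_chi_eq_sum v (fun u w => hv.map_mul (V.chi_ne_zero u) (V.chi_ne_zero w)) u]
  simp only [zsmul_eq_mul]

/-- A character which is regular everywhere is constant, since the toric variety is complete. -/
theorem eq_zero_of_ord_chi_nonneg {u : Fin n → ℤ}
    (hu : ∀ E, V.IsInvariantPrime E → 0 ≤ Scheme.ord (V.chi u) E) : u = 0 := by
  obtain ⟨a, ha⟩ := exists_section_of_isRegularAt (U := (⊤ : V.X.Opens)) (f := V.chi u)
    fun x _ => isRegularAt_of_ord_nonneg x fun y _ hy => by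
      by_cases hyU : y ∈ V.openOrbit
      · rw [V.ord_chi_of_mem u hyU]
      · exact hu y (V.isInvariantPrime_of_notMem hy hyU)
  have h1 : ((V.X ↘ SpecC).appTop.hom.comp
      (Scheme.ΓSpecIso (CommRingCat.of ℂ)).inv.hom).IsIntegral :=
    RingHom.IsIntegral.trans _ _ (RingHom.isIntegral_of_surjective _
      (Scheme.ΓSpecIso (CommRingCat.of ℂ)).symm.commRingCatIsoToRingEquiv.surjective)
      (isIntegral_appTop_of_universallyClosed (V.X ↘ SpecC))
  -- the ring of global sections is integral over `ℂ`, hence `χ^u` is a constant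
  have h2 : _root_.IsIntegral ℂ (V.chi u) := by
    obtain ⟨p, hp, h⟩ := h1 a
    refine ⟨p, hp, ?_⟩
    have h3 := congrArg (V.X.germToFunctionField ⊤).hom h
    rw [Polynomial.hom_eval₂, map_zero] at h3
    rw [← ha]
    exact h3
  obtain ⟨c, hc⟩ := (IsAlgClosed.algebraMap_bijective_of_isIntegral (k := ℂ)
    (K := integralClosure ℂ V.X.functionField)).2 ⟨V.chi u, h2⟩
  have h4 : algebraMap ℂ V.X.functionField c = V.chi u := congrArg Subtype.val hc
  rw [algebraMap_eq_ratFun, chi_eq] at h4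
  have h5 := congrArg (fun f : torusRing n => f.coeff u) (V.ratFun_injective h4)
  by_contra h0
  have h6 : (algebraMap ℂ (torusRing n) c).coeff u = 0 := by
    rw [AddMonoidAlgebra.coe_algebraMap]
    change (AddMonoidAlgebra.single (0 : Fin n → ℤ) c).coeff u = 0
    rw [AddMonoidAlgebra.coeff_single, Finsupp.single_eq_of_ne h0]
  simp only [h6, AddMonoidAlgebra.coeff_single, Finsupp.single_eq_same] at h5
  exact zero_ne_one h5

theorem setOf_isInvariantPrime :
    {E | V.IsInvariantPrime E} = {x : V.X | coheight x = 1 ∧ x ∉ V.openOrbit} :=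
  Set.ext fun _ => V.isInvariantPrime_iff

theorem finite_isInvariantPrime : {E | V.IsInvariantPrime E}.Finite := by
  rw [setOf_isInvariantPrime]
  exact V.finite_boundary

theorem isBounded_polytope (D : QDivisor V.X) : Bornology.IsBounded (V.polytope D) := by
  refine isBounded_polyhedron V.finite_isInvariantPrime
    (fun E i => Scheme.ord (V.chi (Pi.single i 1)) E) (fun E => (D E : ℝ)) fun u hu =>
      V.eq_zero_of_ord_chi_nonneg fun E hE => ?_
  rw [ord_chi_eq_sum]
  exact (hu E hE).trans_eq (Finset.sum_congr rfl fun i _ => mul_comm _ _)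

theorem isClosed_polytope (D : QDivisor V.X) : IsClosed (V.polytope D) := by
  have : V.polytope D = ⋂ E, ⋂ _ : V.IsInvariantPrime E, {x | 0 ≤
      ∑ i, x i * (Scheme.ord (V.chi (Pi.single i 1)) E : ℝ) + (D E : ℝ)} := by
    ext x
    simp only [Set.mem_iInter]
    rfl
  rw [this]
  exact isClosed_iInter fun E => isClosed_iInter fun _ =>
    isClosed_le continuous_const (by fun_prop)

theorem isCompact_polytope (D : QDivisor V.X) : IsCompact (V.polytope D) :=
  Metric.isCompact_of_isClosed_isBounded (V.isClosed_polytope D) (V.isBounded_polytope D)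

theorem convex_polytope (D : QDivisor V.X) : Convex ℝ (V.polytope D) := by
  intro x hx y hy a b ha hb hab E hE
  have h1 := mul_nonneg ha (hx E hE)
  have h2 := mul_nonneg hb (hy E hE)
  have h3 : ∑ i, (a • x + b • y) i * (Scheme.ord (V.chi (Pi.single i 1)) E : ℝ) =
      a * ∑ i, x i * (Scheme.ord (V.chi (Pi.single i 1)) E : ℝ) +
        b * ∑ i, y i * (Scheme.ord (V.chi (Pi.single i 1)) E : ℝ) := by
    rw [Finset.mul_sum, Finset.mul_sum, ← Finset.sum_add_distrib]
    refine Finset.sum_congr rfl fun i _ => ?_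
    simp only [Pi.add_apply, Pi.smul_apply, smul_eq_mul]
    ring
  have h4 : (D E : ℝ) = a * D E + b * D E := by rw [← add_mul, hab, one_mul]
  rw [h3, h4]
  linarith

theorem exists_rat_integral_polytope (D : QDivisor V.X) {f : (Fin n → ℝ) → ℝ}
    (hf : f ∈ ratPoly n) : ∃ q : ℚ, ∫ x in V.polytope D, f x = q := by
  have h : V.polytope D = {x | ∀ E ∈ {E | V.IsInvariantPrime E},
      0 ≤ ratAffine (fun i => (Scheme.ord (V.chi (Pi.single i 1)) E : ℚ)) (D E) x} := by
    ext x
    refine forall₂_congr fun E _ => ?_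
    rw [ratAffine]
    simp only [Rat.cast_intCast, mul_comm]
  rw [h]
  refine integral_polytope_rational V.finite_isInvariantPrime _ _ ?_ hf
  rw [← h]
  exact V.isBounded_polytope D

theorem barycenter_apply (D : QDivisor V.X) (i : Fin n) :
    V.barycenter D i = (volume.real (V.polytope D))⁻¹ * ∫ x in V.polytope D, x i := by
  rw [barycenter, setAverage_eq, Pi.smul_apply, smul_eq_mul, eval_integral]
  exact fun i => ((continuous_apply i).continuousOn).integrableOn_compact (V.isCompact_polytope D)

theorem exists_rat_barycenter (D : QDivisor V.X) (i : Fin n) :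
    ∃ q : ℚ, V.barycenter D i = q := by
  obtain ⟨p, hp⟩ := V.exists_rat_integral_polytope D (const_mem_ratPoly 1)
  obtain ⟨q, hq⟩ := V.exists_rat_integral_polytope D (coord_mem_ratPoly i)
  refine ⟨p⁻¹ * q, ?_⟩
  have h1 : volume.real (V.polytope D) = p := by
    rw [← hp]
    simp
  rw [barycenter_apply, h1, hq]
  push_cast
  rfl

/-- The barycenter of the polytope of an invariant `ℚ`-divisor is rational. -/
theorem exists_isBarycenterDivisor (D : QDivisor V.X) : ∃ B, V.IsBarycenterDivisor D B := by
  choose q hq using V.exists_rat_barycenter D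
  have hden : ∀ i, ∃ z : ℤ, (z : ℚ) = (∏ j, (q j).den : ℕ) * q i := by
    intro i
    refine ⟨(∏ j ∈ Finset.univ.erase i, (q j).den : ℕ) * (q i).num, ?_⟩
    rw [← Finset.mul_prod_erase _ _ (Finset.mem_univ i)]
    push_cast
    rw [← (q i).mul_den_eq_num]
    ring
  choose w hw using hden
  refine ⟨_, ∏ j, (q j).den, w, Finset.prod_pos fun j _ => (q j).den_pos, fun i => ?_, rfl⟩
  rw [hq]
  exact_mod_cast hw i

/-! ### Lattice points and sections -/

variable {V} {D : QDivisor V.X}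

/-- The characters which are sections of `m D + q div χ^w` correspond to the points of the shifted
lattice `(ℤ^n + q w) / m` in the polytope of `D`. -/
theorem mem_sectionExponents_iff {m : ℕ} (hm : 0 < m) (q : ℚ) (w u : Fin n → ℤ) :
    u ∈ V.sectionExponents (m • D + q • div (V.chi w)) ↔
      latticePoint m (fun i => q * w i) u ∈ V.polytope D := by
  have hm' : (0 : ℝ) < m := by exact_mod_cast hm
  refine forall₂_congr fun E _ => ?_
  have h1 : ∑ i, latticePoint m (fun i => q * w i) u i *
      (Scheme.ord (V.chi (Pi.single i 1)) E : ℝ) =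
      ((Scheme.ord (V.chi u) E : ℝ) + q * Scheme.ord (V.chi w) E) / m := by
    rw [V.ord_chi_eq_sum u, V.ord_chi_eq_sum w]
    push_cast
    rw [Finset.mul_sum, ← Finset.sum_add_distrib, Finset.sum_div]
    refine Finset.sum_congr rfl fun i _ => ?_
    rw [latticePoint]
    ring
  rw [h1]
  have h2 : ((Scheme.ord (V.chi u) E : ℝ) + q * Scheme.ord (V.chi w) E) / m + D E =
      ((div (V.chi u) E + (m • D + q • div (V.chi w)) E : ℚ) : ℝ) / m := by
    rw [Pi.add_apply, Pi.smul_apply, Pi.smul_apply, nsmul_eq_mul, smul_eq_mul, div, div]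
    push_cast
    field_simp
    ring
  rw [h2, le_div_iff₀ hm', zero_mul, Rat.cast_nonneg]

theorem mem_sectionExponents_nsmul_iff {m : ℕ} (hm : 0 < m) (u : Fin n → ℤ) :
    u ∈ V.sectionExponents (m • D) ↔ u ∈ V.latticePoints D m := by
  have h := mem_sectionExponents_iff (D := D) hm 0 0 u
  rw [zero_smul, add_zero] at h
  rw [h, latticePoints]
  have h1 : latticePoint m (fun i => ((0 : ℚ) : ℝ) * ((0 : Fin n → ℤ) i : ℝ)) u =
      fun i => (u i : ℝ) / (m : ℝ) := by
    funext i
    simp [latticePoint]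
  rw [h1]
  rfl

end ToricVariety

/-! ### Ample divisors -/

theorem div_pow {X : Scheme.{0}} [IsIntegral X] [IsLocallyNoetherian X] {f : X.functionField}
    (hf : f ≠ 0) (k : ℕ) : div (f ^ k) = k • div f := by
  funext x
  rw [Pi.smul_apply, div, div, ord_pow x hf, nsmul_eq_mul]
  push_cast
  rfl

theorem div_mul {X : Scheme.{0}} [IsIntegral X] [IsLocallyNoetherian X] {f g : X.functionField}
    (hf : f ≠ 0) (hg : g ≠ 0) : div (f * g) = div f + div g := by
  funext x
  rw [Pi.add_apply, div, div, div, Scheme.ord_mul hf hg]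
  push_cast
  rfl

theorem IsCartier.nsmul {X : Scheme.{0}} [IsIntegral X] [IsLocallyNoetherian X] {D : QDivisor X}
    (hD : IsCartier D) (k : ℕ) : IsCartier (k • D) := by
  intro ξ
  obtain ⟨g, hg, U, hξU, hU⟩ := hD ξ
  refine ⟨g ^ k, pow_ne_zero k hg, U, hξU, fun y hy => ?_⟩
  rw [div_pow hg, Pi.smul_apply, Pi.smul_apply, hU y hy]

section Ample

variable {X : Scheme.{0}} [IsIntegral X] [IsNoetherian X] [X.Over SpecC] [IsNormalScheme X]
  {L : QDivisor X}

/-- An ample `ℚ`-divisor has a section whose nonvanishing locus is affine and nonempty. -/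
theorem IsAmple.exists_section (hL : IsAmple L) :
    ∃ q : ℕ, 0 < q ∧ ∃ s ∈ H0 (q • L), s ≠ 0 ∧ ∃ U : X.Opens, IsAffineOpen U ∧ Nonempty U ∧
      (∀ y ∈ U, div s y + (q • L) y = 0) ∧
      ∀ y ∉ U, coheight y = 1 → 0 < div s y + (q • L) y := by
  obtain ⟨r, hr, -, h⟩ := hL
  obtain ⟨k, hk, s, hs, hs0, U, hU, hξU, h⟩ := h (genericPoint X)
  refine ⟨k * r, Nat.mul_pos hk hr, s, hs, hs0, U, hU, ⟨⟨_, hξU⟩⟩,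
    fun y hy => (h y).mp hy y specializes_rfl, fun y hy hy1 => ?_⟩
  refine lt_of_le_of_ne (hs.resolve_left hs0 y hy1) fun h0 => hy ((h y).mpr fun z hz => ?_)
  by_cases hzg : z = genericPoint X
  · exact (h (genericPoint X)).mp hξU z (hzg ▸ specializes_rfl)
  · rw [eq_of_coheight_eq_one hy1 hz hzg, ← h0]

/-- A rational function which is regular on the nonvanishing locus of `s` becomes a global section
after multiplication with a high power of `s`. -/
theorem eventually_mul_pow_mem_H0 {q : ℕ} {s : X.functionField} (hs : s ≠ 0) {U : X.Opens}
    [Nonempty U] (hU : ∀ y ∈ U, div s y + (q • L) y = 0)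
    (hU' : ∀ y ∉ U, coheight y = 1 → 0 < div s y + (q • L) y) {a : X.functionField} (ha : a ≠ 0)
    (haU : ∀ y ∈ U, IsRegularAt a y) :
    ∀ᶠ p : ℕ in atTop, a * s ^ p ∈ H0 ((p * q) • L) := by
  have h1 : ∀ᶠ p : ℕ in atTop, ∀ y ∈ {x : X | coheight x = 1 ∧ x ∉ U},
      0 ≤ div a y + p * (div s y + (q • L) y) := by
    rw [(finite_coheight_one_compl U).eventually_all]
    rintro y ⟨hy, hyU⟩
    have h2 : Tendsto (fun p : ℕ => div a y + (p : ℚ) * (div s y + (q • L) y)) atTop atTop :=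
      tendsto_atTop_add_const_left _ _
        (tendsto_natCast_atTop_atTop.atTop_mul_const (hU' y hyU hy))
    exact h2.eventually_ge_atTop 0
  filter_upwards [h1] with p hp
  refine Or.inr fun y hy => ?_
  have h3 : div (a * s ^ p) y + ((p * q) • L) y = div a y + p * (div s y + (q • L) y) := by
    rw [div_mul ha (pow_ne_zero p hs), div_pow hs, Pi.add_apply, Pi.smul_apply, Pi.smul_apply,
      Pi.smul_apply, nsmul_eq_mul, nsmul_eq_mul, nsmul_eq_mul]
    push_cast
    ring
  rw [h3]
  by_cases hyU : y ∈ U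
  · rw [hU y hyU, mul_zero, add_zero, div]
    exact_mod_cast (isRegularAt_iff_ord_nonneg hy ha).mp (haU y hyU)
  · exact hp y ⟨hy, hyU⟩

end Ample

namespace ToricVariety

variable {n : ℕ} {V : ToricVariety n} {L D : QDivisor V.X}

theorem IsInvariantDivisor.nsmul (hD : V.IsInvariantDivisor D) (m : ℕ) :
    V.IsInvariantDivisor (m • D) := fun x hx => hD x fun h => hx (by
  rw [Pi.smul_apply, h, smul_zero])

theorem IsInvariantDivisor.add_div_chi (hD : V.IsInvariantDivisor D) (q : ℚ) (w : Fin n → ℤ) :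
    V.IsInvariantDivisor (D + q • div (V.chi w)) := by
  intro x hx
  by_cases h : D x = 0
  · rw [Pi.add_apply, h, zero_add, Pi.smul_apply, div] at hx
    rw [isInvariantPrime_iff]
    refine ⟨?_, fun hxU => hx ?_⟩
    · by_contra hx1
      simp [hx1] at hx
    · rw [V.ord_chi_of_mem w hxU]
      simp
  · exact hD x h

theorem nsmul_eq_nsmul_add_div {r : ℕ} {f : V.X.functionField} (hf : f ≠ 0)
    (h : r • L = r • D + div f) (k : ℕ) : (k * r) • L = (k * r) • D + div (f ^ k) := by
  rw [mul_smul, h, smul_add, div_pow hf, mul_smul]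

/-- If `E = D + div g`, a nonzero section of `E` corresponds to a nonzero Laurent polynomial, all of
whose characters are sections of `D`. -/
theorem exists_mem_sectionExponents (hD : V.IsInvariantDivisor D) {E : QDivisor V.X}
    {g : V.X.functionField} (hg : g ≠ 0) (hE : E = D + div g) {s : V.X.functionField}
    (hs : s ∈ H0 E) (hs0 : s ≠ 0) : ∃ a : torusRing n, V.ratFun a = s * g ∧
      (∀ u, a.coeff u ≠ 0 → u ∈ V.sectionExponents D) ∧ ∃ u, a.coeff u ≠ 0 := by
  have h := (mem_H0_iff_mul hg hE s).mp hs
  obtain ⟨a, ha⟩ := exists_ratFun_of_mem_H0 hD h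
  refine ⟨a, ha, fun u hu => mem_sectionExponents hD (ha ▸ h) hu, ?_⟩
  by_contra! h0
  have : a = 0 := AddMonoidAlgebra.coeff_injective (Finsupp.ext h0)
  rw [this, map_zero] at ha
  exact mul_ne_zero hs0 hg ha.symm

/-- The polytope of an ample divisor has dimension `n`. Writing a character `χ` as a quotient
`b / a` of functions which are regular on an affine nonvanishing locus, the sections `a s^p` and
`b s^p` contain monomials which differ by `χ`. -/
theorem interior_polytope_nonempty (hL : IsAmple L) (hD : V.IsInvariantDivisor D)
    (hLD : QLinEquiv L D) : (interior (V.polytope D)).Nonempty := by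
  obtain ⟨r, hr, f, hf, hrf⟩ := hLD
  obtain ⟨q, hq, s, hs, hs0, U, hUaff, hUne, hU, hU'⟩ := hL.exists_section
  have key : ∀ w : Fin n → ℤ, ∃ m : ℕ, 0 < m ∧ ∃ u : Fin n → ℤ,
      u ∈ V.latticePoints D m ∧ u + w ∈ V.latticePoints D m := by
    intro w
    have := functionField_isFractionRing_of_isAffineOpen V.X U hUaff
    obtain ⟨b, a, ha, hab⟩ := IsFractionRing.div_surjective (A := Γ(V.X, U)) (V.chi w)
    have ha0 : V.X.germToFunctionField U a ≠ 0 :=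
      (map_ne_zero_iff _ (V.X.germToFunctionField_injective U)).mpr (nonZeroDivisors.ne_zero ha)
    have hba : V.X.germToFunctionField U b = V.chi w * V.X.germToFunctionField U a := by
      rw [← hab]
      exact (div_mul_cancel₀ _ ha0).symm
    have hb0 : V.X.germToFunctionField U b ≠ 0 := by
      rw [hba]
      exact mul_ne_zero (V.chi_ne_zero w) ha0
    have hev := (eventually_mul_pow_mem_H0 hs0 hU hU' ha0 fun y hy => isRegularAt_germ a hy).and
      (eventually_mul_pow_mem_H0 hs0 hU hU' hb0 fun y hy => isRegularAt_germ b hy)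
    obtain ⟨p₀, hp₀⟩ := eventually_atTop.mp hev
    -- a multiple of `r` above the threshold
    obtain ⟨hA, hB⟩ := hp₀ ((p₀ + 1) * r)
      ((Nat.le_succ p₀).trans (Nat.le_mul_of_pos_right _ hr))
    have hm : 0 < (p₀ + 1) * r * q := by positivity
    have hmL : ((p₀ + 1) * r * q) • L = ((p₀ + 1) * r * q) • D + div (f ^ ((p₀ + 1) * q)) := by
      rw [mul_right_comm]
      exact nsmul_eq_nsmul_add_div hf hrf _
    have hg : f ^ ((p₀ + 1) * q) ≠ 0 := pow_ne_zero _ hf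
    obtain ⟨α, hα, hα1, u, hu⟩ := exists_mem_sectionExponents (hD.nsmul _) hg hmL hA
      (mul_ne_zero ha0 (pow_ne_zero _ hs0))
    have hβ : V.ratFun (AddMonoidAlgebra.single w 1 * α) =
        V.X.germToFunctionField U b * s ^ ((p₀ + 1) * r) * f ^ ((p₀ + 1) * q) := by
      rw [map_mul, ← chi_eq, hα, hba]
      ring
    refine ⟨_, hm, u, (mem_sectionExponents_nsmul_iff hm u).mp (hα1 u hu),
      (mem_sectionExponents_nsmul_iff hm _).mp (mem_sectionExponents (hD.nsmul _)
        (a := AddMonoidAlgebra.single w 1 * α) ?_ ?_)⟩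
    · rw [hβ]
      exact (mem_H0_iff_mul hg hmL _).mp hB
    · rw [add_comm u w, AddMonoidAlgebra.coeff_single_mul_add, one_mul]
      exact hu
  refine interior_nonempty_of_segments (V.convex_polytope D) ?_ fun i => ?_
  · obtain ⟨m, -, u, hu, -⟩ := key 0
    exact ⟨_, hu⟩
  · obtain ⟨m, hm, u, hu, hu'⟩ := key (Pi.single i 1)
    have hm' : (m : ℝ) ≠ 0 := by exact_mod_cast hm.ne'
    refine ⟨_, hu, 1 / m, one_div_ne_zero hm', ?_⟩
    have h : (fun j => (u j : ℝ) / (m : ℝ)) + Pi.single i (1 / (m : ℝ)) =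
        fun j => (((u + Pi.single i 1 : Fin n → ℤ) j : ℤ) : ℝ) / (m : ℝ) := by
      funext j
      by_cases hj : j = i
      · subst hj
        simp [add_div]
      · simp [hj]
    rw [h]
    exact hu'

end ToricVariety

/-! ### Computation of the invariants -/

namespace ToricVariety

variable {n : ℕ} {V : ToricVariety n} {L D : QDivisor V.X}

/-- If `m L` is Cartier, it is linearly equivalent to an invariant `ℚ`-divisor, which differs from
`m D` by a fractional multiple of the divisor of a character. Indeed `r (m L - m D)` is the divisor
of `f^m`, whose orders along the prime divisors which meet the torus are divisible by `r`, and the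
coordinate ring of the torus is factorial. -/
theorem exists_shift (hD : V.IsInvariantDivisor D) {r : ℕ} (hr : 0 < r) {f : V.X.functionField}
    (hf : f ≠ 0) (hrf : r • L = r • D + div f) {m : ℕ} (hm : IsCartier (m • L)) :
    ∃ (w : Fin n → ℤ) (g : V.X.functionField), g ≠ 0 ∧
      m • L = (m • D + (1 / r : ℚ) • div (V.chi w)) + div g := by
  have hr' : (r : ℚ) ≠ 0 := by exact_mod_cast hr.ne'
  have hrm : ∀ x, (r : ℚ) * (m • L) x = r * (m • D) x + m * div f x := by
    intro x
    have h1 := congrFun hrf x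
    rw [Pi.add_apply, Pi.smul_apply, Pi.smul_apply, nsmul_eq_mul, nsmul_eq_mul] at h1
    rw [Pi.smul_apply, Pi.smul_apply, nsmul_eq_mul, nsmul_eq_mul]
    linear_combination (m : ℚ) * h1
  have hdvd : ∀ y ∈ V.openOrbit, coheight y = 1 → (r : ℤ) ∣ Scheme.ord (f ^ m) y := by
    intro y hy _
    obtain ⟨g, hg, U, hyU, hU⟩ := hm y
    have h0 : D y = 0 := by
      by_contra h0
      exact (V.isInvariantPrime_iff.mp (hD y h0)).2 hy
    have h1 := hrm y
    rw [← hU y hyU, Pi.smul_apply, h0, smul_zero, mul_zero, zero_add, div, div] at h1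
    refine ⟨Scheme.ord g y, ?_⟩
    rw [ord_pow y hf]
    exact_mod_cast h1.symm
  have : UniqueFactorizationMonoid Γ(V.X, V.openOrbit) :=
    V.orbitRingEquiv.toMulEquiv.uniqueFactorizationMonoid inferInstance
  obtain ⟨ε, g, hε, hg, h⟩ := exists_unit_mul_pow_of_dvd_ord V.isAffineOpen_openOrbit hr
    (pow_ne_zero m hf) hdvd
  obtain ⟨w, c, hc, hw⟩ := eq_single_of_isUnit (hε.map V.orbitRingEquiv.symm)
  have hε' : V.X.germToFunctionField V.openOrbit ε = c • V.chi w := by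
    have h1 : ε = V.orbitRingEquiv (AddMonoidAlgebra.single w c) := by
      rw [← hw, RingEquiv.apply_symm_apply]
    have h2 : (AddMonoidAlgebra.single w c : torusRing n) = c • AddMonoidAlgebra.single w 1 := by
      rw [AddMonoidAlgebra.smul_single, smul_eq_mul, mul_one]
    rw [h1, chi_eq, ← ratFun_smul, ← h2]
    rfl
  refine ⟨w, g, hg, ?_⟩
  have h1 : div (f ^ m) = div (V.chi w) + r • div g := by
    rw [h, hε', div_mul (smul_ne_zero hc (V.chi_ne_zero w)) (pow_ne_zero r hg), div_pow hg,
      div_smul hc (V.chi_ne_zero w)]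
  funext x
  have h2 := hrm x
  have h3 := congrFun h1 x
  rw [div_pow hf, Pi.smul_apply, Pi.add_apply, Pi.smul_apply, nsmul_eq_mul, nsmul_eq_mul] at h3
  rw [h3] at h2
  rw [Pi.add_apply, Pi.add_apply, Pi.smul_apply _ (div _), smul_eq_mul]
  field_simp
  linear_combination h2

theorem exists_finset_sectionExponents {m : ℕ} (hm : 0 < m) (q : ℚ) (w : Fin n → ℤ) :
    ∃ S : Finset (Fin n → ℤ), (∀ u, u ∈ S ↔ u ∈ V.sectionExponents (m • D + q • div (V.chi w))) ∧
      (S : Set (Fin n → ℤ)) = {u | latticePoint m (fun i => q * w i) u ∈ V.polytope D} := by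
  have h := finite_latticePoint_mem (V.isBounded_polytope D) hm fun i => (q : ℝ) * w i
  refine ⟨h.toFinset, fun u => ?_, h.coe_toFinset⟩
  rw [Set.Finite.mem_toFinset, mem_sectionExponents_iff hm]
  rfl

/-- The value `S_m(v)` in terms of the points of a shifted lattice in the polytope: it is the value
at `D` plus the average over these points of the linear form which extends `u ↦ v (χ^u)`. -/
theorem Sm_eq (hD : V.IsInvariantDivisor D) {r : ℕ} {m : ℕ} (hm : 0 < m) {w : Fin n → ℤ}
    {g : V.X.functionField} (hg : g ≠ 0)
    (hmL : m • L = (m • D + (1 / r : ℚ) • div (V.chi w)) + div g)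
    {v : V.X.functionField → ℝ} (hv : v ∈ V.invDivVal) {d : ℝ} (hd : HasVal v D d)
    {θ : Fin n → ℝ} (hθ : θ = fun i => ((1 / r : ℚ) : ℝ) * w i)
    (hne : {u | latticePoint m θ u ∈ V.polytope D}.Nonempty) :
    Sm L m v = d + (∑ᶠ u ∈ {u | latticePoint m θ u ∈ V.polytope D},
        ∑ i, latticePoint m θ u i * v (V.chi (Pi.single i 1))) /
      ∑ᶠ u ∈ {u | latticePoint m θ u ∈ V.polytope D}, (1 : ℝ) := by
  subst hθ
  obtain ⟨S, hS, hS'⟩ := exists_finset_sectionExponents (V := V) (D := D) hm (1 / r : ℚ) w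
  rw [← hS'] at hne ⊢
  rw [Finset.coe_nonempty] at hne
  have hd' : HasVal v (m • D + (1 / r : ℚ) • div (V.chi w))
      (m * d + (1 / r : ℚ) * v (V.chi w)) :=
    (hd.nsmul hv.1 m).add hv.1 ((HasVal.of_div hv.1 (V.chi_ne_zero w)).smul hv.1 _)
  have h := (isGreatest_basisTypeValues ((hD.nsmul m).add_div_chi _ w) hm hg hmL S hS hne hv
    hd').csSup_eq
  rw [Sm, h, finsum_mem_coe_finset, finsum_mem_coe_finset]
  have hm' : (m : ℝ) ≠ 0 := by exact_mod_cast hm.ne'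
  have hN : (S.card : ℝ) ≠ 0 := by exact_mod_cast hne.card_pos.ne'
  have h1 : ∀ u : Fin n → ℤ, ∑ i, latticePoint m (fun i => ((1 / r : ℚ) : ℝ) * w i) u i *
      v (V.chi (Pi.single i 1)) = (v (V.chi u) + (1 / r : ℚ) * v (V.chi w)) / m := by
    intro u
    rw [V.val_chi_eq_sum hv.1 u, V.val_chi_eq_sum hv.1 w, Finset.mul_sum,
      ← Finset.sum_add_distrib, Finset.sum_div]
    refine Finset.sum_congr rfl fun i _ => ?_
    rw [latticePoint]
    ring
  simp only [h1]
  rw [← Finset.sum_div, Finset.sum_add_distrib, Finset.sum_const, Finset.sum_const, nsmul_eq_mul,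
    nsmul_eq_mul, mul_one]
  field_simp
  ring

theorem volume_polytope_pos (hP : (interior (V.polytope D)).Nonempty) :
    0 < volume.real (V.polytope D) := by
  have h1 : 0 < volume (V.polytope D) :=
    (isOpen_interior.measure_pos volume hP).trans_le (measure_mono interior_subset)
  exact ENNReal.toReal_pos h1.ne' (V.isCompact_polytope D).measure_lt_top.ne

/-- The averages of a linear form over the points of shifted lattices in the polytope converge to
its value at the barycenter, and the polytope contains such points. -/
theorem tendsto_average (hP : (interior (V.polytope D)).Nonempty) (θ : ℕ → Fin n → ℝ)
    (lam : Fin n → ℝ) :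
    (∀ᶠ m : ℕ in atTop, {u | latticePoint m (θ m) u ∈ V.polytope D}.Nonempty) ∧
    Tendsto (fun m : ℕ => (∑ᶠ u ∈ {u | latticePoint m (θ m) u ∈ V.polytope D},
        ∑ i, latticePoint m (θ m) u i * lam i) /
      ∑ᶠ u ∈ {u | latticePoint m (θ m) u ∈ V.polytope D}, (1 : ℝ)) atTop
      (𝓝 (∑ i, V.barycenter D i * lam i)) := by
  have hlim := fun (F : (Fin n → ℝ) → ℝ) (hF : Continuous F) =>
    tendsto_sum_latticePoint (V.isBounded_polytope D) (V.isClosed_polytope D).measurableSet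
      ((V.convex_polytope D).addHaar_frontier volume) hF θ
  have hvol := volume_polytope_pos hP
  have h1 := hlim (fun _ => 1) continuous_const
  have h2 := hlim (fun x => ∑ i, x i * lam i) (by fun_prop)
  have h3 : ∫ x in V.polytope D, (1 : ℝ) = volume.real (V.polytope D) := by simp
  rw [h3] at h1
  constructor
  · filter_upwards [h1.eventually_ne hvol.ne'] with m hm
    by_contra h
    have h' : ∀ u, latticePoint m (θ m) u ∉ V.polytope D := fun u hu => h ⟨u, hu⟩
    exact hm (by simp [h'])
  · have h4 := h2.div h1 hvol.ne'
    have h5 : (∫ x in V.polytope D, ∑ i, x i * lam i) / volume.real (V.polytope D) =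
        ∑ i, V.barycenter D i * lam i := by
      rw [integral_finsetSum]
      · rw [Finset.sum_div]
        refine Finset.sum_congr rfl fun i _ => ?_
        rw [barycenter_apply, integral_mul_const]
        ring
      · intro i _
        exact (((continuous_apply i).mul continuous_const).continuousOn).integrableOn_compact
          (V.isCompact_polytope D)
    rw [h5] at h4
    refine h4.congr' ?_
    filter_upwards [eventually_gt_atTop 0] with m hm
    have : (1 : ℝ) / (m : ℝ) ^ n ≠ 0 := by positivity
    rw [Pi.div_apply, mul_div_mul_left _ _ this]

theorem exists_hasVal_of_qLinEquiv (hL : IsAmple L) (hLD : QLinEquiv L D)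
    {v : V.X.functionField → ℝ} (hv : IsDivisorial v) : ∃ d, HasVal v D d := by
  obtain ⟨q, hq, hC, -⟩ := hL
  obtain ⟨r, hr, f, hf, hrf⟩ := hLD
  obtain ⟨l, hl⟩ := exists_hasVal hv ⟨q, hq, hC⟩
  have hr' : (r : ℚ) ≠ 0 := by exact_mod_cast hr.ne'
  refine ⟨l + (-1 / r : ℚ) * v f, ?_⟩
  convert hl.add hv ((HasVal.of_div hv hf).smul hv (-1 / r : ℚ)) using 1
  funext x
  have h1 := congrFun hrf x
  rw [Pi.add_apply, Pi.smul_apply, Pi.smul_apply, nsmul_eq_mul, nsmul_eq_mul] at h1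
  rw [Pi.add_apply, Pi.smul_apply, smul_eq_mul]
  field_simp
  linear_combination -h1

theorem neBot_cartierAtTop (hL : IsAmple L) : (cartierAtTop L).NeBot := by
  obtain ⟨q, hq, hC, -⟩ := hL
  rw [cartierAtTop, ← frequently_mem_iff_neBot]
  refine frequently_atTop.mpr fun N => ⟨N * q, Nat.le_mul_of_pos_right _ hq, ?_⟩
  change IsCartier ((N * q) • L)
  rw [mul_smul]
  exact hC.nsmul N

/-- The invariant `S(v)` of an invariant divisorial valuation is the value of `v` at the barycenter
divisor. -/
theorem tendsto_Sm (hL : IsAmple L) (hD : V.IsInvariantDivisor D) (hLD : QLinEquiv L D)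
    {B : QDivisor V.X} (hB : V.IsBarycenterDivisor D B) {v : V.X.functionField → ℝ}
    (hv : v ∈ V.invDivVal) :
    Tendsto (fun m => Sm L m v) (cartierAtTop L) (𝓝 (valDiv v B)) := by
  have hP := interior_polytope_nonempty hL hD hLD
  obtain ⟨d, hd⟩ := exists_hasVal_of_qLinEquiv hL hLD hv.1
  obtain ⟨r, hr, f, hf, hrf⟩ := hLD
  obtain ⟨m', w', hm', hw', rfl⟩ := hB
  have hval : valDiv v (fun x => D x + (1 / (m' : ℚ)) * div (V.chi w') x) =
      d + ∑ i, V.barycenter D i * v (V.chi (Pi.single i 1)) := by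
    have h1 := hd.add hv.1 ((HasVal.of_div hv.1 (V.chi_ne_zero w')).smul hv.1 (1 / m' : ℚ))
    refine (h1.valDiv_eq hv.1).trans ?_
    have hm0 : (m' : ℝ) ≠ 0 := by exact_mod_cast hm'.ne'
    rw [V.val_chi_eq_sum hv.1 w', Finset.mul_sum]
    congr 1
    refine Finset.sum_congr rfl fun i _ => ?_
    rw [hw' i]
    push_cast
    field_simp
  rw [hval]
  have hshift : ∀ m : ℕ, ∃ w : Fin n → ℤ, IsCartier (m • L) →
      ∃ g : V.X.functionField, g ≠ 0 ∧
        m • L = (m • D + (1 / r : ℚ) • div (V.chi w)) + div g := by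
    intro m
    by_cases hm : IsCartier (m • L)
    · obtain ⟨w, g, h⟩ := exists_shift hD hr hf hrf hm
      exact ⟨w, fun _ => ⟨g, h⟩⟩
    · exact ⟨0, fun h => absurd h hm⟩
  choose w hw using hshift
  -- the shifts depend on `m` without any control, but the Riemann sums converge regardless
  obtain ⟨hne, hlim⟩ := tendsto_average hP (fun m i => ((1 / r : ℚ) : ℝ) * w m i)
    fun i => v (V.chi (Pi.single i 1))
  refine ((hlim.const_add d).mono_left (inf_le_left : cartierAtTop L ≤ atTop)).congr' ?_
  have h1 : ∀ᶠ m : ℕ in cartierAtTop L, IsCartier (m • L) :=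
    (eventually_principal.mpr fun _ h => h).filter_mono inf_le_right
  filter_upwards [h1, hne.filter_mono inf_le_left,
    (eventually_gt_atTop 0).filter_mono inf_le_left] with m hm hmne hm0
  obtain ⟨g, hg, hmL⟩ := hw m hm
  exact (Sm_eq hD hm0 hg hmL hv hd rfl hmne).symm

theorem monomialDivisor_eq_toricBasisDivisor {m : ℕ} (hm : 0 < m) (S : Finset (Fin n → ℤ))
    (hS : (S : Set (Fin n → ℤ)) = V.latticePoints D m) (hne : S.Nonempty) :
    monomialDivisor (m • D) m S = V.toricBasisDivisor D m := by
  funext x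
  have hm' : (m : ℚ) ≠ 0 := by exact_mod_cast hm.ne'
  have hN : (S.card : ℚ) ≠ 0 := by exact_mod_cast hne.card_pos.ne'
  rw [monomialDivisor, toricBasisDivisor, ← hS, Set.ncard_coe_finset, finsum_mem_coe_finset,
    ← Finset.mul_sum, Finset.sum_add_distrib, Finset.sum_const, Pi.smul_apply, nsmul_eq_mul,
    nsmul_eq_mul]
  field_simp
  ring

/-- For all sufficiently divisible `m`, the divisor of the basis of characters of `H⁰(X, m L)`
attains the maximum which defines `S_m(v)`, for every invariant valuation `v`. -/
theorem exists_isGreatest_toricBasisDivisor (hL : IsAmple L) (hD : V.IsInvariantDivisor D)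
    (hLD : QLinEquiv L D) : ∃ r : ℕ, 0 < r ∧ ∀ m : ℕ, 0 < m → r ∣ m →
      IsBasisType L m (V.toricBasisDivisor D m) ∧ ∀ v ∈ V.invDivVal,
        IsGreatest (basisTypeValues L m v) (valDiv v (V.toricBasisDivisor D m)) := by
  have hvalD := fun v (hv : v ∈ V.invDivVal) => exists_hasVal_of_qLinEquiv hL hLD hv.1
  obtain ⟨q, hq, s, hs, hs0, U, -, hUne, hU, hU'⟩ := hL.exists_section
  obtain ⟨r, hr, f, hf, hrf⟩ := hLD
  obtain ⟨p₀, hp₀⟩ := eventually_atTop.mp (eventually_mul_pow_mem_H0 hs0 hU hU' one_ne_zero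
    fun y _ => ⟨1, map_one _⟩)
  refine ⟨q * r * (p₀ + 1), by positivity, ?_⟩
  rintro m hm ⟨k, rfl⟩
  have hk : 0 < k := Nat.pos_of_mul_pos_left hm
  have hg : f ^ (q * (p₀ + 1) * k) ≠ 0 := pow_ne_zero _ hf
  have hmL : (q * r * (p₀ + 1) * k) • L =
      (q * r * (p₀ + 1) * k) • D + div (f ^ (q * (p₀ + 1) * k)) := by
    have h := nsmul_eq_nsmul_add_div hf hrf (q * (p₀ + 1) * k)
    rwa [show q * (p₀ + 1) * k * r = q * r * (p₀ + 1) * k by ring] at h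
  have hsec : 1 * s ^ (r * (p₀ + 1) * k) ∈ H0 ((q * r * (p₀ + 1) * k) • L) := by
    have h := hp₀ (r * (p₀ + 1) * k) (by nlinarith [Nat.mul_pos hr hk])
    rwa [show r * (p₀ + 1) * k * q = q * r * (p₀ + 1) * k by ring] at h
  obtain ⟨a, -, ha, u, hu⟩ := exists_mem_sectionExponents (hD.nsmul _) hg hmL hsec
    (mul_ne_zero one_ne_zero (pow_ne_zero _ hs0))
  generalize q * r * (p₀ + 1) * k = m at *
  have hfin : (V.latticePoints D m).Finite := by
    refine (finite_latticePoint_mem (V.isBounded_polytope D) hm 0).subset fun u hu => ?_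
    have h1 : latticePoint m 0 u = fun i => (u i : ℝ) / (m : ℝ) := by
      funext i
      simp [latticePoint]
    exact (h1 ▸ hu : latticePoint m 0 u ∈ V.polytope D)
  have hS : ∀ u, u ∈ hfin.toFinset ↔ u ∈ V.sectionExponents (m • D) := fun u => by
    rw [Set.Finite.mem_toFinset, mem_sectionExponents_nsmul_iff hm]
  have hne : hfin.toFinset.Nonempty := ⟨u, (hS u).mpr (ha u hu)⟩
  rw [← monomialDivisor_eq_toricBasisDivisor hm hfin.toFinset hfin.coe_toFinset hne]
  refine ⟨isBasisType_monomialDivisor (hD.nsmul m) hg hmL _ hS hne, fun v hv => ?_⟩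
  obtain ⟨d, hd⟩ := hvalD v hv
  have hd' : HasVal v (m • D) (m * d) := hd.nsmul hv.1 m
  rw [(hasVal_monomialDivisor hv.1 hm hg hmL _ hne hd').valDiv_eq hv.1]
  exact isGreatest_basisTypeValues (hD.nsmul m) hm hg hmL _ hS hne hv hd'

end ToricVariety

end ToricStability

end

theorem mainTheorem3 (n : ℕ) (V : ToricStability.ToricVariety n)
    (L D₀ : ToricStability.QDivisor V.X)
    (hL : ToricStability.IsAmple L)
    (hD₀ : V.IsInvariantDivisor D₀)
    (hLD₀ : ToricStability.QLinEquiv L D₀) :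
    ∃ B : ToricStability.QDivisor V.X, V.IsBarycenterDivisor D₀ B ∧
      (∃ r : ℕ, 0 < r ∧ ∀ m : ℕ, 0 < m → r ∣ m →
        ToricStability.IsBasisType L m (V.toricBasisDivisor D₀ m) ∧
        ∀ v ∈ V.invDivVal,
          IsGreatest (ToricStability.basisTypeValues L m v)
            (ToricStability.valDiv v (V.toricBasisDivisor D₀ m)) ∧
          ToricStability.Sm L m v = ToricStability.valDiv v (V.toricBasisDivisor D₀ m)) ∧
      (∀ v ∈ V.invDivVal,
        Tendsto (fun m => ToricStability.Sm L m v) (ToricStability.cartierAtTop L)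
          (𝓝 (ToricStability.valDiv v B)) ∧
        ToricStability.SInv L v = ToricStability.valDiv v B) ∧
      ∀ ω : ⋀[V.X.functionField]^n (Ω[V.X.functionField⁄ℂ]), ω ≠ 0 →
        ToricStability.IsQCartier (ToricStability.canonicalDivisor ω) →
        V.deltaT ω L = ⨅ v ∈ V.invDivVal,
          ToricStability.ratio (ToricStability.logDiscrepancy ω v)
            (ToricStability.valDiv v B) := by
  obtain ⟨B, hB⟩ := V.exists_isBarycenterDivisor D₀
  have hT := fun v (hv : v ∈ V.invDivVal) =>
    ToricStability.ToricVariety.tendsto_Sm hL hD₀ hLD₀ hB hv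
  have := ToricStability.ToricVariety.neBot_cartierAtTop hL
  have hS : ∀ v ∈ V.invDivVal, ToricStability.SInv L v = ToricStability.valDiv v B :=
    fun v hv => (hT v hv).limUnder_eq
  obtain ⟨r, hr, h⟩ :=
    ToricStability.ToricVariety.exists_isGreatest_toricBasisDivisor hL hD₀ hLD₀
  refine ⟨B, hB, ⟨r, hr, fun m hm hrm => ⟨(h m hm hrm).1, fun v hv =>
    ⟨(h m hm hrm).2 v hv, ((h m hm hrm).2 v hv).csSup_eq⟩⟩⟩,
    fun v hv => ⟨hT v hv, hS v hv⟩, fun ω _ _ => ?_⟩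
  rw [ToricStability.ToricVariety.deltaT]
  exact iInf_congr fun v => iInf_congr fun hv => by rw [hS v hv]
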